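/- Finite and infinite binary sequences are written as words in $0,1$, and all maps act on the right: $\xi.(fg)=(\xi.f).g$. Let $x$ and $y$ be the bijections of $2^{\mathbb N}$ given by $$00\eta.x=0\eta,\quad 01\eta.x=10\eta,\quad 1\eta.x=11\eta,$$ $$00\eta.y=0(\eta.y),\quad 01\eta.y=10(\eta.y^{-1}),\quad 1\eta.y=11(\eta.y),$$ and for a finite binary sequence $s$ let $x_s$ (resp. $y_s$) be the bijection of $2^{\mathbb N}$ that maps $s\eta$ to $s(\eta.x)$ (resp. $s(\eta.y)$) and fixes every sequence that does not extend $s$. An empty subscript is omitted. For finite sequences $s,t$, the sequence $t.x_s$ is defined as follows: $s00v.x_s=s0v$, $s01v.x_s=s10v$, $s1v.x_s=s11v$, and $t.x_s=t$ if $s,t$ are incompatible (neither is an initial segment of the other); it is undefined otherwise. Let $G$ be the group generated by all $x_s$ and $y_s$, and let $G_0$ be the group generated by $a=x$, $b=x_1$, $c=y_{10}$. Let $R$ be the following set of relations between formal symbols $x_s,y_s$ (for all finite binary sequences $s,t$): 1. $x_s^2=x_{s0}\,x_s\,x_{s1}$; 2. $x_tx_s=x_sx_{t.x_s}$ if $t.x_s$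 is defined; 3. $y_tx_s=x_sy_{t.x_s}$ if $t.x_s$ is defined; 4. $y_sy_t=y_ty_s$ if $s$ and $t$ are incompatible; 5. $y_s=x_s\,y_{s0}\,y_{s10}^{-1}\,y_{s11}$. Let $S_0$ be the set of all symbols $x_s$ together with those $y_s$ for which $s$ is not constant (that is, $s$ contains both digits), and let $R_0$ be the set of those relations in $R$ that only involve symbols in $S_0$. **Theorem.** The symbols $x_s,y_s$ with the relations $R$ give a presentation of $G$, and the symbols in $S_0$ with the relations $R_0$ give a presentation of $G_0$. (In particular $S_0$ generates $G_0$.) Both $G$ and $G_0$ are finitely presented. Moreover, $G_0$ is presented by the three generators $a,b,c$ and the nine relations $$ba^{-2}ba=a^{-1}baba^{-1},\qquad ba^{-3}ba^2=a^{-2}ba^2ba^{-1},$$ $$c\,x_0=x_0\,c,\quad c\,x_{01}=x_{01}\,c,\quad c\,x_{11}=x_{11}\,c,\quad c\,x_{111}=x_{111}\,c,$$ $$y_{01}\,c=c\,y_{01},\qquad y_{001}\,c=c\,y_{001},\qquad c=x_{10}\,y_{100}\,y_{1010}^{-1}\,y_{1011},$$ where $x_0=a^2b^{-1}a^{-1}$,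 $x_{10}=b^2a^{-1}b^{-1}ab^{-1}$, $x_{01}=ax_{10}a^{-1}$, $x_{11}=a^{-1}ba$, $x_{111}=a^{-2}ba^2$, $y_{01}=aca^{-1}$, $y_{001}=a^2ca^{-2}$, $y_{100}=bcb^{-1}$, $y_{1010}=(ba^{-1}b)\,c\,(ba^{-1}b)^{-1}$ and $y_{1011}=(ba^{-1}ba^{-1})\,c\,(ba^{-1}ba^{-1})^{-1}$ denote these words in $a,b,c$. -/

import Mathlib

namespace Cantor

open scoped Stream'

/-! Infinite binary sequences are `Stream' Bool`, finite ones are `List Bool`; the digit `0` is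
`false` and the digit `1` is `true`. -/

/-- `00η ↦ 0η`, `01η ↦ 10η`, `1η ↦ 11η`. -/
def xFun (ξ : Stream' Bool) : Stream' Bool :=
  if ξ.head = true then true :: true :: ξ.tail
  else if ξ.tail.head = true then true :: false :: ξ.tail.tail
  else false :: ξ.tail.tail

/-- `0η ↦ 00η`, `10η ↦ 01η`, `11η ↦ 1η`. -/
def xInvFun (ξ : Stream' Bool) : Stream' Bool :=
  if ξ.head = false then false :: false :: ξ.tail
  else if ξ.tail.head = false then false :: true :: ξ.tail.tail
  else true :: ξ.tail.tail

/-- The homeomorphism `x` of the space of binary sequences. -/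
def xPerm : Equiv.Perm (Stream' Bool) where
  toFun := xFun
  invFun := xInvFun
  left_inv ξ := by
    rw [← Stream'.eta ξ, ← Stream'.eta ξ.tail]
    rcases ξ.head with _ | _ <;> rcases ξ.tail.head with _ | _ <;> simp [xFun, xInvFun]
  right_inv ξ := by
    rw [← Stream'.eta ξ, ← Stream'.eta ξ.tail]
    rcases ξ.head with _ | _ <;> rcases ξ.tail.head with _ | _ <;> simp [xFun, xInvFun]

/-- The digits of `ξ.y` (for `e = true`) and of `ξ.y⁻¹` (for `e = false`). Both are given by one
set of rules, in which `e` stands for the digit `1` in the first case and `0` in the second: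
`eη ↦ ee(η.y^e)`, `ē e η ↦ e ē (η.y^ē)`, `ē ē η ↦ ē (η.y^e)`, where `ē` is the other digit and
`y^1 = y`, `y^0 = y⁻¹`. The lemmas `yFun_true_…` and `yFun_false_…` spell this out. -/
def yDigit : Bool → Stream' Bool → ℕ → Bool
  | e, ξ, 0 => if ξ.head = e then e else if ξ.tail.head = e then e else !e
  | e, ξ, 1 =>
      if ξ.head = e then e
      else if ξ.tail.head = e then !e
      else yDigit e ξ.tail.tail 0
  | e, ξ, n + 2 =>
      if ξ.head = e then yDigit e ξ.tail n
      else if ξ.tail.head = e then yDigit (!e) ξ.tail.tail n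
      else yDigit e ξ.tail.tail (n + 1)

/-- The function `y` (for `e = true`) or `y⁻¹` (for `e = false`). -/
def yFun (e : Bool) (ξ : Stream' Bool) : Stream' Bool := fun n => yDigit e ξ n

theorem yFun_same (e : Bool) (η : Stream' Bool) : yFun e (e :: η) = e :: e :: yFun e η := by
  funext n
  rcases n with _ | _ | n <;> simp [yFun, yDigit, Stream'.cons]

theorem yFun_swap (e : Bool) (η : Stream' Bool) :
    yFun e ((!e) :: e :: η) = e :: (!e) :: yFun (!e) η := by
  funext n
  rcases n with _ | _ | n <;> simp [yFun, yDigit, Stream'.cons]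

theorem yFun_contract (e : Bool) (η : Stream' Bool) :
    yFun e ((!e) :: (!e) :: η) = (!e) :: yFun e η := by
  funext n
  rcases n with _ | _ | n <;> simp [yFun, yDigit, Stream'.cons]

theorem yFun_true_00 (η : Stream' Bool) :
    yFun true (false :: false :: η) = false :: yFun true η := yFun_contract true η

theorem yFun_true_01 (η : Stream' Bool) :
    yFun true (false :: true :: η) = true :: false :: yFun false η := yFun_swap true η

theorem yFun_true_1 (η : Stream' Bool) :
    yFun true (true :: η) = true :: true :: yFun true η := yFun_same true η

theorem yFun_false_0 (η : Stream' Bool) :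
    yFun false (false :: η) = false :: false :: yFun false η := yFun_same false η

theorem yFun_false_10 (η : Stream' Bool) :
    yFun false (true :: false :: η) = false :: true :: yFun true η := yFun_swap false η

theorem yFun_false_11 (η : Stream' Bool) :
    yFun false (true :: true :: η) = true :: yFun false η := yFun_contract false η

theorem yFun_yFun_get (n : ℕ) : ∀ (e : Bool) (ξ : Stream' Bool),
    yFun e (yFun (!e) ξ) n = ξ n := by
  induction n using Nat.strong_induction_on with
  | _ n ih =>
    intro e ξ
    rw [← Stream'.eta ξ, ← Stream'.eta ξ.tail]
    generalize ξ.head = i, ξ.tail.head = j, ξ.tail.tail = η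
    by_cases hi : i = e
    · subst hi
      by_cases hj : j = i
      · subst hj
        have h := yFun_contract (!j) η
        rw [Bool.not_not] at h
        rw [h, yFun_same]
        rcases n with _ | _ | n
        · rfl
        · rfl
        · exact ih n (by omega) j η
      · obtain rfl : j = !i := by cases i <;> cases j <;> simp_all
        have h := yFun_swap (!i) η
        rw [Bool.not_not] at h
        rw [h, yFun_swap]
        rcases n with _ | _ | n
        · rfl
        · rfl
        · have := ih n (by omega) (!i) η
          rw [Bool.not_not] at this
          exact this
    · obtain rfl : i = !e := by cases i <;> cases e <;> simp_all
      rw [yFun_same, yFun_contract]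
      rcases n with _ | n
      · rfl
      · exact ih n (by omega) e (j :: η)

/-- The homeomorphism `y` of the space of binary sequences. -/
def yPerm : Equiv.Perm (Stream' Bool) where
  toFun := yFun true
  invFun := yFun false
  left_inv ξ := funext fun n => yFun_yFun_get n false ξ
  right_inv ξ := funext fun n => yFun_yFun_get n true ξ

/-- `sη ↦ s(η.f)`, and `ξ ↦ ξ` if `ξ` does not extend `s`. -/
def localFun (s : List Bool) (f : Stream' Bool → Stream' Bool) (ξ : Stream' Bool) :
    Stream' Bool :=
  if ξ.take s.length = s then s ++ₛ f (ξ.drop s.length) else ξ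

theorem localFun_append (s : List Bool) (f : Stream' Bool → Stream' Bool) (η : Stream' Bool) :
    localFun s f (s ++ₛ η) = s ++ₛ f η := by
  have h : (s ++ₛ η).take s.length = s := by
    induction s with
    | nil => rfl
    | cons a s ih =>
      rw [Stream'.cons_append_stream, List.length_cons, Stream'.take_succ_cons, ih]
  rw [localFun, if_pos h, Stream'.drop_append_stream]

theorem localFun_of_ne (s : List Bool) (f : Stream' Bool → Stream' Bool) (ξ : Stream' Bool)
    (h : ξ.take s.length ≠ s) : localFun s f ξ = ξ := if_neg h

theorem localFun_localFun (s : List Bool) (f g : Stream' Bool → Stream' Bool)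
    (h : ∀ ξ, f (g ξ) = ξ) (ξ : Stream' Bool) : localFun s f (localFun s g ξ) = ξ := by
  by_cases hs : ξ.take s.length = s
  · have e : ξ = s ++ₛ ξ.drop s.length := by
      conv_lhs => rw [← Stream'.append_take_drop s.length ξ, hs]
    rw [e, localFun_append, localFun_append, h]
  · rw [localFun_of_ne s g ξ hs, localFun_of_ne s f ξ hs]

/-- The copy of the permutation `f` that acts on the sequences extending `s`. -/
def localPerm (s : List Bool) (f : Equiv.Perm (Stream' Bool)) : Equiv.Perm (Stream' Bool) where
  toFun := localFun s f
  invFun := localFun s f.symm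
  left_inv := localFun_localFun s _ _ f.symm_apply_apply
  right_inv := localFun_localFun s _ _ f.apply_symm_apply

/-- The group of permutations of the space of binary sequences, acting on the right: in a product
`f * g` the factor `f` is applied first, `ξ.(fg) = (ξ.f).g`. -/
abbrev RightPerm : Type := (Equiv.Perm (Stream' Bool))ᵐᵒᵖ

/-- The element `x_s`. -/
def x (s : List Bool) : RightPerm := MulOpposite.op (localPerm s xPerm)

/-- The element `y_s`. -/
def y (s : List Bool) : RightPerm := MulOpposite.op (localPerm s yPerm)

/-- The group `G`, generated by all `x_s` and `y_s`. -/
def G : Subgroup RightPerm := Subgroup.closure (Set.range x ∪ Set.range y)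

/-- The group `G₀`, generated by `a = x`, `b = x_1` and `c = y_10`. -/
def G₀ : Subgroup RightPerm := Subgroup.closure {x [], x [true], y [true, false]}

/-- `XAct t s u` says that `t.x_s` is defined and equal to `u`, for finite sequences `s`, `t`, `u`:
the map `x_s` replaces the prefixes `s00`, `s01`, `s1` by `s0`, `s10`, `s11`, and does not change
the sequences that are incompatible with `s`. It is not defined on `s0` and the prefixes of `s`. -/
inductive XAct : List Bool → List Bool → List Bool → Prop
  | zero_zero (s v : List Bool) : XAct (s ++ false :: false :: v) s (s ++ false :: v)
  | zero_one (s v : List Bool) : XAct (s ++ false :: true :: v) s (s ++ true :: false :: v)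
  | one (s v : List Bool) : XAct (s ++ true :: v) s (s ++ true :: true :: v)
  | incompatible (s t : List Bool) (h₁ : ¬ s <+: t) (h₂ : ¬ t <+: s) : XAct t s t

/-- The alphabet `S`: formal symbols for the generators `x_s` and `y_s`. -/
inductive Gen : Type
  | x (s : List Bool) : Gen
  | y (s : List Bool) : Gen

/-- The free group element `x_s`. -/
def fx (s : List Bool) : FreeGroup Gen := FreeGroup.of (Gen.x s)

/-- The free group element `y_s`. -/
def fy (s : List Bool) : FreeGroup Gen := FreeGroup.of (Gen.y s)

/-- The relations `R`; a relation `v = w` is represented by `v * w⁻¹`. -/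
inductive R : Set (FreeGroup Gen)
  /-- `x_s² = x_{s0} x_s x_{s1}` -/
  | pentagon (s : List Bool) :
      R (fx s ^ 2 * (fx (s ++ [false]) * fx s * fx (s ++ [true]))⁻¹)
  /-- `x_t x_s = x_s x_{t.x_s}` if `t.x_s` is defined -/
  | conj_x (s t u : List Bool) (h : XAct t s u) :
      R (fx t * fx s * (fx s * fx u)⁻¹)
  /-- `y_t x_s = x_s y_{t.x_s}` if `t.x_s` is defined -/
  | conj_y (s t u : List Bool) (h : XAct t s u) :
      R (fy t * fx s * (fx s * fy u)⁻¹)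
  /-- `y_s y_t = y_t y_s` if `s` and `t` are incompatible -/
  | comm_y (s t : List Bool) (h₁ : ¬ s <+: t) (h₂ : ¬ t <+: s) :
      R (fy s * fy t * (fy t * fy s)⁻¹)
  /-- `y_s = x_s y_{s0} y_{s10}⁻¹ y_{s11}` -/
  | expand (s : List Bool) :
      R (fy s * (fx s * fy (s ++ [false]) * (fy (s ++ [true, false]))⁻¹
        * fy (s ++ [true, true]))⁻¹)

/-- The alphabet `S₀`: all `x_s`, and those `y_s` for which `s` is not constant. -/
def S₀ : Set Gen :=
  {g | ∀ s, g = Gen.y s → false ∈ s ∧ true ∈ s}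

/-- The relations `R₀`: those relations in `R` which only refer to symbols in `S₀`. -/
def R₀ : Set (FreeGroup S₀) :=
  {w | FreeGroup.map (Subtype.val : S₀ → Gen) w ∈ R}

/-- The permutation denoted by a symbol. -/
def Gen.eval : Gen → RightPerm
  | Gen.x s => Cantor.x s
  | Gen.y s => Cantor.y s

/-- `⟨ι | rels⟩` is a presentation of the subgroup `H`, where the symbol `i` denotes `f i`: the `f i`
generate `H`, and the words that evaluate to `1` are the consequences of `rels`. -/
def IsPresentation {ι K : Type*} [Group K] (f : ι → K) (rels : Set (FreeGroup ι))
    (H : Subgroup K) : Prop :=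
  (FreeGroup.lift f).range = H ∧ (FreeGroup.lift f).ker = Subgroup.normalClosure rels

/-! Words in the three letters `a`, `b`, `c`; the names of the compound words say which `x_s` or
`y_s` they denote. -/

namespace Word

def a : FreeGroup (Fin 3) := FreeGroup.of 0
def b : FreeGroup (Fin 3) := FreeGroup.of 1
def c : FreeGroup (Fin 3) := FreeGroup.of 2
def x0 : FreeGroup (Fin 3) := a ^ 2 * b⁻¹ * a⁻¹
def x10 : FreeGroup (Fin 3) := b ^ 2 * a⁻¹ * b⁻¹ * a * b⁻¹
def x01 : FreeGroup (Fin 3) := a * x10 * a⁻¹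
def x11 : FreeGroup (Fin 3) := a⁻¹ * b * a
def x111 : FreeGroup (Fin 3) := a⁻¹ ^ 2 * b * a ^ 2
def y01 : FreeGroup (Fin 3) := a * c * a⁻¹
def y001 : FreeGroup (Fin 3) := a ^ 2 * c * a⁻¹ ^ 2
def y100 : FreeGroup (Fin 3) := b * c * b⁻¹
def y1010 : FreeGroup (Fin 3) := (b * a⁻¹ * b) * c * (b * a⁻¹ * b)⁻¹
def y1011 : FreeGroup (Fin 3) := (b * a⁻¹ * b * a⁻¹) * c * (b * a⁻¹ * b * a⁻¹)⁻¹

/-- The nine relations of the finite presentation of `G₀`; `v = w` is represented by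
`v * w⁻¹`. -/
def nine : Fin 9 → FreeGroup (Fin 3) :=
  ![b * a⁻¹ ^ 2 * b * a * (a⁻¹ * b * a * b * a⁻¹)⁻¹,
    b * a⁻¹ ^ 3 * b * a ^ 2 * (a⁻¹ ^ 2 * b * a ^ 2 * b * a⁻¹)⁻¹,
    c * x0 * (x0 * c)⁻¹,
    c * x01 * (x01 * c)⁻¹,
    c * x11 * (x11 * c)⁻¹,
    c * x111 * (x111 * c)⁻¹,
    y01 * c * (c * y01)⁻¹,
    y001 * c * (c * y001)⁻¹,
    c * (x10 * y100 * y1010⁻¹ * y1011)⁻¹]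

end Word

end Cantor

/-! The relations hold because a map that replaces the prefix t by u conjugates a copy acting behind
t into the copy acting behind u (`Maps.loc_mul`). Only the pentagon relation and the expansion of y
need a computation.

Completeness rests on a normal form. In any group generated by symbols satisfying the relations (a
`Model`), each element is the image of some f in Thompson's group F, generated by the x_s, times a
product of elements y_s^(±1) with longer indices first. Such a product is recorded as a binary tree
with signs at its vertices. The expansion relation pushes a sign at s to three vertices below s, at
the cost of an element of F, and opposite signs that meet cancel. A sign travels down like an
automaton with three states. A tree is reduced if no sign can meet an opposite one on its way.
`Model.form_val_mul_sg` and `Model.form_val_mul_x` show that reduced normal forms survive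
multiplication by generators.

A reduced tree that contains a sign does not act as an element of F (`YTree.signFree_of_perm_mem`).
Reading 1 as t ↦ t + 1 and 0 as t ↦ t/(1 + t) turns y into t ↦ 2t, so a branch with k signs carries
an integer matrix of determinant 2^k. If the tree acted by prefix replacement, this matrix would be
an integer multiple of a matrix of determinant 1, hence zero modulo 2 when k > 0. But the three
states are the three nonzero covectors modulo 2, and in a reduced tree the covector is never
annihilated. So an element with trivial action has a tree without signs, comes from F, and is
trivial (`Model.Generates.injective`).

Finiteness comes from counting orbits. F matches any two ordered partitions into equally many cones,
so it has four orbits on words and at most eight on pairs of incompatible words taken from left to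
right. Up to conjugation by F, only relations for representatives are needed (`baseModel`), together
with the commutation of each representative y_r with the finitely generated stabilizer of the cone
of r. F itself has two generators and two relations (`exists_hom_F`). Words containing both digits
form one orbit, with two kinds of pairs, whence 2 + 4 + 2 + 1 = 9 relations for G₀. Six generators
and 9 + 10 + 3 relations suffice for G. The injectivity statements hold for an arbitrary group
satisfying these relations, so they also apply to the groups presented by R and R₀. -/

namespace Cantor

open scoped Stream'

/-! ### The right action -/

/-- The image `ξ.f` of a sequence. -/
def app (f : RightPerm) (ξ : Stream' Bool) : Stream' Bool := f.unop ξ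

@[simp] theorem app_mul (f g : RightPerm) (ξ : Stream' Bool) : app (f * g) ξ = app g (app f ξ) := rfl

@[simp] theorem app_inv_app (f : RightPerm) (ξ : Stream' Bool) : app f⁻¹ (app f ξ) = ξ :=
  f.unop.symm_apply_apply ξ

@[simp] theorem app_app_inv (f : RightPerm) (ξ : Stream' Bool) : app f (app f⁻¹ ξ) = ξ :=
  f.unop.apply_symm_apply ξ

theorem ext_app {f g : RightPerm} (h : ∀ ξ, app f ξ = app g ξ) : f = g :=
  MulOpposite.unop_injective (Equiv.ext h)

theorem app_injective (f : RightPerm) : Function.Injective (app f) := f.unop.injective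

theorem app_inv_eq {f : RightPerm} {ξ ζ : Stream' Bool} (h : app f ξ = ζ) : app f⁻¹ ζ = ξ := by
  rw [← h, app_inv_app]

theorem append_stream_inj (s : List Bool) {η η' : Stream' Bool} (h : s ++ₛ η = s ++ₛ η') : η = η' := by
  have := congrArg (Stream'.drop s.length) h
  rwa [Stream'.drop_append_stream, Stream'.drop_append_stream] at this

theorem take_append_stream (s : List Bool) (η : Stream' Bool) : (s ++ₛ η).take s.length = s := by
  induction s with
  | nil => rfl
  | cons a s ih => rw [Stream'.cons_append_stream, List.length_cons, Stream'.take_succ_cons, ih]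

theorem append_stream_eq_of_length {s t : List Bool} {η η' : Stream' Bool}
    (hl : s.length = t.length) (h : s ++ₛ η = t ++ₛ η') : s = t := by
  rw [← take_append_stream s η, h, hl, take_append_stream]

/-! ### Incompatible words -/

/-- Neither word is a prefix of the other. -/
def Incomp (s t : List Bool) : Prop := ¬ s <+: t ∧ ¬ t <+: s

theorem Incomp.symm {s t : List Bool} (h : Incomp s t) : Incomp t s := ⟨h.2, h.1⟩

theorem Incomp.append_left {s t : List Bool} (h : Incomp s t) (v : List Bool) :
    Incomp (s ++ v) t := by
  refine ⟨fun h' => h.1 ((List.prefix_append s v).trans h'), fun h' => ?_⟩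
  rcases List.prefix_or_prefix_of_prefix h' (List.prefix_append s v) with h'' | h''
  · exact h.2 h''
  · exact h.1 h''

theorem Incomp.append_right {s t : List Bool} (h : Incomp s t) (v : List Bool) :
    Incomp s (t ++ v) := (h.symm.append_left v).symm

@[simp] theorem incomp_cons_same {d : Bool} {s t : List Bool} :
    Incomp (d :: s) (d :: t) ↔ Incomp s t := by
  simp [Incomp, List.cons_prefix_cons]

theorem incomp_cons_not (d : Bool) (s t : List Bool) : Incomp (d :: s) ((!d) :: t) := by
  simp [Incomp, List.cons_prefix_cons]

@[simp] theorem incomp_append_same {p s t : List Bool} : Incomp (p ++ s) (p ++ t) ↔ Incomp s t := by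
  induction p with
  | nil => rfl
  | cons d p ih => simpa using ih

theorem incomp_nil_left {s : List Bool} : ¬ Incomp [] s := fun h => h.1 List.nil_prefix

theorem incomp_nil_right {s : List Bool} : ¬ Incomp s [] := fun h => h.2 List.nil_prefix

theorem Incomp.exists_split {s t : List Bool} (h : Incomp s t) :
    ∃ (p : List Bool) (d : Bool) (a b : List Bool), s = p ++ d :: a ∧ t = p ++ (!d) :: b := by
  induction s generalizing t with
  | nil => exact (incomp_nil_left h).elim
  | cons c s ih =>
    cases t with
    | nil => exact (incomp_nil_right h).elim
    | cons e t =>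
      by_cases hce : e = c
      · subst hce
        obtain ⟨p, d, a, b, rfl, rfl⟩ := ih (incomp_cons_same.1 h)
        exact ⟨e :: p, d, a, b, rfl, rfl⟩
      · exact ⟨[], c, s, t, rfl, by cases c <;> cases e <;> simp_all⟩

theorem Incomp.append_stream_ne {s t : List Bool} (h : Incomp s t) (η η' : Stream' Bool) :
    s ++ₛ η ≠ t ++ₛ η' := by
  obtain ⟨p, d, a, b, rfl, rfl⟩ := h.exists_split
  intro h
  rw [Stream'.append_append_stream, Stream'.append_append_stream] at h
  have := congrArg Stream'.head (append_stream_inj p h)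
  simp [Stream'.cons_append_stream] at this

/-! ### Localization -/

theorem append_or_forall_ne (s : List Bool) (ξ : Stream' Bool) :
    (∃ η, ξ = s ++ₛ η) ∨ ∀ η, ξ ≠ s ++ₛ η := by
  by_cases h : ∃ η, ξ = s ++ₛ η
  · exact Or.inl h
  · exact Or.inr (not_exists.1 h)

/-- The homomorphism that sends `f` to its copy acting on the sequences extending `s`. -/
def loc (s : List Bool) : RightPerm →* RightPerm where
  toFun f := MulOpposite.op (localPerm s f.unop)
  map_one' := by
    refine ext_app fun ξ => ?_
    rcases append_or_forall_ne s ξ with ⟨η, rfl⟩ | h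
    · exact localFun_append s _ η
    · refine localFun_of_ne s _ ξ fun h' => h (ξ.drop s.length) ?_
      conv_lhs => rw [← Stream'.append_take_drop s.length ξ, h']
  map_mul' f g := by
    refine ext_app fun ξ => ?_
    rcases append_or_forall_ne s ξ with ⟨η, rfl⟩ | h
    · change localFun s _ _ = localFun s _ (localFun s _ _)
      simp only [localFun_append]
      rfl
    · have : ξ.take s.length ≠ s := fun h' => h (ξ.drop s.length) (by
        conv_lhs => rw [← Stream'.append_take_drop s.length ξ, h'])
      change localFun s _ _ = localFun s _ (localFun s _ _)
      rw [localFun_of_ne s _ ξ this, localFun_of_ne s _ ξ this, localFun_of_ne s _ ξ this]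

@[simp] theorem app_loc_append (s : List Bool) (f : RightPerm) (η : Stream' Bool) :
    app (loc s f) (s ++ₛ η) = s ++ₛ app f η := localFun_append s _ η

theorem app_loc_of_ne (s : List Bool) (f : RightPerm) (ξ : Stream' Bool) (h : ∀ η, ξ ≠ s ++ₛ η) :
    app (loc s f) ξ = ξ := by
  refine localFun_of_ne s _ ξ fun h' => h (ξ.drop s.length) ?_
  conv_lhs => rw [← Stream'.append_take_drop s.length ξ, h']

theorem app_loc_incomp {s t : List Bool} (h : Incomp s t) (f : RightPerm) (η : Stream' Bool) :
    app (loc s f) (t ++ₛ η) = t ++ₛ η :=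
  app_loc_of_ne s f _ fun η' => h.symm.append_stream_ne η η'

theorem loc_nil (f : RightPerm) : loc [] f = f := ext_app fun ξ => app_loc_append [] f ξ

theorem loc_loc (s t : List Bool) (f : RightPerm) : loc s (loc t f) = loc (s ++ t) f := by
  refine ext_app fun ξ => ?_
  rcases append_or_forall_ne s ξ with ⟨η, rfl⟩ | h
  · rw [app_loc_append]
    rcases append_or_forall_ne t η with ⟨η, rfl⟩ | h
    · rw [app_loc_append, ← Stream'.append_append_stream, ← Stream'.append_append_stream,
        app_loc_append]
    · rw [app_loc_of_ne t f η h, app_loc_of_ne]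
      intro η' h'
      rw [Stream'.append_append_stream] at h'
      exact h η' (append_stream_inj s h')
  · rw [app_loc_of_ne s _ ξ h, app_loc_of_ne]
    intro η' h'
    rw [Stream'.append_append_stream] at h'
    exact h _ h'

theorem loc_injective (s : List Bool) : Function.Injective (loc s) := fun f g h =>
  ext_app fun ξ => append_stream_inj s (by rw [← app_loc_append, h, app_loc_append])

theorem commute_loc {s t : List Bool} (h : Incomp s t) (f g : RightPerm) :
    Commute (loc s f) (loc t g) := by
  refine ext_app fun ξ => ?_
  rw [app_mul, app_mul]
  rcases append_or_forall_ne s ξ with ⟨η, rfl⟩ | h₁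
  · rw [app_loc_append, app_loc_incomp h.symm, app_loc_incomp h.symm, app_loc_append]
  · rcases append_or_forall_ne t ξ with ⟨η, rfl⟩ | h₂
    · rw [app_loc_append, app_loc_incomp h, app_loc_incomp h, app_loc_append]
    · rw [app_loc_of_ne s f ξ h₁, app_loc_of_ne t g ξ h₂, app_loc_of_ne s f ξ h₁]

theorem x_eq_loc (s : List Bool) : x s = loc s (x []) := by
  change loc s (MulOpposite.op xPerm) = loc s (loc [] (MulOpposite.op xPerm))
  rw [loc_nil]

theorem y_eq_loc (s : List Bool) : y s = loc s (y []) := by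
  change loc s (MulOpposite.op yPerm) = loc s (loc [] (MulOpposite.op yPerm))
  rw [loc_nil]

theorem loc_x (s t : List Bool) : loc s (x t) = x (s ++ t) := by
  rw [x_eq_loc t, loc_loc, ← x_eq_loc]

theorem loc_y (s t : List Bool) : loc s (y t) = y (s ++ t) := by
  rw [y_eq_loc t, loc_loc, ← y_eq_loc]

/-! ### Prefix replacement -/

/-- `f` replaces the prefix `t` by `u`. -/
def Maps (f : RightPerm) (t u : List Bool) : Prop := ∀ η, app f (t ++ₛ η) = u ++ₛ η

theorem maps_one (t : List Bool) : Maps 1 t t := fun _ => rfl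

theorem Maps.mul {f g : RightPerm} {t u v : List Bool} (hf : Maps f t u) (hg : Maps g u v) :
    Maps (f * g) t v := fun η => by rw [app_mul, hf, hg]

theorem Maps.inv {f : RightPerm} {t u : List Bool} (hf : Maps f t u) : Maps f⁻¹ u t :=
  fun η => app_inv_eq (hf η)

theorem Maps.append {f : RightPerm} {t u : List Bool} (hf : Maps f t u) (v : List Bool) :
    Maps f (t ++ v) (u ++ v) := fun η => by
  rw [Stream'.append_append_stream, hf, Stream'.append_append_stream]

theorem Maps.loc {f : RightPerm} {t u : List Bool} (hf : Maps f t u) (s : List Bool) :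
    Maps (loc s f) (s ++ t) (s ++ u) := fun η => by
  rw [Stream'.append_append_stream, app_loc_append, hf, Stream'.append_append_stream]

theorem Incomp.maps_loc {s t : List Bool} (h : Incomp s t) (f : RightPerm) : Maps (Cantor.loc s f) t t :=
  app_loc_incomp h f

/-- Conjugation moves a localized element along a prefix replacement. -/
theorem Maps.loc_mul {f : RightPerm} {t u : List Bool} (h : Maps f t u) (g : RightPerm) :
    Cantor.loc t g * f = f * Cantor.loc u g := by
  refine ext_app fun ξ => ?_
  rw [app_mul, app_mul]
  rcases append_or_forall_ne t ξ with ⟨η, rfl⟩ | h'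
  · rw [app_loc_append, h, h, app_loc_append]
  -- Since f is injective and maps the cone of t onto the cone of u, a sequence outside the former
  -- is sent outside the latter.
  · rw [app_loc_of_ne t g ξ h', app_loc_of_ne]
    intro η hη
    exact h' η (app_injective f (hη.trans (h η).symm))

/-! ### The relations hold -/

theorem app_x_nil (ξ : Stream' Bool) : app (x []) ξ = xFun ξ := localFun_append [] _ ξ

theorem app_y_nil (ξ : Stream' Bool) : app (y []) ξ = yFun true ξ := localFun_append [] _ ξ

theorem app_y_nil_inv (ξ : Stream' Bool) : app (y [])⁻¹ ξ = yFun false ξ := localFun_append [] _ ξ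

theorem maps_x_00 : Maps (x []) [false, false] [false] := fun η => by
  rw [app_x_nil]; simp [xFun, Stream'.cons_append_stream]

theorem maps_x_01 : Maps (x []) [false, true] [true, false] := fun η => by
  rw [app_x_nil]; simp [xFun, Stream'.cons_append_stream]

theorem maps_x_1 : Maps (x []) [true] [true, true] := fun η => by
  rw [app_x_nil]; simp [xFun, Stream'.cons_append_stream]

theorem maps_x_append {t u : List Bool} (h : Maps (x []) t u) (s v : List Bool) :
    Maps (x s) (s ++ (t ++ v)) (s ++ (u ++ v)) := by
  rw [x_eq_loc]
  exact (h.append v).loc s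

theorem XAct.maps {s t u : List Bool} (h : XAct t s u) : Maps (x s) t u := by
  cases h with
  | zero_zero s v => exact maps_x_append maps_x_00 s v
  | zero_one s v => exact maps_x_append maps_x_01 s v
  | one s v => exact maps_x_append maps_x_1 s v
  | incompatible s t h₁ h₂ => rw [x_eq_loc]; exact Incomp.maps_loc ⟨h₁, h₂⟩ _

/-- Every sequence extends `00`, `01` or `1`. -/
theorem stream_cases (ξ : Stream' Bool) : (∃ η, ξ = [false, false] ++ₛ η) ∨
    (∃ η, ξ = [false, true] ++ₛ η) ∨ ∃ η, ξ = [true] ++ₛ η := by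
  rw [← Stream'.eta ξ, ← Stream'.eta ξ.tail]
  generalize ξ.head = i, ξ.tail.head = j, ξ.tail.tail = η
  cases i
  · cases j
    · exact Or.inl ⟨η, rfl⟩
    · exact Or.inr (Or.inl ⟨η, rfl⟩)
  · exact Or.inr (Or.inr ⟨_, rfl⟩)

/-- Both sides replace the prefixes 000, 001, 01, 1 by 0, 10, 110, 111. -/
theorem x_pentagon_nil : x [] ^ 2 = x [false] * x [] * x [true] := by
  refine ext_app fun ξ => ?_
  rw [pow_two]
  simp only [app_mul]
  rcases stream_cases ξ with ⟨η, rfl⟩ | ⟨η, rfl⟩ | ⟨η, rfl⟩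
  · rcases stream_cases ([false] ++ₛ η) with ⟨η', h⟩ | ⟨η', h⟩ | ⟨η', h⟩
    · obtain rfl : η = [false] ++ₛ η' := (append_stream_inj [false] h)
      have h1 := maps_x_append maps_x_00 [false] []
      have h2 := Incomp.maps_loc (incomp_cons_not true [] []) (x [])
      rw [← x_eq_loc] at h2
      exact ((maps_x_00.append [false]).mul maps_x_00 η').trans
        ((h1.mul (maps_x_00.mul h2)) η').symm
    · obtain rfl : η = [true] ++ₛ η' := (append_stream_inj [false] h)
      have h1 := maps_x_append maps_x_01 [false] []
      have h2 := maps_x_append maps_x_00 [true] []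
      exact ((maps_x_00.append [true]).mul maps_x_01 η').trans
        ((h1.mul ((maps_x_01.append [false]).mul h2)) η').symm
    · exact absurd (congrArg Stream'.head h) (by simp [Stream'.cons_append_stream])
  · have h1 := maps_x_append maps_x_1 [false] []
    have h2 := maps_x_append maps_x_01 [true] []
    exact (maps_x_01.mul (maps_x_1.append [false]) η).trans
        ((h1.mul ((maps_x_01.append [true]).mul h2)) η).symm
  · have h1 := Incomp.maps_loc (incomp_cons_not false [] []) (x [])
    rw [← x_eq_loc] at h1
    have h2 := maps_x_append maps_x_1 [true] []
    exact (maps_x_1.mul (maps_x_1.append [true]) η).trans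
        ((h1.mul (maps_x_1.mul h2)) η).symm

theorem x_pentagon (s : List Bool) : x s ^ 2 = x (s ++ [false]) * x s * x (s ++ [true]) := by
  have := congrArg (loc s) x_pentagon_nil
  simpa only [map_mul, map_pow, loc_x, List.append_nil] using this

theorem app_y_append (s : List Bool) (η : Stream' Bool) :
    app (y s) (s ++ₛ η) = s ++ₛ yFun true η := by
  rw [y_eq_loc, app_loc_append, app_y_nil]

theorem app_y_inv_append (s : List Bool) (η : Stream' Bool) :
    app (y s)⁻¹ (s ++ₛ η) = s ++ₛ yFun false η := by
  rw [y_eq_loc, ← map_inv, app_loc_append, app_y_nil_inv]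

theorem app_y_incomp {s t : List Bool} (h : Incomp s t) (η : Stream' Bool) :
    app (y s) (t ++ₛ η) = t ++ₛ η := by
  rw [y_eq_loc, app_loc_incomp h]

theorem app_y_inv_incomp {s t : List Bool} (h : Incomp s t) (η : Stream' Bool) :
    app (y s)⁻¹ (t ++ₛ η) = t ++ₛ η := by
  rw [y_eq_loc, ← map_inv, app_loc_incomp h]

/-- This is the recursion defining y: the factor x changes the prefix, and the other three apply y,
y⁻¹, y behind the new prefixes 0, 10, 11. -/
theorem y_expand_nil : y [] = x [] * y [false] * (y [true, false])⁻¹ * y [true, true] := by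
  refine ext_app fun ξ => ?_
  simp only [app_mul, app_y_nil]
  have h01 (a b : List Bool) : Incomp (false :: a) (true :: b) := incomp_cons_not false a b
  have h10 (a b : List Bool) : Incomp (true :: a) (false :: b) := incomp_cons_not true a b
  rcases stream_cases ξ with ⟨η, rfl⟩ | ⟨η, rfl⟩ | ⟨η, rfl⟩
  · rw [maps_x_00, app_y_append, app_y_inv_incomp (h10 _ _), app_y_incomp (h10 _ _)]
    exact yFun_true_00 η
  · rw [maps_x_01, app_y_incomp (h01 _ _), app_y_inv_append,
      app_y_incomp (incomp_cons_same.2 (h10 _ _))]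
    exact yFun_true_01 η
  · rw [maps_x_1, app_y_incomp (h01 _ _), app_y_inv_incomp (incomp_cons_same.2 (h01 _ _)),
      app_y_append]
    exact yFun_true_1 η

theorem y_expand (s : List Bool) :
    y s = x s * y (s ++ [false]) * (y (s ++ [true, false]))⁻¹ * y (s ++ [true, true]) := by
  have := congrArg (loc s) y_expand_nil
  simpa only [map_mul, map_inv, loc_x, loc_y, List.append_nil] using this

theorem Maps.x_mul {f : RightPerm} {t u : List Bool} (h : Maps f t u) : x t * f = f * x u := by
  rw [x_eq_loc t, x_eq_loc u, h.loc_mul]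

theorem Maps.y_mul {f : RightPerm} {t u : List Bool} (h : Maps f t u) : y t * f = f * y u := by
  rw [y_eq_loc t, y_eq_loc u, h.loc_mul]

theorem commute_y {s t : List Bool} (h : Incomp s t) : Commute (y s) (y t) := by
  rw [y_eq_loc s, y_eq_loc t]; exact commute_loc h _ _

theorem lift_eval_of_mem_R {w : FreeGroup Gen} (hw : w ∈ R) : FreeGroup.lift Gen.eval w = 1 := by
  cases hw with
  | pentagon s => simp [fx, Gen.eval, x_pentagon]
  | conj_x s t u h => simp [fx, Gen.eval, h.maps.x_mul]
  | conj_y s t u h => simp [fx, fy, Gen.eval, h.maps.y_mul]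
  | comm_y s t h₁ h₂ =>
    simp [fy, Gen.eval, (commute_y (s := s) (t := t) ⟨h₁, h₂⟩).eq]
  | expand s => rw [map_mul, map_inv, mul_inv_eq_one]; simpa [fx, fy, Gen.eval] using y_expand s

/-! ### Thompson's group `F` -/

/-- The group generated by all `x_s`. -/
def F : Subgroup RightPerm := Subgroup.closure (Set.range x)

theorem x_mem_F (s : List Bool) : x s ∈ F := Subgroup.subset_closure ⟨s, rfl⟩

theorem XAct.zero_zero_nil (v : List Bool) : XAct (false :: false :: v) [] (false :: v) :=
  XAct.zero_zero [] v

theorem XAct.zero_one_nil (v : List Bool) : XAct (false :: true :: v) [] (true :: false :: v) :=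
  XAct.zero_one [] v

theorem XAct.one_nil (v : List Bool) : XAct (true :: v) [] (true :: true :: v) := XAct.one [] v

/-- A property of words that is invariant under the partial actions of `x` and of the `x_s` with
`s = 1…1` only has to be checked on four words. -/
theorem XAct.word_induction {P : List Bool → Prop}
    (h₁ : ∀ t u, XAct t [] u → P t → P u)
    (h₂ : ∀ k t u, XAct t (List.replicate k true) u → P u → P t) (hnil : P []) (h0 : P [false])
    (h1 : P [true]) (h10 : P [true, false]) (s : List Bool) : P s := by
  have hone (k : ℕ) : P (List.replicate (k + 1) true) := by
    induction k with
    | zero => exact h1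
    | succ k ih => exact h₁ _ _ (XAct.one_nil _) ih
  have hone' (k : ℕ) : P (List.replicate k true ++ [false]) := by
    induction k with
    | zero => exact h0
    | succ k ih =>
      cases k with
      | zero => exact h10
      | succ k => exact h₁ _ _ (XAct.one_nil _) ih
  -- The action of x_{1…1} shortens the part behind the first 0 by one letter, possibly adding a
  -- leading 1. Hence the induction on this part treats all k at once.
  have hgen (v : List Bool) : ∀ k, P (List.replicate k true ++ false :: v) := by
    induction v with
    | nil => exact hone'
    | cons d v ih =>
      intro k
      cases d
      · exact h₂ _ _ _ (XAct.zero_zero _ _) (ih k)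
      · refine h₂ _ _ _ (XAct.zero_one _ _) ?_
        have := ih (k + 1)
        rwa [List.replicate_succ', List.append_assoc] at this
  have hdec (s : List Bool) : ∃ k, s = List.replicate k true ∨
      ∃ v : List Bool, s = List.replicate k true ++ false :: v := by
    induction s with
    | nil => exact ⟨0, Or.inl rfl⟩
    | cons d s ih =>
      cases d
      · exact ⟨0, Or.inr ⟨s, rfl⟩⟩
      · obtain ⟨k, rfl | ⟨v, rfl⟩⟩ := ih
        · exact ⟨k + 1, Or.inl rfl⟩
        · exact ⟨k + 1, Or.inr ⟨v, rfl⟩⟩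
  obtain ⟨k, rfl | ⟨v, rfl⟩⟩ := hdec s
  · cases k with
    | zero => exact hnil
    | succ k => exact hone k
  · exact hgen v k

/-- In a group in which the relations between the `x_s` hold, all of them lie in the subgroup
generated by `x` and `x_1`. -/
theorem mem_of_relations {M : Type*} [Group M] {X : List Bool → M}
    (hp : ∀ s, X s ^ 2 = X (s ++ [false]) * X s * X (s ++ [true]))
    (hc : ∀ s t u, XAct t s u → X t * X s = X s * X u) {H : Subgroup M} (h : X [] ∈ H)
    (h1 : X [true] ∈ H) (s : List Bool) : X s ∈ H := by
  have hp' (s) (hs : X s ∈ H) (hs' : X (s ++ [true]) ∈ H) : X (s ++ [false]) ∈ H := by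
    rw [show X (s ++ [false]) = X s ^ 2 * (X (s ++ [true]))⁻¹ * (X s)⁻¹ by rw [hp]; group]
    exact mul_mem (mul_mem (pow_mem hs 2) (inv_mem hs')) (inv_mem hs)
  have hfwd {s t u} (hs : X s ∈ H) (htu : XAct t s u) (ht : X t ∈ H) : X u ∈ H := by
    rw [← inv_mul_eq_iff_eq_mul.2 (hc s t u htu)]
    exact mul_mem (inv_mem hs) (mul_mem ht hs)
  have hbwd {s t u} (hs : X s ∈ H) (htu : XAct t s u) (hu : X u ∈ H) : X t ∈ H := by
    rw [eq_mul_inv_of_mul_eq (hc s t u htu)]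
    exact mul_mem (mul_mem hs hu) (inv_mem hs)
  have hone (k : ℕ) : X (List.replicate k true) ∈ H := by
    rcases k with _ | k
    · exact h
    · induction k with
      | zero => exact h1
      | succ k ih => exact hfwd h (XAct.one_nil _) ih
  exact XAct.word_induction (P := fun s => X s ∈ H) (fun t u htu => hfwd h htu)
    (fun k t u htu => hbwd (hone k) htu) h (hp' [] h h1) h1 (hp' [true] h1 (hone 2)) s

theorem F_eq_closure : F = Subgroup.closure {x [], x [true]} := by
  refine le_antisymm ((Subgroup.closure_le _).2 ?_) (Subgroup.closure_mono ?_)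
  · rintro _ ⟨s, rfl⟩
    exact mem_of_relations x_pentagon (fun s t u h => h.maps.x_mul)
      (Subgroup.subset_closure (by simp)) (Subgroup.subset_closure (by simp)) s
  · rintro _ (rfl | rfl)
    exacts [⟨_, rfl⟩, ⟨_, rfl⟩]

/-- An induction principle for `F`: closure under multiplication by the generators and their
inverses. -/
theorem F_induction {P : RightPerm → Prop} (h1 : P 1) (hx : ∀ s, P (x s)) (hx' : ∀ s, P (x s)⁻¹)
    (hmul : ∀ f g, P f → P g → P (f * g)) {f : RightPerm} (hf : f ∈ F) : P f := by
  refine Subgroup.closure_induction'' (p := fun f _ => P f) ?_ ?_ h1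
    (fun f g _ _ => hmul f g) hf
  · rintro _ ⟨s, rfl⟩; exact hx s
  · rintro _ ⟨s, rfl⟩; exact hx' s

theorem loc_mem_F (s : List Bool) {f : RightPerm} (hf : f ∈ F) : loc s f ∈ F := by
  refine F_induction (P := fun f => loc s f ∈ F) ?_ ?_ ?_ ?_ hf
  · rw [map_one]; exact one_mem F
  · intro t; rw [loc_x]; exact x_mem_F _
  · intro t; rw [map_inv, loc_x]; exact inv_mem (x_mem_F _)
  · intro f g h h'; rw [map_mul]; exact mul_mem h h'

/-! ### Elements of `F` replace long prefixes -/

/-- `f` replaces all sufficiently long prefixes by long prefixes. -/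
def LocPrefix (f : RightPerm) : Prop :=
  ∀ m : ℕ, ∃ n : ℕ, ∀ t : List Bool, n ≤ t.length → ∃ u : List Bool, m ≤ u.length ∧ Maps f t u

theorem locPrefix_loc {f : RightPerm} (hf : LocPrefix f) (s : List Bool) : LocPrefix (loc s f) := by
  intro m
  obtain ⟨n, hn⟩ := hf m
  refine ⟨s.length + n + m, fun t ht => ?_⟩
  by_cases hst : s <+: t
  · obtain ⟨v, rfl⟩ := hst
    obtain ⟨u, hu, huv⟩ := hn v (by rw [List.length_append] at ht; omega)
    exact ⟨s ++ u, by rw [List.length_append]; omega, huv.loc s⟩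
  -- The word t is at least as long as s, so it could be a prefix of s only by being equal to s.
  · refine ⟨t, by omega, Incomp.maps_loc ⟨hst, fun h => hst ?_⟩ f⟩
    have := h.length_le
    rw [h.eq_of_length (by omega)]

theorem exists_cons_cons {n : ℕ} {t : List Bool} (h : n + 2 ≤ t.length) :
    ∃ (i j : Bool) (v : List Bool), t = i :: j :: v ∧ n ≤ v.length := by
  rcases t with _ | ⟨i, _ | ⟨j, v⟩⟩
  · simp at h
  · simp at h
  · exact ⟨i, j, v, rfl, by simpa using h⟩

theorem locPrefix_x : LocPrefix (x []) := by
  intro m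
  refine ⟨m + 2, fun t ht => ?_⟩
  obtain ⟨i, j, v, rfl, hv⟩ := exists_cons_cons ht
  cases i
  · cases j
    · exact ⟨_, by simp; omega, maps_x_00.append v⟩
    · exact ⟨_, by simp; omega, maps_x_01.append v⟩
  · exact ⟨_, by simp; omega, maps_x_1.append (j :: v)⟩

theorem locPrefix_x_inv : LocPrefix (x [])⁻¹ := by
  intro m
  refine ⟨m + 2, fun t ht => ?_⟩
  obtain ⟨i, j, v, rfl, hv⟩ := exists_cons_cons ht
  cases i
  · exact ⟨_, by simp; omega, maps_x_00.inv.append (j :: v)⟩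
  · cases j
    · exact ⟨_, by simp; omega, maps_x_01.inv.append v⟩
    · exact ⟨_, by simp; omega, maps_x_1.inv.append v⟩

/-- The lower bound on the length of the image is what makes the property stable under composition.
-/
theorem locPrefix_of_mem_F {f : RightPerm} (hf : f ∈ F) : LocPrefix f := by
  refine F_induction (P := LocPrefix) (fun m => ⟨m, fun t ht => ⟨t, ht, maps_one t⟩⟩) ?_ ?_ ?_ hf
  · intro s; rw [x_eq_loc]; exact locPrefix_loc locPrefix_x s
  · intro s; rw [x_eq_loc, ← map_inv]; exact locPrefix_loc locPrefix_x_inv s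
  · intro f g hf hg m
    obtain ⟨k, hk⟩ := hg m
    obtain ⟨n, hn⟩ := hf k
    refine ⟨n, fun t ht => ?_⟩
    obtain ⟨u, hu, htu⟩ := hn t ht
    obtain ⟨v, hv, huv⟩ := hk u hu
    exact ⟨v, hv, htu.mul huv⟩

/-! ### Elements of `F` preserve the order -/

/-- The lexicographic order on sequences. -/
def SLt (ξ η : Stream' Bool) : Prop :=
  ∃ (p : List Bool) (a b : Stream' Bool), ξ = p ++ₛ ([false] ++ₛ a) ∧ η = p ++ₛ ([true] ++ₛ b)

@[simp] theorem sLt_cons {d e : Bool} {ξ η : Stream' Bool} :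
    SLt (d :: ξ) (e :: η) ↔ (d = false ∧ e = true) ∨ (d = e ∧ SLt ξ η) := by
  constructor
  · rintro ⟨p, a, b, h₁, h₂⟩
    cases p with
    | nil => exact Or.inl ⟨congrArg Stream'.head h₁, congrArg Stream'.head h₂⟩
    | cons c p =>
      obtain rfl : d = c := congrArg Stream'.head h₁
      obtain rfl : e = d := congrArg Stream'.head h₂
      exact Or.inr ⟨rfl, p, a, b, congrArg Stream'.tail h₁, congrArg Stream'.tail h₂⟩
  · rintro (⟨rfl, rfl⟩ | ⟨rfl, p, a, b, rfl, rfl⟩)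
    · exact ⟨[], ξ, η, rfl, rfl⟩
    · exact ⟨d :: p, a, b, rfl, rfl⟩

theorem sLt_append {s : List Bool} {ξ η : Stream' Bool} :
    SLt (s ++ₛ ξ) (s ++ₛ η) ↔ SLt ξ η := by
  induction s with
  | nil => rfl
  | cons d s ih => rw [Stream'.cons_append_stream, Stream'.cons_append_stream, sLt_cons, ih]; simp

theorem sLt_irrefl (ξ : Stream' Bool) : ¬ SLt ξ ξ := by
  rintro ⟨p, a, b, h₁, h₂⟩
  have := append_stream_inj p (h₁.symm.trans h₂)
  exact absurd (congrArg Stream'.head this) (by simp)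

theorem sLt_asymm {ξ η : Stream' Bool} (h : SLt ξ η) : ¬ SLt η ξ := by
  obtain ⟨p, a, b, rfl, rfl⟩ := h
  rw [sLt_append]
  simp

theorem sLt_or_sLt {ξ η : Stream' Bool} (h : ξ ≠ η) : SLt ξ η ∨ SLt η ξ := by
  classical
  have hex : ∃ n, ξ.get n ≠ η.get n := by
    by_contra! h'
    exact h (Stream'.ext h')
  obtain ⟨n, hn, hmin⟩ : ∃ n, ξ.get n ≠ η.get n ∧ ∀ m < n, ξ.get m = η.get m :=
    ⟨Nat.find hex, Nat.find_spec hex, fun m hm => not_not.1 (Nat.find_min hex hm)⟩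
  clear hex h
  induction n generalizing ξ η with
  | zero =>
    rw [← Stream'.eta ξ, ← Stream'.eta η, sLt_cons, sLt_cons]
    change ξ.head ≠ η.head at hn
    cases h₁ : ξ.head <;> cases h₂ : η.head <;> simp_all
  | succ n ih =>
    have h0 : ξ.head = η.head := hmin 0 (by omega)
    rw [← Stream'.eta ξ, ← Stream'.eta η, sLt_cons, sLt_cons, h0]
    simpa using ih (ξ := ξ.tail) (η := η.tail) hn fun m hm => hmin (m + 1) (by omega)

theorem not_sLt_const_false (ξ : Stream' Bool) : ¬ SLt ξ (Stream'.const false) := by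
  rintro ⟨p, a, b, -, h⟩
  have := congrArg (fun ζ => Stream'.get ζ p.length) h
  rw [Stream'.get_append_length] at this
  simp at this

theorem not_const_true_sLt (ξ : Stream' Bool) : ¬ SLt (Stream'.const true) ξ := by
  rintro ⟨p, a, b, h, -⟩
  have := congrArg (fun ζ => Stream'.get ζ p.length) h
  rw [Stream'.get_append_length] at this
  simp at this

/-- `f` preserves the lexicographic order. -/
def OrderPres (f : RightPerm) : Prop :=
  ∀ ξ η, SLt ξ η → SLt (app f ξ) (app f η)

theorem OrderPres.inv {f : RightPerm} (hf : OrderPres f) : OrderPres f⁻¹ := by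
  intro ξ η h
  have hne : app f⁻¹ ξ ≠ app f⁻¹ η := fun h' => by
    rw [app_injective _ h'] at h; exact sLt_irrefl _ h
  refine (sLt_or_sLt hne).resolve_right fun h' => ?_
  have := hf _ _ h'
  rw [app_app_inv, app_app_inv] at this
  exact sLt_asymm h this

theorem OrderPres.mul {f g : RightPerm} (hf : OrderPres f) (hg : OrderPres g) :
    OrderPres (f * g) := fun _ _ h => hg _ _ (hf _ _ h)

/-- Letters of s are peeled off one at a time. First digits do not change, so sequences with
different first digits keep their order, and sequences with the same first digit are compared behind
it. -/
theorem orderPres_loc {f : RightPerm} (hf : OrderPres f) (s : List Bool) : OrderPres (loc s f) := by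
  induction s with
  | nil => rwa [loc_nil]
  | cons d s ih =>
    rw [← List.singleton_append, ← loc_loc]
    generalize loc s f = g at ih
    intro ξ η h
    have key (ξ : Stream' Bool) : (∃ ζ : Stream' Bool, ξ = d :: ζ ∧ app (loc [d] g) ξ = d :: app g ζ) ∨
        ∃ ζ : Stream' Bool, ξ = (!d) :: ζ ∧ app (loc [d] g) ξ = ξ := by
      by_cases hd : ξ.head = d
      · obtain rfl := hd
        refine Or.inl ⟨ξ.tail, (Stream'.eta ξ).symm, ?_⟩
        conv_lhs => rw [← Stream'.eta ξ]
        exact app_loc_append [ξ.head] g ξ.tail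
      · have : ξ.head = !d := by cases h' : ξ.head <;> cases d <;> simp_all
        refine Or.inr ⟨ξ.tail, by rw [← this, Stream'.eta], ?_⟩
        refine app_loc_of_ne _ _ _ fun η h' => hd ?_
        rw [h']; rfl
    rcases key ξ with ⟨ζ, rfl, h₁⟩ | ⟨ζ, rfl, h₁⟩ <;> rcases key η with ⟨ζ', rfl, h₂⟩ | ⟨ζ', rfl, h₂⟩
    · rw [h₁, h₂]
      rw [sLt_cons] at h ⊢
      exact h.imp id fun h => ⟨h.1, ih _ _ h.2⟩
    · rw [h₁, h₂]; rw [sLt_cons] at h ⊢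
      exact h.imp id fun h => by simp at h
    · rw [h₁, h₂]; rw [sLt_cons] at h ⊢
      exact h.imp id fun h => by simp at h
    · rwa [h₁, h₂]

theorem orderPres_x (s : List Bool) : OrderPres (x s) := by
  rw [x_eq_loc]
  refine orderPres_loc (fun ξ η => ?_) s
  rcases stream_cases ξ with ⟨ξ, rfl⟩ | ⟨ξ, rfl⟩ | ⟨ξ, rfl⟩ <;>
    rcases stream_cases η with ⟨η, rfl⟩ | ⟨η, rfl⟩ | ⟨η, rfl⟩ <;>
    simp only [maps_x_00 _, maps_x_01 _, maps_x_1 _] <;>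
    simp [Stream'.cons_append_stream]

theorem orderPres_of_mem_F {f : RightPerm} (hf : f ∈ F) : OrderPres f :=
  F_induction (P := OrderPres) (fun _ _ h => h) orderPres_x (fun s => (orderPres_x s).inv)
    (fun _ _ h h' => h.mul h') hf

/-! ### Ordered partitions into cones -/

/-- Every sequence extending `u` lies to the left of every sequence extending `v`. -/
def Left (u v : List Bool) : Prop := ∀ η η', SLt (u ++ₛ η) (v ++ₛ η')

theorem Left.maps {f : RightPerm} (hf : OrderPres f) {u v u' v' : List Bool} (h : Left u v)
    (hu : Maps f u u') (hv : Maps f v v') : Left u' v' := fun η η' => by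
  rw [← hu, ← hv]; exact hf _ _ (h η η')

theorem left_cons {d : Bool} {u v : List Bool} : Left (d :: u) (d :: v) ↔ Left u v := by
  simp [Left, Stream'.cons_append_stream]

theorem left_false_true (u v : List Bool) : Left (false :: u) (true :: v) := fun η η' => by
  simp [Stream'.cons_append_stream]

/-- The cones of the words in `L` are disjoint, listed from left to right, and cover
everything. -/
def OPart (L : List (List Bool)) : Prop :=
  (∀ ξ, ∃ u ∈ L, ∃ η, ξ = u ++ₛ η) ∧ L.Pairwise Left

theorem forall₂_exists_right {α β : Type*} {r : α → β → Prop} {L : List α} {M : List β}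
    (h : List.Forall₂ r L M) {a : α} (ha : a ∈ L) : ∃ b ∈ M, r a b := by
  induction h with
  | nil => simp at ha
  | cons hab _ ih =>
    rcases List.mem_cons.1 ha with rfl | ha
    · exact ⟨_, by simp, hab⟩
    · obtain ⟨b, hb, h⟩ := ih ha
      exact ⟨b, List.mem_cons_of_mem _ hb, h⟩

theorem exists_forall₂ {α β : Type*} {r : α → β → Prop} {L : List α}
    (h : ∀ a ∈ L, ∃ b, r a b) : ∃ M, List.Forall₂ r L M := by
  induction L with
  | nil => exact ⟨[], .nil⟩
  | cons a L ih =>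
    obtain ⟨b, hb⟩ := h a (by simp)
    obtain ⟨M, hM⟩ := ih fun a ha => h a (List.mem_cons_of_mem _ ha)
    exact ⟨_, .cons hb hM⟩

theorem pairwise_of_forall₂ {α β : Type*} {r : α → β → Prop} {s : α → α → Prop}
    {s' : β → β → Prop} {L : List α} {M : List β} (h : List.Forall₂ r L M)
    (hs : ∀ a a' b b', r a b → r a' b' → s a a' → s' b b') (hL : L.Pairwise s) : M.Pairwise s' := by
  induction h with
  | nil => exact .nil
  | cons hab h ih =>
    rw [List.pairwise_cons] at hL ⊢
    refine ⟨fun b hb => ?_, ih hL.2⟩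
    obtain ⟨a, ha, hab'⟩ := forall₂_exists_right h.flip hb
    exact hs _ _ _ _ hab hab' (hL.1 a ha)

theorem forall₂_maps_mul {f g : RightPerm} {L M N : List (List Bool)}
    (h : List.Forall₂ (Maps f) L M) (h' : List.Forall₂ (Maps g) M N) :
    List.Forall₂ (Maps (f * g)) L N := by
  induction h generalizing N with
  | nil => cases h'; exact .nil
  | cons hab _ ih =>
    cases h' with
    | cons hbc h' => exact .cons (hab.mul hbc) (ih h')

theorem OPart.maps {f : RightPerm} (hf : OrderPres f) {L M : List (List Bool)} (hL : OPart L)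
    (h : List.Forall₂ (Maps f) L M) : OPart M := by
  refine ⟨fun ξ => ?_, pairwise_of_forall₂ h (fun _ _ _ _ h h' hl => hl.maps hf h h') hL.2⟩
  obtain ⟨u, hu, η, hη⟩ := hL.1 (app f⁻¹ ξ)
  obtain ⟨v, hv, huv⟩ := forall₂_exists_right h hu
  exact ⟨v, hv, η, by rw [← huv, ← hη, app_app_inv]⟩

theorem OPart.eq_of_maps {f g : RightPerm} {L M : List (List Bool)} (hL : OPart L)
    (hf : List.Forall₂ (Maps f) L M) (hg : List.Forall₂ (Maps g) L M) : f = g := by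
  refine ext_app fun ξ => ?_
  obtain ⟨u, hu, η, rfl⟩ := hL.1 ξ
  clear hL
  induction hf with
  | nil => simp at hu
  | cons hab _ ih =>
    cases hg with
    | cons hab' h' =>
      rcases List.mem_cons.1 hu with rfl | hu
      · rw [hab, hab']
      · exact ih h' hu

/-- The ordered partition `0, 10, 110, …, 1…10, 1…11` with `n` parts. -/
def comb : ℕ → List (List Bool)
  | 0 => []
  | 1 => [[]]
  | n + 2 => [false] :: (comb (n + 1)).map (true :: ·)

theorem maps_x_pow_zeros (k : ℕ) : Maps (x [] ^ k) (List.replicate (k + 1) false) [false] := by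
  induction k with
  | zero => exact maps_one _
  | succ k ih =>
    rw [pow_succ']
    exact (maps_x_00.append (List.replicate k false)).mul ih

theorem maps_x_pow_true (k : ℕ) (v : List Bool) :
    Maps (x [] ^ k) (true :: v) (List.replicate (k + 1) true ++ v) := by
  induction k generalizing v with
  | zero => exact maps_one _
  | succ k ih =>
    rw [pow_succ']
    have := (maps_x_1.append v).mul (ih (true :: v))
    rwa [List.append_cons, ← List.replicate_succ'] at this

/-- While x^k shrinks the prefix 0…0 (k + 1 digits) to 0, each cone to the right of it is moved as a
whole into the cone of 1: each x either deletes a 0 from a word 00w or sends 01w and 1w to words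
beginning with 1, and further factors x keep them there. -/
theorem exists_maps_x_pow {k : ℕ} {v : List Bool} (h : Left (List.replicate (k + 1) false) v) :
    ∃ v', Maps (x [] ^ k) v (true :: v') := by
  have hnil {k : ℕ} (h : Left (List.replicate (k + 1) false) []) : False := by
    have := h (Stream'.const true) (List.replicate (k + 1) false ++ₛ Stream'.const true)
    exact sLt_irrefl _ this
  induction k generalizing v with
  | zero =>
    rcases v with _ | ⟨_ | _, v⟩
    · exact (hnil h).elim
    · exact (not_const_true_sLt _ (left_cons.1 h (Stream'.const true) (Stream'.const true))).elim
    · exact ⟨v, maps_one _⟩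
  | succ k ih =>
    rcases v with _ | ⟨_ | _, v⟩
    · exact (hnil h).elim
    · rcases v with _ | ⟨_ | _, v⟩
      · exact (hnil (left_cons.1 h)).elim
      · have h' : Maps (x []) (false :: false :: v) (false :: v) := maps_x_00.append v
        obtain ⟨v', hv'⟩ := ih (h.maps (orderPres_x []) (maps_x_00.append _) h')
        exact ⟨v', by rw [pow_succ']; exact h'.mul hv'⟩
      · have h' : Maps (x []) (false :: true :: v) (true :: false :: v) := maps_x_01.append v
        exact ⟨_, by rw [pow_succ']; exact h'.mul (maps_x_pow_true k _)⟩
    · exact ⟨_, maps_x_pow_true _ _⟩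

theorem eq_replicate_of_const {u : List Bool} {η : Stream' Bool} {d : Bool}
    (h : Stream'.const d = u ++ₛ η) : u = List.replicate u.length d := by
  induction u with
  | nil => rfl
  | cons e u ih =>
    rw [Stream'.const_eq] at h
    obtain rfl : d = e := congrArg Stream'.head h
    rw [List.length_cons, List.replicate_succ, ← ih (congrArg Stream'.tail h)]

/-- Induction on the number of parts. The leftmost part contains 000…, so it is a word 0…0. Unless
it is empty, a power of x makes it equal to 0 and all other parts begin with 1. Deleting this 1
leaves a partition with one part less, and the element found for it is applied behind the prefix 1.
-/
theorem exists_maps_comb (n : ℕ) (L : List (List Bool)) (hn : L.length = n) (hL : OPart L) :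
    ∃ g ∈ F, List.Forall₂ (Maps g) L (comb n) := by
  induction n generalizing L with
  | zero =>
    rw [List.length_eq_zero_iff.1 hn]
    exact ⟨1, one_mem F, .nil⟩
  | succ n ih =>
    rcases L with _ | ⟨u, L⟩
    · simp at hn
    have hcov := hL.1
    have hlu := (List.pairwise_cons.1 hL.2).1
    have hu : ∃ k, u = List.replicate k false := by
      obtain ⟨w, hw, η, hη⟩ := hL.1 (Stream'.const false)
      rcases List.mem_cons.1 hw with rfl | hw
      · exact ⟨_, eq_replicate_of_const hη⟩
      · have := hlu w hw (Stream'.const false) η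
        rw [← hη] at this
        exact (not_sLt_const_false _ this).elim
    obtain ⟨k, rfl⟩ := hu
    rcases k with _ | k
    · rcases L with _ | ⟨v, L⟩
      · obtain rfl : n = 0 := by simpa using hn.symm
        exact ⟨1, one_mem F, .cons (maps_one _) .nil⟩
      · exact (sLt_irrefl _ (hlu v (by simp) (v ++ₛ Stream'.const true) (Stream'.const true))).elim
    · rcases n with _ | n
      · obtain rfl : L = [] := by simpa using hn
        obtain ⟨w, hw, η, hη⟩ := hL.1 (Stream'.const true)
        obtain rfl : w = _ := by simpa using hw
        exact absurd (eq_replicate_of_const hη) (by simp [List.replicate_succ])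
      obtain ⟨M, hM⟩ := exists_forall₂ fun v hv => exists_maps_x_pow (hlu v hv)
      have h₁ : List.Forall₂ (Maps (x [] ^ k)) (List.replicate (k + 1) false :: L)
          ([false] :: M.map (true :: ·)) :=
        .cons (maps_x_pow_zeros k) (List.forall₂_map_right_iff.2 hM)
      have hxk := pow_mem (x_mem_F []) k
      have h₂ := hL.maps (orderPres_of_mem_F hxk) h₁
      have h₃ : OPart M := by
        refine ⟨fun ξ => ?_, ?_⟩
        · obtain ⟨w, hw, η, hη⟩ := h₂.1 (true :: ξ)
          rcases List.mem_cons.1 hw with rfl | hw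
          · exact absurd (congrArg Stream'.head hη) (by simp)
          · obtain ⟨v, hv, rfl⟩ := List.mem_map.1 hw
            exact ⟨v, hv, η, congrArg Stream'.tail hη⟩
        · exact (List.pairwise_map.1 (List.pairwise_cons.1 h₂.2).2).imp left_cons.1
      obtain ⟨g, hg, hMg⟩ := ih M (by rw [← hM.length_eq]; simpa using hn) h₃
      refine ⟨x [] ^ k * loc [true] g, mul_mem hxk (loc_mem_F _ hg), forall₂_maps_mul h₁ ?_⟩
      refine .cons (Incomp.maps_loc (incomp_cons_not true [] []) g) ?_
      rw [List.forall₂_map_left_iff, List.forall₂_map_right_iff]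
      exact hMg.imp fun _ _ h => h.loc [true]

/-- Both partitions are carried to the same comb. -/
theorem exists_maps_of_length_eq {L M : List (List Bool)} (hL : OPart L) (hM : OPart M)
    (h : L.length = M.length) : ∃ g ∈ F, List.Forall₂ (Maps g) L M := by
  obtain ⟨f, hf, hfL⟩ := exists_maps_comb _ L rfl hL
  obtain ⟨g, hg, hgM⟩ := exists_maps_comb _ M rfl hM
  refine ⟨f * g⁻¹, mul_mem hf (inv_mem hg), forall₂_maps_mul hfL ?_⟩
  rw [h]
  exact (hgM.imp fun _ _ h => h.inv).flip

/-- All words of length `n`, from left to right. -/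
def words : ℕ → List (List Bool)
  | 0 => [[]]
  | n + 1 => (words n).map (List.cons false) ++ (words n).map (List.cons true)

theorem length_of_mem_words {n : ℕ} {u : List Bool} (h : u ∈ words n) : u.length = n := by
  induction n generalizing u with
  | zero => simp_all [words]
  | succ n ih =>
    simp only [words, List.mem_append, List.mem_map] at h
    rcases h with ⟨v, hv, rfl⟩ | ⟨v, hv, rfl⟩ <;> simp [ih hv]

theorem OPart.node {L M : List (List Bool)} (hL : OPart L) (hM : OPart M) :
    OPart (L.map (List.cons false) ++ M.map (List.cons true)) := by
  constructor
  · intro ξ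
    rw [← Stream'.eta ξ]
    cases ξ.head
    · obtain ⟨u, hu, η, h⟩ := hL.1 ξ.tail
      exact ⟨false :: u, by simpa using hu, η, by rw [h]; rfl⟩
    · obtain ⟨u, hu, η, h⟩ := hM.1 ξ.tail
      exact ⟨true :: u, by simpa using hu, η, by rw [h]; rfl⟩
  · rw [List.pairwise_append, List.pairwise_map, List.pairwise_map]
    refine ⟨hL.2.imp left_cons.2, hM.2.imp left_cons.2, ?_⟩
    intro a ha b hb
    obtain ⟨u, -, rfl⟩ := List.mem_map.1 ha
    obtain ⟨v, -, rfl⟩ := List.mem_map.1 hb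
    exact left_false_true u v

theorem oPart_nil : OPart [[]] := ⟨fun ξ => ⟨[], by simp, ξ, rfl⟩, by simp⟩

theorem oPart_words (n : ℕ) : OPart (words n) := by
  induction n with
  | zero => exact oPart_nil
  | succ n ih => exact ih.node ih

/-- `F` contains all order preserving bijections that replace long prefixes. -/
theorem mem_F_of_orderPres {f : RightPerm} (hf : OrderPres f)
    (h : ∃ n : ℕ, ∀ t : List Bool, n ≤ t.length → ∃ u, Maps f t u) : f ∈ F := by
  obtain ⟨n, hn⟩ := h
  -- The images of the words of length n form an ordered partition with equally many parts. The
  -- element of F that matches the two partitions agrees with f on every cone.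
  obtain ⟨M, hM⟩ := exists_forall₂ fun t ht => hn t (length_of_mem_words ht).ge
  obtain ⟨g, hg, h⟩ := exists_maps_of_length_eq (oPart_words n) ((oPart_words n).maps hf hM)
    hM.length_eq
  rwa [(oPart_words n).eq_of_maps hM h]

/-! ### Restriction and stabilizers -/

/-- An element of F that preserves the cone of s acts behind s as an element of F. By
`mem_F_of_orderPres` it suffices that the restriction preserves the order and replaces long
prefixes. -/
theorem exists_restrict {f : RightPerm} (hf : f ∈ F) {s : List Bool}
    (h : ∀ g : RightPerm, g = f ∨ g = f⁻¹ → ∀ η, ∃ η', app g (s ++ₛ η) = s ++ₛ η') :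
    ∃ f' ∈ F, ∀ η, app f (s ++ₛ η) = s ++ₛ app f' η := by
  choose a ha using h f (Or.inl rfl)
  choose b hb using h f⁻¹ (Or.inr rfl)
  let f' : RightPerm := MulOpposite.op
    { toFun := a
      invFun := b
      left_inv := fun η => append_stream_inj s (by rw [← hb, ← ha, app_inv_app])
      right_inv := fun η => append_stream_inj s (by rw [← ha, ← hb, app_app_inv]) }
  have hf' (η : Stream' Bool) : app f (s ++ₛ η) = s ++ₛ app f' η := ha η
  refine ⟨f', mem_F_of_orderPres (fun ξ η h => ?_) ?_, hf'⟩
  · rw [← sLt_append (s := s), ← hf', ← hf']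
    exact orderPres_of_mem_F hf _ _ (sLt_append.2 h)
  -- Images of long prefixes are required to be at least as long as s, so they begin with s, which
  -- can then be cancelled.
  · obtain ⟨n, hn⟩ := locPrefix_of_mem_F hf s.length
    refine ⟨n, fun t ht => ?_⟩
    obtain ⟨u, hu, htu⟩ := hn (s ++ t) (by rw [List.length_append]; omega)
    have key (η : Stream' Bool) : s ++ₛ app f' (t ++ₛ η) = u ++ₛ η := by
      rw [← hf', ← Stream'.append_append_stream, htu]
    have hs : s = u.take s.length := by
      refine append_stream_eq_of_length (by rw [List.length_take]; omega) ((key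
        (Stream'.const true)).trans ?_) (η' := u.drop s.length ++ₛ Stream'.const true)
      rw [← Stream'.append_append_stream, List.take_append_drop]
    refine ⟨u.drop s.length, fun η => append_stream_inj s ?_⟩
    rw [key, ← Stream'.append_append_stream]
    congr 1
    conv_lhs => rw [← List.take_append_drop s.length u, ← hs]

theorem maps_inv_of_eq {f g : RightPerm} {s : List Bool} (hs : Maps f s s) (h : g = f ∨ g = f⁻¹) :
    Maps g s s := by
  rcases h with rfl | rfl
  exacts [hs, hs.inv]

theorem mem_F_of_eq {f g : RightPerm} (hf : f ∈ F) (h : g = f ∨ g = f⁻¹) : g ∈ F := by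
  rcases h with rfl | rfl
  exacts [hf, inv_mem hf]

/-- If an element of `F` fixes a cone then it preserves the set of sequences on its left. -/
theorem sLt_of_maps_self {f : RightPerm} (hf : f ∈ F) {s : List Bool} (hs : Maps f s s)
    {ξ : Stream' Bool} {η : Stream' Bool} (h : SLt ξ (s ++ₛ η)) : SLt (app f ξ) (s ++ₛ η) := by
  rw [← hs]; exact orderPres_of_mem_F hf _ _ h

theorem sLt_of_maps_self' {f : RightPerm} (hf : f ∈ F) {s : List Bool} (hs : Maps f s s)
    {ξ : Stream' Bool} {η : Stream' Bool} (h : SLt (s ++ₛ η) ξ) : SLt (s ++ₛ η) (app f ξ) := by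
  rw [← hs]; exact orderPres_of_mem_F hf _ _ h

theorem exists_of_sLt_true {ξ : Stream' Bool} (h : SLt ξ ([true] ++ₛ Stream'.const false)) :
    ∃ η, ξ = [false] ++ₛ η := by
  rw [← Stream'.eta ξ] at h ⊢
  cases h' : ξ.head
  · exact ⟨_, rfl⟩
  · rw [h'] at h
    exact (not_sLt_const_false _ (sLt_append (s := [true]).1 h)).elim

theorem exists_of_false_sLt {ξ : Stream' Bool} (h : SLt ([false] ++ₛ Stream'.const true) ξ) :
    ∃ η, ξ = [true] ++ₛ η := by
  rw [← Stream'.eta ξ] at h ⊢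
  cases h' : ξ.head
  · rw [h'] at h
    exact (not_const_true_sLt _ (sLt_append (s := [false]).1 h)).elim
  · exact ⟨_, rfl⟩

theorem stabilizer_nil {f : RightPerm} (h : Maps f [] []) : f = 1 := ext_app h

/-- By monotonicity, a map fixing the cone of 1 pointwise preserves what lies to its left, namely
the cone of 0, and can be restricted to it. -/
theorem stabilizer_1 {f : RightPerm} (hf : f ∈ F) (h : Maps f [true] [true]) :
    ∃ f' ∈ F, f = loc [false] f' := by
  obtain ⟨f', hf', h'⟩ := exists_restrict hf (s := [false]) fun g hg η =>
    exists_of_sLt_true (sLt_of_maps_self (mem_F_of_eq hf hg) (maps_inv_of_eq h hg)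
      (left_false_true [] [] η _))
  refine ⟨f', hf', ext_app fun ξ => ?_⟩
  rw [← Stream'.eta ξ]
  cases ξ.head
  · exact (h' _).trans (app_loc_append [false] f' _).symm
  · exact (h _).trans (app_loc_incomp (incomp_cons_not false [] []) f' _).symm

theorem stabilizer_0 {f : RightPerm} (hf : f ∈ F) (h : Maps f [false] [false]) :
    ∃ f' ∈ F, f = loc [true] f' := by
  obtain ⟨f', hf', h'⟩ := exists_restrict hf (s := [true]) fun g hg η =>
    exists_of_false_sLt (sLt_of_maps_self' (mem_F_of_eq hf hg) (maps_inv_of_eq h hg)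
      (left_false_true [] [] _ η))
  refine ⟨f', hf', ext_app fun ξ => ?_⟩
  rw [← Stream'.eta ξ]
  cases ξ.head
  · exact (h _).trans (app_loc_incomp (incomp_cons_not true [] []) f' _).symm
  · exact (h' _).trans (app_loc_append [true] f' _).symm

/-- Sequences 11η lie to the right of 10111…, which is fixed, so their images stay in the cone of 1.
The restriction to this cone fixes the cone of 0 and hence comes from a map behind 11. Dividing by
that map leaves an element fixing the cone of 1. -/
theorem stabilizer_10 {f : RightPerm} (hf : f ∈ F) (h : Maps f [true, false] [true, false]) :
    ∃ f₁ ∈ F, ∃ f₂ ∈ F, f = loc [false] f₁ * loc [true, true] f₂ := by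
  have hf1 : ∃ f' ∈ F, ∀ η, app f ([true] ++ₛ η) = [true] ++ₛ app f' η := by
    refine exists_restrict hf fun g hg η => ?_
    rw [← Stream'.eta η]
    cases η.head
    · exact ⟨_, maps_inv_of_eq h hg η.tail⟩
    · have h₁ := sLt_of_maps_self' (mem_F_of_eq hf hg) (maps_inv_of_eq h hg)
        (ξ := [true, true] ++ₛ η.tail) (η := Stream'.const true)
        (left_cons.2 (left_false_true [] []) _ _)
      change SLt _ (app g ([true, true] ++ₛ η.tail)) at h₁
      change ∃ η', app g ([true, true] ++ₛ η.tail) = _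
      generalize app g ([true, true] ++ₛ η.tail) = ζ at h₁ ⊢
      refine exists_of_false_sLt ?_
      rw [← Stream'.eta ζ] at h₁ ⊢
      cases h' : ζ.head
      · simp [h', Stream'.cons_append_stream] at h₁
      · simp
  obtain ⟨f', hf', h'⟩ := hf1
  have hmf' : Maps f' [false] [false] := fun η => append_stream_inj [true] ((h' _).symm.trans (h η))
  obtain ⟨f₂, hf₂, rfl⟩ := stabilizer_0 hf' hmf'
  have hmf : Maps (f * (loc [true, true] f₂)⁻¹) [true] [true] := fun η => by
    rw [app_mul, h', ← map_inv, show loc [true, true] f₂⁻¹ = loc [true] (loc [true] f₂⁻¹) from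
      (loc_loc [true] [true] f₂⁻¹).symm, app_loc_append, map_inv, app_inv_app]
  obtain ⟨f₁, hf₁, h₁⟩ := stabilizer_1 (mul_mem hf (inv_mem (loc_mem_F _ hf₂))) hmf
  exact ⟨f₁, hf₁, f₂, hf₂, eq_mul_of_mul_inv_eq h₁⟩

/-! ### Transitivity of `F` -/

/-- Elements of F fix the extreme sequences 000… and 111…, and a word avoids the digit d exactly if
its cone contains the constant sequence of the other digit. -/
theorem mem_iff_of_maps {f : RightPerm} (hf : f ∈ F) {t u : List Bool} (h : Maps f t u) (d : Bool) :
    d ∈ t ↔ d ∈ u := by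
  have key {f : RightPerm} (hf : f ∈ F) {t u : List Bool} (h : Maps f t u) (hd : d ∉ u) :
      d ∉ t := by
    have hc : ∀ f ∈ F, app f (Stream'.const (!d)) = Stream'.const (!d) := by
      intro f hf
      by_contra hne
      have hf' := orderPres_of_mem_F hf
      have hinv : app f⁻¹ (Stream'.const (!d)) ≠ Stream'.const (!d) := fun h' => by
        apply hne
        conv_lhs => rw [← h', app_app_inv]
      cases d
      · have h₁ := (sLt_or_sLt hinv).resolve_right (not_const_true_sLt _)
        have h₂ := hf' _ _ h₁
        rw [app_app_inv] at h₂
        exact not_const_true_sLt _ h₂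
      · have h₁ := (sLt_or_sLt hinv).resolve_left (not_sLt_const_false _)
        have h₂ := hf' _ _ h₁
        rw [app_app_inv] at h₂
        exact not_sLt_const_false _ h₂
    have hcu (u : List Bool) (hd : d ∉ u) : u ++ₛ Stream'.const (!d) = Stream'.const (!d) := by
      induction u with
      | nil => rfl
      | cons e u ih =>
        rw [List.mem_cons, not_or] at hd
        rw [Stream'.cons_append_stream, ih hd.2]
        conv_rhs => rw [Stream'.const_eq]
        congr 1
        cases d <;> cases e <;> simp_all
    have := h (Stream'.const (!d))
    rw [hcu u hd] at this
    have h' := (app_inv_eq this).symm.trans (hc _ (inv_mem hf))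
    rw [eq_replicate_of_const h'.symm]
    cases d <;> simp [List.mem_replicate]
  exact ⟨fun ht => by_contra fun hu => key hf h hu ht,
    fun hu => by_contra fun ht => key (inv_mem hf) h.inv ht hu⟩

/-- Representatives of the orbits of words. -/
def rep (s : List Bool) : List Bool :=
  if true ∈ s then (if false ∈ s then [true, false] else [true])
  else if false ∈ s then [false] else []

theorem rep_eq_of_maps {f : RightPerm} (hf : f ∈ F) {t u : List Bool} (h : Maps f t u) :
    rep t = rep u := by
  simp only [rep, mem_iff_of_maps hf h]

theorem exists_maps_rep (s : List Bool) : ∃ g ∈ F, Maps g s (rep s) := by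
  refine XAct.word_induction (P := fun s => ∃ g ∈ F, Maps g s (rep s)) ?_ ?_
    ⟨1, one_mem F, maps_one _⟩ ⟨1, one_mem F, maps_one _⟩ ⟨1, one_mem F, maps_one _⟩
    ⟨1, one_mem F, maps_one _⟩ s
  · rintro t u h ⟨g, hg, hgt⟩
    rw [rep_eq_of_maps (x_mem_F _) h.maps] at hgt
    exact ⟨(x [])⁻¹ * g, mul_mem (inv_mem (x_mem_F _)) hg, h.maps.inv.mul hgt⟩
  · rintro k t u h ⟨g, hg, hgu⟩
    rw [← rep_eq_of_maps (x_mem_F _) h.maps] at hgu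
    exact ⟨_, mul_mem (x_mem_F _) hg, h.maps.mul hgu⟩

theorem OPart.split {P Q : List (List Bool)} {w : List Bool} (h : OPart (P ++ w :: Q)) :
    OPart (P ++ (w ++ [false]) :: (w ++ [true]) :: Q) := by
  have hl {u v : List Bool} (d : Bool) (h : Left u v) : Left u (v ++ [d]) := fun η η' => by
    rw [Stream'.append_append_stream]; exact h _ _
  have hr {u v : List Bool} (d : Bool) (h : Left u v) : Left (u ++ [d]) v := fun η η' => by
    rw [Stream'.append_append_stream]; exact h _ _
  constructor
  · intro ξ
    obtain ⟨u, hu, η, rfl⟩ := h.1 ξ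
    simp only [List.mem_append, List.mem_cons] at hu
    rcases hu with hu | rfl | hu
    · exact ⟨u, by simp [hu], η, rfl⟩
    · rw [← Stream'.eta η]
      refine ⟨u ++ [η.head], ?_, η.tail, by rw [Stream'.append_append_stream]; rfl⟩
      cases η.head <;> simp
    · exact ⟨u, by simp [hu], η, rfl⟩
  · have h' := h.2
    rw [List.pairwise_append, List.pairwise_cons] at h' ⊢
    obtain ⟨hP, ⟨hw, hQ⟩, hPQ⟩ := h'
    refine ⟨hP, ⟨fun v hv => ?_, ?_⟩, fun u hu v hv => ?_⟩
    · rcases List.mem_cons.1 hv with rfl | hv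
      · intro η η'
        rw [Stream'.append_append_stream, Stream'.append_append_stream, sLt_append]
        exact left_false_true [] [] η η'
      · exact hr _ (hw v hv)
    · rw [List.pairwise_cons]
      exact ⟨fun v hv => hr _ (hw v hv), hQ⟩
    · rcases List.mem_cons.1 hv with rfl | hv
      · exact hl _ (hPQ u hu w (by simp))
      rcases List.mem_cons.1 hv with rfl | hv
      · exact hl _ (hPQ u hu w (by simp))
      · exact hPQ u hu v (by simp [hv])

theorem OPart.refine {P B Q : List (List Bool)} (hB : B ≠ []) (h : OPart (P ++ B ++ Q)) (k : ℕ) :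
    ∃ B' : List (List Bool), B'.length = B.length + k ∧ OPart (P ++ B' ++ Q) := by
  induction k with
  | zero => exact ⟨B, rfl, h⟩
  | succ k ih =>
    obtain ⟨B', hl, h'⟩ := ih
    rcases B' with _ | ⟨w, B'⟩
    · exact absurd (List.length_eq_zero_iff.1 (by simp at hl; omega)) hB
    · refine ⟨(w ++ [false]) :: (w ++ [true]) :: B', by simp at hl ⊢; omega, ?_⟩
      rw [List.append_assoc, List.cons_append] at h'
      have := h'.split
      rwa [List.append_assoc, List.cons_append, List.cons_append]

/-- Two nonempty blocks with b and b' parts are both refined to b + b' parts. An empty block cannot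
be refined, so both have to be empty together. -/
theorem OPart.refine₂ {P B Q P' B' Q' : List (List Bool)} (hB : B = [] ↔ B' = [])
    (h : OPart (P ++ B ++ Q)) (h' : OPart (P' ++ B' ++ Q')) :
    ∃ C C' : List (List Bool), C.length = C'.length ∧ OPart (P ++ C ++ Q) ∧
      OPart (P' ++ C' ++ Q') := by
  by_cases hne : B = []
  · exact ⟨B, B', by rw [hne, hB.1 hne], h, h'⟩
  · obtain ⟨C, hC, h₁⟩ := h.refine hne B'.length
    obtain ⟨C', hC', h₁'⟩ := h'.refine (mt hB.2 hne) B.length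
    exact ⟨C, C', by omega, h₁, h₁'⟩

theorem forall₂_middle {α β : Type*} {r : α → β → Prop} {A L : List α} {B M : List β} {a : α} {b : β}
    (hl : A.length = B.length) (h : List.Forall₂ r (A ++ a :: L) (B ++ b :: M)) :
    r a b ∧ List.Forall₂ r L M := by
  induction A generalizing B with
  | nil =>
    obtain rfl := List.length_eq_zero_iff.1 hl.symm
    exact List.forall₂_cons.1 h
  | cons c A ih =>
    rcases B with _ | ⟨d, B⟩
    · simp at hl
    · exact ih (by simpa using hl) (List.forall₂_cons.1 h).2

/-- Once the gaps to the left of, between and to the right of the two cones have equally many parts,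
the two pairs occupy the same positions in partitions of the same size. -/
theorem exists_maps_pair {B C D B' C' D' : List (List Bool)} {s t s' t' : List Bool}
    (h : OPart (B ++ s :: (C ++ t :: D))) (h' : OPart (B' ++ s' :: (C' ++ t' :: D')))
    (hB : B = [] ↔ B' = []) (hC : C = [] ↔ C' = []) (hD : D = [] ↔ D' = []) :
    ∃ g ∈ F, Maps g s s' ∧ Maps g t t' := by
  obtain ⟨B₁, B₁', hlB, h, h'⟩ := OPart.refine₂ (P := []) (P' := []) hB h h'
  have e (B C D : List (List Bool)) (s t : List Bool) : [] ++ B ++ s :: (C ++ t :: D) =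
    (B ++ [s]) ++ C ++ t :: D := by simp
  rw [e] at h h'
  obtain ⟨C₁, C₁', hlC, h, h'⟩ := OPart.refine₂ hC h h'
  have e (B C D : List (List Bool)) (s t : List Bool) : (B ++ [s]) ++ C ++ t :: D =
    (B ++ s :: (C ++ [t])) ++ D ++ [] := by simp
  rw [e] at h h'
  obtain ⟨D₁, D₁', hlD, h, h'⟩ := OPart.refine₂ hD h h'
  obtain ⟨g, hg, hmap⟩ := exists_maps_of_length_eq h h' (by simp; omega)
  have e (B C D : List (List Bool)) (s t : List Bool) : (B ++ s :: (C ++ [t])) ++ D ++ [] =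
    B ++ s :: (C ++ t :: D) := by simp
  rw [e, e] at hmap
  obtain ⟨hs, hmap⟩ := forall₂_middle hlB hmap
  exact ⟨g, hg, hs, (forall₂_middle hlC hmap).1⟩

theorem exists_oPart (s : List Bool) : ∃ B D : List (List Bool), OPart (B ++ s :: D) ∧
    (B = [] ↔ true ∉ s) ∧ (D = [] ↔ false ∉ s) := by
  induction s with
  | nil => exact ⟨[], [], oPart_nil, by simp, by simp⟩
  | cons d s ih =>
    obtain ⟨B, D, h, hB, hD⟩ := ih
    cases d
    · refine ⟨B.map (List.cons false), D.map (List.cons false) ++ [[true]], ?_, ?_, ?_⟩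
      · simpa using h.node oPart_nil
      · simp [hB]
      · simp
    · refine ⟨[false] :: B.map (List.cons true), D.map (List.cons true), ?_, ?_, ?_⟩
      · simpa using oPart_nil.node h
      · simp
      · simp [hD]

theorem exists_oPart_pair (p a b : List Bool) : ∃ B C D : List (List Bool),
    OPart (B ++ (p ++ false :: a) :: (C ++ (p ++ true :: b) :: D)) ∧
    (B = [] ↔ true ∉ p ++ false :: a) ∧ (D = [] ↔ false ∉ p ++ true :: b) := by
  induction p with
  | nil =>
    obtain ⟨B, C, h, hB, -⟩ := exists_oPart a
    obtain ⟨C', D, h', -, hD⟩ := exists_oPart b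
    refine ⟨B.map (List.cons false), C.map (List.cons false) ++ C'.map (List.cons true),
      D.map (List.cons true), by simpa using h.node h', by simp [hB], by simp [hD]⟩
  | cons d p ih =>
    obtain ⟨B, C, D, h, hB, hD⟩ := ih
    cases d
    · refine ⟨B.map (List.cons false), C.map (List.cons false),
        D.map (List.cons false) ++ [[true]], ?_, ?_, ?_⟩
      · simpa using h.node oPart_nil
      · simpa using hB
      · simp
    · refine ⟨[false] :: B.map (List.cons true), C.map (List.cons true),
        D.map (List.cons true), ?_, ?_, ?_⟩
      · simpa using oPart_nil.node h
      · simp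
      · simpa using hD

/-- Representatives of the orbits of pairs of disjoint cones: `i` (resp. `j`) tells whether there
is something to the left (resp. right) of both cones, `k` whether there is something between
them. -/
def basePair : Bool → Bool → Bool → List Bool × List Bool
  | true, true, false => ([false, true], [true, false])
  | true, true, true => ([false, false, true], [true, false])
  | false, true, false => ([false], [true, false])
  | false, true, true => ([false, false], [true, false])
  | true, false, false => ([false, true], [true])
  | true, false, true => ([false, true], [true, true])
  | false, false, false => ([false], [true])
  | false, false, true => ([false, false], [true])

theorem exists_oPart_basePair (i j k : Bool) : ∃ B C D : List (List Bool),
    OPart (B ++ (basePair i j k).1 :: (C ++ (basePair i j k).2 :: D)) ∧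
    (B = [] ↔ i = false) ∧ (D = [] ↔ j = false) ∧ (C = [] ↔ k = false) := by
  have h1 := oPart_nil.node oPart_nil
  have h2 := h1.node oPart_nil
  have h3 := oPart_nil.node h1
  have h4 := h1.node h1
  have h5 := h2.node h1
  cases i <;> cases j <;> cases k
  · exact ⟨[], [], [], h1, by simp⟩
  · exact ⟨[], [_], [], h2, by simp⟩
  · exact ⟨[], [], [_], h3, by simp⟩
  · exact ⟨[], [_], [_], h4, by simp⟩
  · exact ⟨[_], [], [], h2, by simp⟩
  · exact ⟨[_], [_], [], h4, by simp⟩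
  · exact ⟨[_], [], [_], h4, by simp⟩
  · exact ⟨[_], [_], [_], h5, by simp⟩

/-- Which of the three gaps around two disjoint cones are nonempty decides to which base pair they
can be moved. -/
theorem exists_maps_basePair (p a b : List Bool) : ∃ i j k, ∃ g ∈ F,
    Maps g (p ++ false :: a) (basePair i j k).1 ∧ Maps g (p ++ true :: b) (basePair i j k).2 := by
  obtain ⟨B, C, D, h, hB, hD⟩ := exists_oPart_pair p a b
  obtain ⟨B', C', D', h', hB', hD', hC'⟩ := exists_oPart_basePair (decide (B ≠ []))
    (decide (D ≠ [])) (decide (C ≠ []))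
  exact ⟨_, _, _, exists_maps_pair h h' (by simp [hB']) (by simp [hC']) (by simp [hD'])⟩

end Cantor

namespace Cantor

/-! ### Finite presentation of `F` -/

section Thompson

variable {M N : Type*} [Group M] [Group N]

/-- The relations `Z_m Z_n = Z_n Z_{m+1}` for `n < m`. -/
def IsThompson (Z : ℕ → M) : Prop := ∀ m n, n < m → Z m * Z n = Z n * Z (m + 1)

/-- The ordered product `Z_0^{a_0} Z_1^{a_1} ⋯`. -/
def normalForm : (ℕ → M) → List ℕ → M
  | _, [] => 1
  | Z, a :: l => Z 0 ^ a * normalForm (fun n => Z (n + 1)) l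

theorem IsThompson.shift {Z : ℕ → M} (h : IsThompson Z) : IsThompson fun n => Z (n + 1) :=
  fun m n hmn => h (m + 1) (n + 1) (by omega)

theorem map_normalForm (f : M →* N) (Z : ℕ → M) (l : List ℕ) :
    f (normalForm Z l) = normalForm (fun n => f (Z n)) l := by
  induction l generalizing Z with
  | nil => exact map_one f
  | cons a l ih => rw [normalForm, map_mul, map_pow, ih]; rfl

theorem IsThompson.mul_pow {Z : ℕ → M} (h : IsThompson Z) (n a : ℕ) :
    Z (n + 1) * Z 0 ^ a = Z 0 ^ a * Z (n + 1 + a) := by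
  induction a with
  | zero => simp
  | succ a ih => rw [pow_succ, ← mul_assoc, ih, mul_assoc, h _ 0 (by omega), ← mul_assoc]; rfl

/-- Moving Z_{n+1} to the right across Z_0^a raises its index by a. It is then absorbed by the rest,
a normal form in the shifted sequence. -/
theorem IsThompson.mul_normalForm {Z : ℕ → M} (h : IsThompson Z) (n : ℕ) (l : List ℕ) :
    ∃ l', Z n * normalForm Z l = normalForm Z l' := by
  induction l generalizing Z n with
  | nil =>
    induction n generalizing Z with
    | zero => exact ⟨[1], by simp [normalForm]⟩
    | succ n ih =>
      obtain ⟨l', hl'⟩ := ih h.shift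
      refine ⟨0 :: l', ?_⟩
      rw [show normalForm Z (0 :: l') = Z 0 ^ 0 * normalForm _ l' from rfl, pow_zero, one_mul, ← hl']
      rfl
  | cons a l ih =>
    cases n with
    | zero => exact ⟨(a + 1) :: l, by rw [normalForm, normalForm, pow_succ', mul_assoc]⟩
    | succ n =>
      obtain ⟨l', hl'⟩ := ih h.shift (n + a)
      refine ⟨a :: l', ?_⟩
      rw [normalForm, normalForm, ← mul_assoc, h.mul_pow, mul_assoc, ← hl']
      congr 3
      omega

theorem IsThompson.exists_normalForm {Z : ℕ → M} (h : IsThompson Z) {p : M}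
    (hp : p ∈ Submonoid.closure (Set.range Z)) : ∃ l, p = normalForm Z l := by
  induction hp using Submonoid.closure_induction_left with
  | one => exact ⟨[], rfl⟩
  | mul_left z hz p _ ih =>
    obtain ⟨n, rfl⟩ := hz
    obtain ⟨l, rfl⟩ := ih
    exact h.mul_normalForm n l

/-- A negative letter can be moved to the right through a positive word: it cancels against an equal
letter and otherwise passes, the larger of the two indices being raised by one. This gives fractions
of positive words. -/
theorem IsThompson.inv_mul_mem {Z : ℕ → M} (h : IsThompson Z) {p : M}
    (hp : p ∈ Submonoid.closure (Set.range Z)) (n : ℕ) :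
    ∃ q ∈ Submonoid.closure (Set.range Z), ∃ r ∈ Submonoid.closure (Set.range Z),
      (Z n)⁻¹ * p = q * r⁻¹ := by
  have hZ (n : ℕ) : Z n ∈ Submonoid.closure (Set.range Z) := Submonoid.subset_closure ⟨n, rfl⟩
  induction hp using Submonoid.closure_induction_left generalizing n with
  | one => exact ⟨1, one_mem _, Z n, hZ n, by simp⟩
  | mul_left z hz p hp ih =>
    obtain ⟨m, rfl⟩ := hz
    rcases lt_trichotomy m n with hmn | rfl | hmn
    · obtain ⟨q, hq, r, hr, e⟩ := ih (n + 1)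
      refine ⟨Z m * q, mul_mem (hZ m) hq, r, hr, ?_⟩
      have := h n m hmn
      rw [mul_assoc (Z m), ← e, inv_mul_eq_iff_eq_mul, ← mul_assoc, this]
      group
    · exact ⟨p, hp, 1, one_mem _, by simp⟩
    · obtain ⟨q, hq, r, hr, e⟩ := ih n
      refine ⟨Z (m + 1) * q, mul_mem (hZ _) hq, r, hr, ?_⟩
      have := h m n hmn
      rw [mul_assoc (Z (m + 1)), ← e, inv_mul_eq_iff_eq_mul, ← mul_assoc, ← this]
      group

theorem IsThompson.exists_fraction {Z : ℕ → M} (h : IsThompson Z) {w : M}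
    (hw : w ∈ Subgroup.closure (Set.range Z)) :
    ∃ l l', w = normalForm Z l * (normalForm Z l')⁻¹ := by
  suffices ∃ p ∈ Submonoid.closure (Set.range Z), ∃ q ∈ Submonoid.closure (Set.range Z),
      w = p * q⁻¹ by
    obtain ⟨p, hp, q, hq, rfl⟩ := this
    obtain ⟨l, rfl⟩ := h.exists_normalForm hp
    obtain ⟨l', rfl⟩ := h.exists_normalForm hq
    exact ⟨l, l', rfl⟩
  induction hw using Subgroup.closure_induction_left with
  | one => exact ⟨1, one_mem _, 1, one_mem _, by simp⟩
  | mul_left z hz w _ ih =>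
    obtain ⟨n, rfl⟩ := hz
    obtain ⟨p, hp, q, hq, rfl⟩ := ih
    exact ⟨Z n * p, mul_mem (Submonoid.subset_closure ⟨n, rfl⟩) hp, q, hq, by group⟩
  | inv_mul_cancel z hz w _ ih =>
    obtain ⟨n, rfl⟩ := hz
    obtain ⟨p, hp, q, hq, rfl⟩ := ih
    obtain ⟨p', hp', r, hr, e⟩ := h.inv_mul_mem hp n
    exact ⟨p', hp', q * r, mul_mem hq hr, by rw [← mul_assoc, e]; group⟩

end Thompson

/-! ### Homomorphisms defined on F -/

/-- The generators `x_{1…1}` of `F`. -/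
def xOnes (n : ℕ) : RightPerm := x (List.replicate n true)

theorem xOnes_succ (n : ℕ) : xOnes (n + 1) = loc [true] (xOnes n) := (loc_x [true] _).symm

theorem isThompson_xOnes : IsThompson xOnes := by
  intro m n hmn
  obtain ⟨k, rfl⟩ := Nat.exists_eq_add_of_lt hmn
  have := (XAct.one (List.replicate n true) (List.replicate k true)).maps.x_mul
  rw [xOnes, xOnes, xOnes]
  convert this using 3
  · rw [add_assoc, List.replicate_add, List.replicate_succ]
  · rw [add_assoc, add_assoc, List.replicate_add]; rfl

open scoped Stream' in
-- The leading exponent of a normal form in F is determined. If a < a', cancelling x^a leaves a map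
-- that fixes 01111… on one side, while on the other side a positive power of x moves this sequence
-- into the cone of 1, where it stays.
theorem pow_mul_loc_inj {a a' : ℕ} {f f' : RightPerm}
    (h : x [] ^ a * loc [true] f = x [] ^ a' * loc [true] f') : a = a' ∧ f = f' := by
  wlog hle : a ≤ a' generalizing a a' f f'
  · exact (this h.symm (by omega)).imp Eq.symm Eq.symm
  obtain ⟨k, rfl⟩ := Nat.exists_eq_add_of_le hle
  rw [pow_add, mul_assoc, mul_left_cancel_iff] at h
  rcases k with _ | k
  · exact ⟨rfl, loc_injective _ (by simpa using h)⟩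
  · have h₁ := congrArg (app · ([false, true] ++ₛ Stream'.const true)) h
    have h₂ := app_loc_incomp (incomp_cons_not true [] [true]) f (Stream'.const true)
    rw [Bool.not_true] at h₂
    rw [h₂, pow_succ', app_mul, app_mul, maps_x_01,
      maps_x_pow_true k [false]] at h₁
    have h₃ := app_loc_append [true] f' ((List.replicate k true ++ [false]) ++ₛ Stream'.const true)
    rw [← Stream'.append_append_stream] at h₃
    exact absurd (congrArg Stream'.head (h₁.trans h₃)) (by simp [Stream'.cons_append_stream])

/-- Normal forms in F are unique up to trailing zero exponents, and these do not affect the value in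
any group. The empty list is compared with longer ones as if it began with the exponent 0. -/
theorem normalForm_eq_of_xOnes {K : Type*} [Group K] {l l' : List ℕ}
    (h : normalForm xOnes l = normalForm xOnes l') (A : ℕ → K) :
    normalForm A l = normalForm A l' := by
  have hcons (a : ℕ) (l : List ℕ) :
      normalForm xOnes (a :: l) = x [] ^ a * loc [true] (normalForm xOnes l) := by
    rw [normalForm, map_normalForm]
    simp only [xOnes_succ]
    rfl
  have hnil : (1 : RightPerm) = x [] ^ 0 * loc [true] (normalForm xOnes []) := by
    simp [normalForm]
  induction l generalizing A l' with
  | nil =>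
    induction l' generalizing A with
    | nil => rfl
    | cons a l' ih =>
      rw [hcons, normalForm, hnil] at h
      obtain ⟨rfl, h'⟩ := pow_mul_loc_inj h
      rw [normalForm, normalForm, pow_zero, one_mul, ← ih h']
      rfl
  | cons a l ih =>
    cases l' with
    | nil =>
      rw [hcons, normalForm, hnil] at h
      obtain ⟨rfl, h'⟩ := pow_mul_loc_inj h
      rw [normalForm, normalForm, pow_zero, one_mul, ih h']
      rfl
    | cons a' l' =>
      rw [hcons, hcons] at h
      obtain ⟨rfl, h'⟩ := pow_mul_loc_inj h
      rw [normalForm, normalForm, ih h']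

/-- The subgroup of K × F generated by the pairs (A_n, x_{1…1}) is the graph of the homomorphism.
The pairs satisfy the same relations, so each element of the subgroup is a fraction of normal forms.
If its second component is trivial, uniqueness of normal forms in F makes the first one trivial as
well. -/
theorem IsThompson.exists_hom_F {K : Type*} [Group K] {A : ℕ → K} (hA : IsThompson A) :
    ∃ ψ : F →* K, ∀ n, ψ ⟨xOnes n, x_mem_F _⟩ = A n := by
  let Z : ℕ → K × RightPerm := fun n => (A n, xOnes n)
  have hZ : IsThompson Z := fun m n h => Prod.ext (hA m n h) (isThompson_xOnes m n h)
  let Γ := Subgroup.closure (Set.range Z)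
  have hZΓ (n) : Z n ∈ Γ := Subgroup.subset_closure ⟨n, rfl⟩
  have hinj {k : K} (hk : (k, (1 : RightPerm)) ∈ Γ) : k = 1 := by
    obtain ⟨l, l', h⟩ := hZ.exists_fraction hk
    have h₁ := congrArg (MonoidHom.fst K RightPerm) h
    have h₂ := congrArg (MonoidHom.snd K RightPerm) h
    rw [map_mul, map_inv, map_normalForm, map_normalForm] at h₁ h₂
    exact h₁.trans (mul_inv_eq_one.2 (normalForm_eq_of_xOnes (mul_inv_eq_one.1 h₂.symm) A))
  have hex (f : F) : ∃ k : K, (k, (f : RightPerm)) ∈ Γ := by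
    have : F ≤ Γ.map (MonoidHom.snd K RightPerm) := by
      rw [F_eq_closure, Subgroup.closure_le]
      rintro _ (rfl | rfl)
      exacts [⟨Z 0, hZΓ 0, rfl⟩, ⟨Z 1, hZΓ 1, rfl⟩]
    obtain ⟨⟨k, f'⟩, hk, h⟩ := this f.2
    exact ⟨k, by rwa [← h]⟩
  have huniq {k k' : K} {f : RightPerm} (hk : (k, f) ∈ Γ) (hk' : (k', f) ∈ Γ) : k = k' := by
    have : (k * k'⁻¹, (1 : RightPerm)) ∈ Γ := by
      simpa using mul_mem hk (inv_mem hk')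
    exact mul_inv_eq_one.1 (hinj this)
  choose ψ hψ using hex
  exact ⟨MonoidHom.mk' ψ fun f g => huniq (hψ (f * g)) (mul_mem (hψ f) (hψ g)),
    fun n => huniq (hψ _) (hZΓ n)⟩

/-- The presentation of `F` by two generators and two relations. -/
theorem exists_hom_F {K : Type*} [Group K] {a b : K}
    (h₁ : a⁻¹ * b * a * b = b * (a⁻¹ ^ 2 * b * a ^ 2))
    (h₂ : a⁻¹ ^ 2 * b * a ^ 2 * b = b * (a⁻¹ ^ 3 * b * a ^ 3)) :
    ∃ ψ : F →* K, ψ ⟨x [], x_mem_F _⟩ = a ∧ ψ ⟨x [true], x_mem_F _⟩ = b := by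
  let B : ℕ → K := fun n => a⁻¹ ^ n * b * a ^ n
  have hB (n) : B n * a = a * B (n + 1) := by
    simp only [B, pow_succ' a⁻¹, pow_succ a]; group
  have hconj (j : ℕ) {m n k l : ℕ} (h : B m * B n = B k * B l) :
      B (m + j) * B (n + j) = B (k + j) * B (l + j) := by
    induction j with
    | zero => exact h
    | succ j ih =>
      have e (n) : B (n + 1) = a⁻¹ * B n * a := by rw [mul_assoc, hB]; group
      rw [← add_assoc, ← add_assoc, ← add_assoc, ← add_assoc, e, e, e, e]
      calc _ = a⁻¹ * (B (m + j) * B (n + j)) * a := by group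
        _ = _ := by rw [ih]; group
  -- Two consecutive relations are carried along: the next one follows from the second of them and
  -- from the first one with indices shifted by 1 and by 2, after multiplying by B_1 on the left.
  have hC (m : ℕ) : B (m + 1) * B 0 = B 0 * B (m + 2) ∧ B (m + 2) * B 0 = B 0 * B (m + 3) := by
    induction m with
    | zero => exact ⟨by simpa [B] using h₁, by simpa [B] using h₂⟩
    | succ m ih =>
      refine ⟨ih.2, ?_⟩
      have h02 : B 1 * B 0 = B 0 * B 2 := by simpa [B] using h₁
      have e₁ : B (m + 2) * B 1 = B 1 * B (m + 3) := hconj 1 ih.1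
      have e₂ : B (m + 3) * B 2 = B 2 * B (m + 4) := hconj 2 ih.1
      refine mul_left_cancel (a := B 1) ?_
      calc B 1 * (B (m + 3) * B 0) = B (m + 2) * (B 1 * B 0) := by rw [← mul_assoc, ← e₁, mul_assoc]
        _ = B 0 * (B (m + 3) * B 2) := by rw [h02, ← mul_assoc, ih.2, mul_assoc]
        _ = B 1 * (B 0 * B (m + 4)) := by rw [e₂, ← mul_assoc, ← h02, mul_assoc]
  let A : ℕ → K := fun n => n.casesOn a B
  have hA : IsThompson A := by
    intro m n hmn
    rcases n with _ | n
    · obtain ⟨m, rfl⟩ := Nat.exists_eq_add_of_lt hmn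
      rw [zero_add]
      exact hB m
    · obtain ⟨k, rfl⟩ := Nat.exists_eq_add_of_lt hmn
      have := hconj n (hC k).1
      rw [zero_add] at this
      rw [show n + 1 + k + 1 = k + 1 + n + 1 by omega]
      change B (k + 1 + n) * B n = B n * B (k + 1 + n + 1)
      rw [this]
      congr 2
      omega
  obtain ⟨ψ, hψ⟩ := hA.exists_hom_F
  exact ⟨ψ, hψ 0, (hψ 1).trans (by simp [A, B])⟩

/-! ### Normal forms -/

/-- `x_s` as an element of `F`. -/
def xF (s : List Bool) : F := ⟨x s, x_mem_F s⟩

/-- `g` or `g⁻¹`, depending on the sign `e`. -/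
def sg {K : Type*} [Group K] (g : K) (e : Bool) : K := if e then g else g⁻¹

section sg

variable {K L : Type*} [Group K] [Group L]

@[simp] theorem sg_true (g : K) : sg g true = g := rfl

@[simp] theorem sg_false (g : K) : sg g false = g⁻¹ := rfl

theorem map_sg (f : K →* L) (g : K) (e : Bool) : f (sg g e) = sg (f g) e := by
  cases e <;> simp

theorem sg_mul_eq {g h f : K} (H : g * f = f * h) (e : Bool) : sg g e * f = f * sg h e := by
  cases e
  · rw [sg_false, sg_false, inv_mul_eq_iff_eq_mul, ← mul_assoc, H, mul_inv_cancel_right]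
  · exact H

theorem commute_sg_left {g h : K} (H : Commute g h) (e : Bool) : Commute (sg g e) h := by
  cases e
  · exact H.inv_left
  · exact H

theorem sg_mem {H : Subgroup K} {g : K} (hg : g ∈ H) (e : Bool) : sg g e ∈ H := by
  cases e
  · exact inv_mem hg
  · exact hg

end sg

theorem coe_sg_xF (s : List Bool) (e : Bool) : ((sg (xF s) e : F) : RightPerm) = sg (x s) e := by
  cases e <;> rfl

/-- With e in the role of the digit 1, both x and x⁻¹ follow the rules ēē ↦ ē, ēe ↦ eē, e ↦ ee. This
allows y and y⁻¹ to be treated together from here on. -/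
theorem maps_sg_x₁ (s : List Bool) (e : Bool) :
    Maps (sg (x s) e) (s ++ [!e] ++ [!e]) (s ++ [!e]) := by
  cases e
  · simpa using (maps_x_append maps_x_1 s []).inv
  · simpa using maps_x_append maps_x_00 s []

theorem maps_sg_x₂ (s : List Bool) (e : Bool) :
    Maps (sg (x s) e) (s ++ [!e] ++ [e]) (s ++ [e] ++ [!e]) := by
  cases e
  · simpa using (maps_x_append maps_x_01 s []).inv
  · simpa using maps_x_append maps_x_01 s []

theorem maps_sg_x₃ (s : List Bool) (e : Bool) :
    Maps (sg (x s) e) (s ++ [e]) (s ++ [e] ++ [e]) := by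
  cases e
  · simpa using (maps_x_append maps_x_00 s []).inv
  · simpa using maps_x_append maps_x_1 s []

theorem incomp_append_singleton (s : List Bool) (d : Bool) : Incomp (s ++ [d]) (s ++ [!d]) :=
  incomp_append_same.2 (incomp_cons_not d [] [])

theorem incomp_append_singleton' (s : List Bool) (d : Bool) : Incomp (s ++ [!d]) (s ++ [d]) :=
  (incomp_append_singleton s d).symm

/-! ### Models and signed trees -/

/-- A set of words that is closed under extension and under the partial action of `F`. -/
structure IsAdmissible (A : List Bool → Prop) : Prop where
  append : ∀ s v, A s → A (s ++ v)
  maps : ∀ f ∈ F, ∀ t u, Maps f t u → A t → A u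

/-- A group with a homomorphism from `F` and with elements `y_s`, for `s` in the set `A`, such that
the relations hold that involve some `y_s`. -/
structure Model (A : List Bool → Prop) (K : Type*) [Group K] where
  ψ : F →* K
  Y : List Bool → K
  conj : ∀ (f : F) (t u : List Bool), A t → Maps f t u → Y t * ψ f = ψ f * Y u
  comm : ∀ s t : List Bool, Incomp s t → A s → A t → Commute (Y s) (Y t)
  expand : ∀ s : List Bool, A s →
    Y s = ψ (xF s) * Y (s ++ [false]) * (Y (s ++ [true, false]))⁻¹ * Y (s ++ [true, true])

/-- Binary trees with signs attached to the vertices. They describe products of elements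
`y_s ^ (±1)` in which the longer indices come first. -/
inductive YTree : Type
  | leaf : YTree
  | node (c : Bool → YTree) : YTree
  | up (e : Bool) (T : YTree) : YTree

namespace YTree

/-- The function on `Bool` with value `a` at `!e` and `b` at `e`. -/
def pair (e : Bool) (a b : YTree) (d : Bool) : YTree := if d = e then b else a

@[simp] theorem pair_self (e : Bool) (a b : YTree) : pair e a b e = b := by simp [pair]

@[simp] theorem pair_not (e : Bool) (a b : YTree) : pair e a b (!e) = a := by simp [pair]

/-- The indices of all `y_s` that occur belong to `A`. -/
def Allowed (A : List Bool → Prop) : YTree → List Bool → Prop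
  | leaf, _ => True
  | node c, s => ∀ d, Allowed A (c d) (s ++ [d])
  | up _ T, s => A s ∧ Allowed A T s

/-- The states after reading digits with `y` (initial state `some true`) or `y⁻¹` (initial state
`some false`). -/
def step (d : Bool) : Option Bool → Option Bool
  | some e => if e = d then some d else none
  -- The state `none` means that y^e has read one ē. The next digit alone decides how to continue,
  -- since ēe leads to y^ē and ēē to y^e. So e need not be remembered.
  | none => some (!d)

@[simp] theorem step_self (e : Bool) : step e (some e) = some e := by simp [step]

@[simp] theorem step_not (e : Bool) : step (!e) (some e) = none := by simp [step]

@[simp] theorem step_none (e : Bool) : step e none = some (!e) := rfl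

/-- Nothing in the tree cancels against a sign above it which arrives in the state `q`. -/
def NoCancel : Option Bool → YTree → Prop
  | _, leaf => True
  | q, node c => ∀ d, NoCancel (step d q) (c d)
  -- Only the first sign on the way matters. Those below it are compared with it by `Reduced`.
  | q, up e _ => q ≠ some (!e)

/-- There is no potential cancellation in the tree. -/
def Reduced : YTree → Prop
  | leaf => True
  | node c => ∀ d, Reduced (c d)
  | up e T => Reduced T ∧ NoCancel (some e) T

/-- The maximal number of signs on a branch. -/
def count : YTree → ℕ
  | leaf => 0
  | node c => max (count (c false)) (count (c true))
  | up _ T => count T + 1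

theorem forall_bool {P : Bool → Prop} (e : Bool) : (∀ d, P d) ↔ P (!e) ∧ P e := by
  cases e <;> simp [Bool.forall_bool, and_comm]

theorem allowed_pair {A : List Bool → Prop} {e : Bool} {a b : YTree} {s : List Bool} :
    Allowed A (node (pair e a b)) s ↔ Allowed A a (s ++ [!e]) ∧ Allowed A b (s ++ [e]) := by
  rw [Allowed, forall_bool e, pair_self, pair_not]

theorem noCancel_pair {q : Option Bool} {e : Bool} {a b : YTree} :
    NoCancel q (node (pair e a b)) ↔ NoCancel (step (!e) q) a ∧ NoCancel (step e q) b := by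
  rw [NoCancel, forall_bool e, pair_self, pair_not]

theorem reduced_pair {e : Bool} {a b : YTree} :
    Reduced (node (pair e a b)) ↔ Reduced a ∧ Reduced b := by
  rw [Reduced, forall_bool e, pair_self, pair_not]

theorem count_pair (e : Bool) (a b : YTree) :
    count (node (pair e a b)) = max (count a) (count b) := by
  cases e <;> simp [count, pair, max_comm]

theorem count_le_node (c : Bool → YTree) (d : Bool) : count (c d) ≤ count (node c) := by
  cases d <;> simp [count]

end YTree

open YTree

theorem IsAdmissible.allowed_maps {A : List Bool → Prop} (hA : IsAdmissible A) {f : RightPerm}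
    (hf : f ∈ F) {T : YTree} {t u : List Bool} (h : Maps f t u) (hT : T.Allowed A t) :
    T.Allowed A u := by
  induction T generalizing t u with
  | leaf => trivial
  | node c ih => exact fun d => ih d (h.append [d]) (hT d)
  | up e T ih => exact ⟨hA.maps f hf t u h hT.1, ih h hT.2⟩

/-- `f` does not move the sequences that do not extend `s`. -/
def LocalAt (s : List Bool) (f : RightPerm) : Prop := ∀ t, Incomp s t → Maps f t t

theorem localAt_one (s : List Bool) : LocalAt s 1 := fun _ _ => maps_one _

theorem LocalAt.mul {s : List Bool} {f g : RightPerm} (hf : LocalAt s f) (hg : LocalAt s g) :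
    LocalAt s (f * g) := fun t h => (hf t h).mul (hg t h)

theorem LocalAt.of_append {s v : List Bool} {f : RightPerm} (hf : LocalAt (s ++ v) f) :
    LocalAt s f := fun t h => hf t (h.append_left v)

theorem localAt_sg_x (s : List Bool) (e : Bool) : LocalAt s (sg (x s) e) := fun t h => by
  have : Maps (x s) t t := by rw [x_eq_loc]; exact h.maps_loc _
  cases e
  · exact this.inv
  · exact this

/-! ### Rewriting into reduced trees -/

namespace Model

variable {A : List Bool → Prop} {K : Type*} [Group K] (m : Model A K)

/-- The element described by a tree with root `s`. -/
def val : YTree → List Bool → K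
  | leaf, _ => 1
  | node c, s => val (c false) (s ++ [false]) * val (c true) (s ++ [true])
  | up e T, s => val T s * sg (m.Y s) e

theorem conj_val {f : F} {T : YTree} {t u : List Bool}
    (h : Maps f t u) (hT : T.Allowed A t) : m.val T t * m.ψ f = m.ψ f * m.val T u := by
  induction T generalizing t u with
  | leaf => rw [val, val, one_mul, mul_one]
  | node c ih =>
    rw [val, val, mul_assoc, ih true (h.append [true]) (hT true), ← mul_assoc,
      ih false (h.append [false]) (hT false), mul_assoc]
  | up e T ih =>
    rw [val, val, mul_assoc, sg_mul_eq (m.conj f t u hT.1 h), ← mul_assoc, ih h hT.2, mul_assoc]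

theorem commute_Y_val {T : YTree} {s t : List Bool} (h : Incomp s t) (hs : A s)
    (hT : T.Allowed A t) : Commute (m.Y s) (m.val T t) := by
  induction T generalizing t with
  | leaf => exact Commute.one_right _
  | node c ih =>
    exact (ih false (h.append_right _) (hT false)).mul_right (ih true (h.append_right _) (hT true))
  | up e T ih =>
    exact (ih h hT.2).mul_right (commute_sg_left (m.comm s t h hs hT.1).symm e).symm

theorem commute_val_val {T T' : YTree} {s t : List Bool} (h : Incomp s t) (hT : T.Allowed A s)
    (hT' : T'.Allowed A t) : Commute (m.val T s) (m.val T' t) := by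
  induction T generalizing s with
  | leaf => exact Commute.one_left _
  | node c ih =>
    exact (ih false (h.append_left _) (hT false)).mul_left (ih true (h.append_left _) (hT true))
  | up e T ih =>
    exact (ih h hT.2).mul_left (commute_sg_left (m.commute_Y_val h hT.1 hT') e)

theorem val_node (e : Bool) {c : Bool → YTree} {s : List Bool} (h : (node c).Allowed A s) :
    m.val (node c) s = m.val (c !e) (s ++ [!e]) * m.val (c e) (s ++ [e]) := by
  cases e
  · exact m.commute_val_val (incomp_append_singleton s false) (h false) (h true)
  · rfl

/-- `w` is the product of an element of `F` and a reduced tree with root `s`. -/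
def Form (s : List Bool) (w : K) : Prop :=
  ∃ f : F, LocalAt s f ∧ ∃ T : YTree, T.Allowed A s ∧ T.Reduced ∧ w = m.ψ f * m.val T s

theorem form_val {T : YTree} {s : List Bool} (hT : T.Allowed A s) (hr : T.Reduced) :
    m.Form s (m.val T s) := ⟨1, localAt_one s, T, hT, hr, by rw [map_one, one_mul]⟩

theorem Form.mul_left {m : Model A K} {s : List Bool} {w : K} (h : m.Form s w) {f : F}
    (hf : LocalAt s f) : m.Form s (m.ψ f * w) := by
  obtain ⟨f', hf', T, hT, hr, rfl⟩ := h
  exact ⟨f * f', hf.mul hf', T, hT, hr, by rw [map_mul, mul_assoc]⟩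

/-- The element of F belonging to the second child is supported in the cone of that child, so it
passes the tree at the first child. This is why `Form` requires local support. -/
theorem form_node (e : Bool) {s : List Bool} {v w : K}
    (hv : m.Form (s ++ [!e]) v) (hw : m.Form (s ++ [e]) w) : m.Form s (v * w) := by
  obtain ⟨f, hf, T, hT, hTr, rfl⟩ := hv
  obtain ⟨g, hg, T', hT', hTr', rfl⟩ := hw
  refine ⟨f * g, hf.of_append.mul hg.of_append, node (pair e T T'), allowed_pair.2 ⟨hT, hT'⟩,
    reduced_pair.2 ⟨hTr, hTr'⟩, ?_⟩
  have := m.conj_val (hg _ (incomp_append_singleton s e)) hT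
  rw [m.val_node e (allowed_pair.2 ⟨hT, hT'⟩), pair_not, pair_self, map_mul]
  calc _ = m.ψ f * (m.val T (s ++ [!e]) * m.ψ g) * m.val T' (s ++ [e]) := by simp only [mul_assoc]
    _ = _ := by rw [this]; simp only [mul_assoc]

/-- For e = 0 this is the inverse of the expansion relation. Moving x_s⁻¹ to the front changes the
indices s11, s10, s0 into s1, s01, s00. -/
theorem sg_expand (hA : IsAdmissible A) {s : List Bool} (hs : A s) (e : Bool) :
    sg (m.Y s) e = m.ψ (sg (xF s) e) * (sg (m.Y (s ++ [!e])) e *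
      (sg (m.Y (s ++ [e] ++ [!e])) (!e) * sg (m.Y (s ++ [e] ++ [e])) e)) := by
  cases e
  · have hx := m.expand s hs
    have h (t u) (htu : Maps (x s) (s ++ t) (s ++ u)) :
        (m.Y (s ++ t)) = m.ψ (xF s) * m.Y (s ++ u) * (m.ψ (xF s))⁻¹ := by
      rw [eq_mul_inv_iff_mul_eq]
      exact m.conj (xF s) _ _ (hA.append _ _ hs) htu
    have h₁ := h [true] [true, true] (by simpa using maps_x_append maps_x_1 s [])
    have h₂ := h [false, true] [true, false] (by simpa using maps_x_append maps_x_01 s [])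
    have h₃ := h [false, false] [false] (by simpa using maps_x_append maps_x_00 s [])
    simp only [Bool.not_false, sg_true, sg_false, map_inv, List.append_assoc,
      List.singleton_append]
    rw [hx, h₁, h₂, h₃]
    group
  · simpa [mul_assoc] using m.expand s hs

/-- Moving x_s^(±1) to the left of a tree rotates it: the subtrees at sēē, sēe, se are attached at
sē, seē, see. -/
theorem val_node_node_mul {s : List Bool} {e : Bool} {c c' : Bool → YTree}
    (hc : (node c).Allowed A s) (hc' : c (!e) = node c') :
    m.val (node c) s * m.ψ (sg (xF s) e) = m.ψ (sg (xF s) e) * (m.val (c' !e) (s ++ [!e]) *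
      (m.val (c' e) (s ++ [e] ++ [!e]) * m.val (c e) (s ++ [e] ++ [e]))) := by
  have h₁ := hc (!e)
  rw [hc'] at h₁
  have hx := coe_sg_xF s e
  rw [m.val_node e hc, hc', m.val_node e h₁]
  have e₁ := m.conj_val (f := sg (xF s) e) (hx ▸ maps_sg_x₁ s e) (h₁ !e)
  have e₂ := m.conj_val (f := sg (xF s) e) (hx ▸ maps_sg_x₂ s e) (h₁ e)
  have e₃ := m.conj_val (f := sg (xF s) e) (hx ▸ maps_sg_x₃ s e) (hc e)
  rw [mul_assoc, e₃, ← mul_assoc, mul_assoc (m.val (c' !e) _), e₂, ← mul_assoc, e₁]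
  simp only [mul_assoc]

/-- A sign at the root of a tree can be pushed to the children of the root. -/
theorem push (hA : IsAdmissible A) {s : List Bool} (hs : A s) {e : Bool} {c c' : Bool → YTree}
    (hc : (node c).Allowed A s) (hc' : c (!e) = node c') :
    m.val (node c) s * sg (m.Y s) e = m.ψ (sg (xF s) e) *
      ((m.val (c' !e) (s ++ [!e]) * sg (m.Y (s ++ [!e])) e) *
        ((m.val (c' e) (s ++ [e] ++ [!e]) * sg (m.Y (s ++ [e] ++ [!e])) (!e)) *
          (m.val (c e) (s ++ [e] ++ [e]) * sg (m.Y (s ++ [e] ++ [e])) e))) := by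
  have h₁ := hc (!e)
  rw [hc'] at h₁
  rw [m.sg_expand hA hs, ← mul_assoc, m.val_node_node_mul hc hc']
  have a₂ : (c' e).Allowed A (s ++ [e] ++ [!e]) :=
    hA.allowed_maps (sg_mem (x_mem_F s) e) (maps_sg_x₂ s e) (h₁ e)
  have a₃ : (c e).Allowed A (s ++ [e] ++ [e]) :=
    hA.allowed_maps (sg_mem (x_mem_F s) e) (maps_sg_x₃ s e) (hc e)
  have i := incomp_append_singleton' s e
  have k₁ := commute_sg_left (m.commute_Y_val (i.append_right [!e]) (hA.append _ _ hs) a₂) e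
  have k₂ := commute_sg_left (m.commute_Y_val (i.append_right [e]) (hA.append _ _ hs) a₃) e
  have k₃ := commute_sg_left (m.commute_Y_val (incomp_append_singleton' (s ++ [e]) e)
    (hA.append _ _ (hA.append _ _ hs)) a₃) (!e)
  generalize m.val (c' !e) (s ++ [!e]) = u₁ at *
  generalize m.val (c' e) (s ++ [e] ++ [!e]) = u₂ at *
  generalize m.val (c e) (s ++ [e] ++ [e]) = u₃ at *
  generalize sg (m.Y (s ++ [!e])) e = v₁ at *
  generalize sg (m.Y (s ++ [e] ++ [!e])) (!e) = v₂ at *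
  generalize sg (m.Y (s ++ [e] ++ [e])) e = v₃ at *
  rw [mul_assoc]
  congr 1
  -- Each sign commutes with the subtrees at the other two vertices, so it can be moved next to its
  -- own subtree.
  calc u₁ * (u₂ * u₃) * (v₁ * (v₂ * v₃)) = u₁ * u₂ * (u₃ * v₁) * v₂ * v₃ := by
        simp only [mul_assoc]
    _ = u₁ * (u₂ * v₁) * (u₃ * v₂) * v₃ := by rw [← k₂.eq]; simp only [mul_assoc]
    _ = _ := by rw [← k₁.eq, ← k₃.eq]; simp only [mul_assoc]

/-- A reduced tree can be rewritten as a reduced tree without signs at its root. -/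
theorem deepen (hA : IsAdmissible A) (T : YTree) (s : List Bool) (hT : T.Allowed A s)
    (hr : T.Reduced) : ∃ f : F, LocalAt s f ∧ ∃ c : Bool → YTree, (node c).Allowed A s ∧
      (node c).Reduced ∧ (∀ q, NoCancel q T → NoCancel q (node c)) ∧ (node c).count ≤ T.count ∧
      m.val T s = m.ψ f * m.val (node c) s := by
  -- After the tree below a root sign has been deepened, its child at ē has to be deepened once
  -- more. This child need not be a subtree of T, but its branches carry fewer signs than the
  -- maximum in T, so the number of signs is a decreasing measure.
  induction hn : T.count using Nat.strong_induction_on generalizing T s with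
  | _ n ih =>
    subst hn
    cases T with
    | leaf =>
      exact ⟨1, localAt_one s, fun _ => leaf, fun _ => trivial, fun _ => trivial,
        fun _ _ _ => trivial, by simp [count], by simp [val]⟩
    | node c =>
      exact ⟨1, localAt_one s, c, hT, hr, fun _ h => h, le_rfl, by simp⟩
    | up e T =>
      obtain ⟨f, hf, c, hc, hcr, hcn, hcc, hval⟩ := ih T.count (by simp [count]) T s hT.2 hr.1 rfl
      have hlt := (count_le_node c (!e)).trans_lt (hcc.trans_lt (Nat.lt_succ_self _))
      obtain ⟨f', hf', c', hc', hcr', hcn', hcc', hval'⟩ :=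
        ih (c !e).count hlt (c !e) (s ++ [!e]) (hc !e) (hcr !e) rfl
      have a₁ : (c' !e).Allowed A (s ++ [!e]) :=
        hA.allowed_maps (sg_mem (x_mem_F s) e) (maps_sg_x₁ s e) (hc' !e)
      have a₂ : (c' e).Allowed A (s ++ [e] ++ [!e]) :=
        hA.allowed_maps (sg_mem (x_mem_F s) e) (maps_sg_x₂ s e) (hc' e)
      have a₃ : (c e).Allowed A (s ++ [e] ++ [e]) :=
        hA.allowed_maps (sg_mem (x_mem_F s) e) (maps_sg_x₃ s e) (hc e)
      have hs := hT.1
      -- The sign e at the root reaches the three subtrees in the states e, ē, e after reading ēē,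
      -- ēe, e. These are the signs placed there, so the absence of cancellation with the root sign
      -- is what keeps the new tree reduced.
      have hn := hcn _ hr.2
      have hn₁ := hcn' _ (hn !e)
      have n₁ := hn₁ (!e)
      have n₂ := hn₁ e
      have n₃ := hn e
      rw [step_not] at n₁ n₂
      have n₁' : NoCancel (some e) (c' !e) := by simpa using n₁
      rw [step_none] at n₂
      rw [step_self] at n₃
      have all : (node (pair e (up e (c' !e)) (node (pair e (up (!e) (c' e)) (up e (c e)))))).Allowed
          A s := allowed_pair.2 ⟨⟨hA.append _ _ hs, a₁⟩, allowed_pair.2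
            ⟨⟨hA.append _ _ (hA.append _ _ hs), a₂⟩, ⟨hA.append _ _ (hA.append _ _ hs), a₃⟩⟩⟩
      refine ⟨f * f' * sg (xF s) e, (hf.mul hf'.of_append).mul (coe_sg_xF s e ▸ localAt_sg_x s e),
        pair e (up e (c' !e)) (node (pair e (up (!e) (c' e)) (up e (c e)))), all, ?_, ?_, ?_, ?_⟩
      · exact reduced_pair.2 ⟨⟨hcr' _, n₁'⟩, reduced_pair.2 ⟨⟨hcr' _, n₂⟩, ⟨hcr _, n₃⟩⟩⟩
      · intro q hq
        rw [noCancel_pair, noCancel_pair]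
        simp only [NoCancel] at hq ⊢
        revert hq
        rcases q with _ | _ | _ <;> cases e <;> decide
      · have c₁ := count_le_node c' (!e)
        have c₂ := count_le_node c' e
        have c₃ := count_le_node c e
        rw [count_pair, count_pair]
        simp only [count] at hcc hcc' c₁ c₂ c₃ hlt ⊢
        omega
      · have hk : (node (pair e (node c') (c e))).Allowed A s := allowed_pair.2 ⟨hc', hc e⟩
        have e₁ : m.val (node c) s = m.ψ f' * m.val (node (pair e (node c') (c e))) s := by
          rw [m.val_node e hc, hval', m.val_node e hk, pair_not, pair_self, mul_assoc]
        rw [show m.val (up e T) s = m.val T s * sg (m.Y s) e from rfl, hval, e₁, mul_assoc, mul_assoc, m.push hA hs hk (pair_not _ _ _), pair_self,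
          m.val_node e all, pair_not, pair_self, m.val_node e (allowed_pair.1 all).2, pair_not, pair_self,
          map_mul, map_mul]
        simp only [val, mul_assoc]

theorem form_push (hA : IsAdmissible A) {s : List Bool} (hs : A s) {e : Bool} {c c' : Bool → YTree}
    (hc : (node c).Allowed A s) (hc' : c (!e) = node c')
    (h₁ : m.Form (s ++ [!e]) (m.val (c' !e) (s ++ [!e]) * sg (m.Y (s ++ [!e])) e))
    (h₂ : m.Form (s ++ [e] ++ [!e])
      (m.val (c' e) (s ++ [e] ++ [!e]) * sg (m.Y (s ++ [e] ++ [!e])) (!e)))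
    (h₃ : m.Form (s ++ [e] ++ [e]) (m.val (c e) (s ++ [e] ++ [e]) * sg (m.Y (s ++ [e] ++ [e])) e)) :
    m.Form s (m.val (node c) s * sg (m.Y s) e) := by
  rw [m.push hA hs hc hc']
  exact (m.form_node e h₁ (m.form_node e h₂ h₃)).mul_left
    (coe_sg_xF s e ▸ localAt_sg_x s e)

/-- Reduced trees can be multiplied by a sign at the root. -/
theorem form_val_mul_sg (hA : IsAdmissible A) (T : YTree) (s : List Bool) (e : Bool) (hs : A s)
    (hT : T.Allowed A s) (hr : T.Reduced) : m.Form s (m.val T s * sg (m.Y s) e) := by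
  have hup {T : YTree} {s : List Bool} {e : Bool} (hs : A s) (hT : T.Allowed A s)
      (hr : T.Reduced) (hn : NoCancel (some e) T) : m.Form s (m.val T s * sg (m.Y s) e) :=
    m.form_val (T := up e T) ⟨hs, hT⟩ ⟨hr, hn⟩
  let Q (T : YTree) : Prop := ∀ (s : List Bool) (e : Bool), A s → T.Allowed A s → T.Reduced →
    m.Form s (m.val T s * sg (m.Y s) e)
  -- Pushing a sign through two levels reaches grandchildren, so the induction hypothesis has to
  -- cover the children of a child as well.
  suffices Q T ∧ ∀ c, T = node c → ∀ d, Q (c d) from this.1 s e hs hT hr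
  clear hs hT hr s e
  induction T with
  | leaf => exact ⟨fun s e hs hT hr => hup hs hT hr trivial, fun c h => by simp at h⟩
  | up e' T _ =>
    refine ⟨fun s e hs hT hr => ?_, fun c h => by simp at h⟩
    by_cases he : e' = e
    · subst he
      exact hup hs hT hr (by simp [NoCancel])
    · obtain rfl : e' = !e := by cases e <;> cases e' <;> simp_all
      have : m.val (up (!e) T) s * sg (m.Y s) e = m.val T s := by
        rw [val, mul_assoc]
        cases e <;> simp
      rw [this]
      exact m.form_val hT.2 hr.1
  | node c ih =>
    refine ⟨fun s e hs hT hr => ?_, fun c' h d => by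
      rw [node.injEq] at h; exact h ▸ (ih d).1⟩
    have a₃ : (c e).Allowed A (s ++ [e] ++ [e]) :=
      hA.allowed_maps (sg_mem (x_mem_F s) e) (maps_sg_x₃ s e) (hT e)
    have hs₁ : A (s ++ [!e]) := hA.append _ _ hs
    have hs₂ : A (s ++ [e] ++ [!e]) := hA.append _ _ (hA.append _ _ hs)
    have hs₃ : A (s ++ [e] ++ [e]) := hA.append _ _ (hA.append _ _ hs)
    have h₃ := (ih e).1 (s ++ [e] ++ [e]) e hs₃ a₃ (hr e)
    -- If nothing in the child at ē cancels, the child is deepened to a node and the two signs are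
    -- placed there. Otherwise it already is a node, because a leaf or a sign never cancels in the
    -- state `none`, and induction applies to its children.
    by_cases hn : NoCancel none (c !e)
    · obtain ⟨f, hf, c', hc', hcr', hcn', -, hval'⟩ :=
        m.deepen hA (c !e) (s ++ [!e]) (hT !e) (hr !e)
      have a₁ : (c' !e).Allowed A (s ++ [!e]) :=
        hA.allowed_maps (sg_mem (x_mem_F s) e) (maps_sg_x₁ s e) (hc' !e)
      have a₂ : (c' e).Allowed A (s ++ [e] ++ [!e]) :=
        hA.allowed_maps (sg_mem (x_mem_F s) e) (maps_sg_x₂ s e) (hc' e)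
      have n₁ : NoCancel (some e) (c' !e) := by simpa using hcn' _ hn (!e)
      have n₂ : NoCancel (some !e) (c' e) := hcn' _ hn e
      have hk : (node (pair e (node c') (c e))).Allowed A s := allowed_pair.2 ⟨hc', hT e⟩
      have e₁ : m.val (node c) s = m.ψ f * m.val (node (pair e (node c') (c e))) s := by
        rw [m.val_node e hT, hval', m.val_node e hk, pair_not, pair_self, mul_assoc]
      rw [e₁, mul_assoc]
      refine (m.form_push hA hs hk (pair_not _ _ _) (hup hs₁ a₁ (hcr' _) n₁)
        (hup hs₂ a₂ (hcr' _) n₂) ?_).mul_left hf.of_append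
      rwa [pair_self]
    · cases hce : c (!e) with
      | leaf => rw [hce] at hn; exact (hn trivial).elim
      | up e' T => rw [hce] at hn; exact (hn (by simp [NoCancel])).elim
      | node c' =>
        have hT' := hT (!e)
        have hr' := hr (!e)
        rw [hce] at hT' hr'
        have a₁ : (c' !e).Allowed A (s ++ [!e]) :=
          hA.allowed_maps (sg_mem (x_mem_F s) e) (maps_sg_x₁ s e) (hT' !e)
        have a₂ : (c' e).Allowed A (s ++ [e] ++ [!e]) :=
          hA.allowed_maps (sg_mem (x_mem_F s) e) (maps_sg_x₂ s e) (hT' e)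
        exact m.form_push hA hs hT hce ((ih !e).2 c' hce (!e) _ _ hs₁ a₁ (hr' _))
          ((ih !e).2 c' hce e _ _ hs₂ a₂ (hr' _)) h₃

/-- The root and its child at ē are first freed of signs, after which x_s^(±1) acts as a rotation.
-/
theorem form_val_mul_x (hA : IsAdmissible A) (T : YTree) (s : List Bool) (e : Bool)
    (hT : T.Allowed A s) (hr : T.Reduced) : m.Form s (m.val T s * m.ψ (sg (xF s) e)) := by
  obtain ⟨f, hf, c, hc, hcr, -, -, hval⟩ := m.deepen hA T s hT hr
  obtain ⟨f', hf', c', hc', hcr', -, -, hval'⟩ := m.deepen hA (c !e) (s ++ [!e]) (hc !e) (hcr !e)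
  have hk : (node (pair e (node c') (c e))).Allowed A s := allowed_pair.2 ⟨hc', hc e⟩
  have e₁ : m.val (node c) s = m.ψ f' * m.val (node (pair e (node c') (c e))) s := by
    rw [m.val_node e hc, hval', m.val_node e hk, pair_not, pair_self, mul_assoc]
  rw [hval, e₁, mul_assoc, mul_assoc, m.val_node_node_mul hk (pair_not _ _ _), pair_self]
  refine (((m.form_node e (m.form_val ?_ (hcr' _)) (m.form_node e (m.form_val ?_ (hcr' _))
    (m.form_val ?_ (hcr _)))).mul_left (coe_sg_xF s e ▸ localAt_sg_x s e)).mul_left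
      hf'.of_append).mul_left hf
  · exact hA.allowed_maps (sg_mem (x_mem_F s) e) (maps_sg_x₁ s e) (hc' !e)
  · exact hA.allowed_maps (sg_mem (x_mem_F s) e) (maps_sg_x₂ s e) (hc' e)
  · exact hA.allowed_maps (sg_mem (x_mem_F s) e) (maps_sg_x₃ s e) (hc e)

/-- Deepening along the path from p to p ++ s exposes the subtree at p ++ s, the only one affected
by g. -/
theorem form_val_mul (hA : IsAdmissible A) {p s : List Bool} {g : K}
    (hg : ∀ T : YTree, T.Allowed A (p ++ s) → T.Reduced → m.Form (p ++ s) (m.val T (p ++ s) * g))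
    (T : YTree) (hT : T.Allowed A p) (hr : T.Reduced) : m.Form p (m.val T p * g) := by
  induction s generalizing p T with
  | nil => rw [List.append_nil] at hg; exact hg T hT hr
  | cons d s ih =>
    obtain ⟨f, hf, c, hc, hcr, -, -, hval⟩ := m.deepen hA T p hT hr
    rw [hval, m.val_node d hc, mul_assoc, mul_assoc]
    refine (m.form_node d (m.form_val (hc _) (hcr _)) (ih ?_ _ (hc d) (hcr d))).mul_left hf
    rwa [← List.append_cons]

theorem Form.mul_right (hA : IsAdmissible A) {w : K} (h : m.Form [] w) {s : List Bool} {g : K}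
    (hg : ∀ T : YTree, T.Allowed A s → T.Reduced → m.Form s (m.val T s * g)) :
    m.Form [] (w * g) := by
  obtain ⟨f, hf, T, hT, hr, rfl⟩ := h
  rw [mul_assoc]
  exact (m.form_val_mul hA (p := []) (s := s) hg T hT hr).mul_left hf

/-- The symbols generate the group. -/
def Generates : Prop :=
  Subgroup.closure (Set.range (fun s => m.ψ (xF s)) ∪ m.Y '' {s | A s}) = ⊤

theorem Generates.form {m : Model A K} (h : m.Generates) (hA : IsAdmissible A) (w : K) :
    m.Form [] w := by
  have hw : w ∈ Subgroup.closure (Set.range (fun s => m.ψ (xF s)) ∪ m.Y '' {s | A s}) := by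
    rw [h]; trivial
  have key (g : K) (hg : g ∈ Set.range (fun s => m.ψ (xF s)) ∪ m.Y '' {s | A s}) (e : Bool) :
      ∃ s, ∀ T : YTree, T.Allowed A s → T.Reduced → m.Form s (m.val T s * sg g e) := by
    rcases hg with ⟨s, rfl⟩ | ⟨s, hs, rfl⟩
    · refine ⟨s, fun T hT hr => ?_⟩
      rw [← map_sg]
      exact m.form_val_mul_x hA T s e hT hr
    · exact ⟨s, fun T hT hr => m.form_val_mul_sg hA T s e hs hT hr⟩
  induction hw using Subgroup.closure_induction_right with
  | one => exact m.form_val (T := leaf) trivial trivial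
  | mul_right w _ g hg ih =>
    obtain ⟨s, hs⟩ := key g hg true
    exact Form.mul_right m hA ih hs
  | mul_inv_cancel w _ g hg ih =>
    obtain ⟨s, hs⟩ := key g hg false
    exact Form.mul_right m hA ih hs

end Model

end Cantor

namespace Cantor

open scoped Stream' Matrix

/-! ### Cusps

A sequence `p000…` is identified with a vector in `ℤ²` (a rational point of the projective line),
on which the digits and `y` act by matrices. -/

/-- The matrix of the map `η ↦ dη`. -/
def digitMat (d : Bool) : Matrix (Fin 2) (Fin 2) ℤ := if d then !![1, 1; 0, 1] else !![1, 0; 1, 1]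

/-- The matrix of `y` (for `e = true`) or `y⁻¹` (for `e = false`). -/
def yMat (e : Bool) : Matrix (Fin 2) (Fin 2) ℤ := if e then !![2, 0; 0, 1] else !![1, 0; 0, 2]

/-- The matrix of the map `η ↦ uη`. -/
def wordMat (u : List Bool) : Matrix (Fin 2) (Fin 2) ℤ := (u.map digitMat).prod

theorem wordMat_cons (d : Bool) (u : List Bool) : wordMat (d :: u) = digitMat d * wordMat u :=
  List.prod_cons

theorem wordMat_append (u v : List Bool) : wordMat (u ++ v) = wordMat u * wordMat v := by
  simp [wordMat]

theorem det_digitMat (d : Bool) : (digitMat d).det = 1 := by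
  cases d <;> simp [digitMat, Matrix.det_fin_two]

theorem det_yMat (e : Bool) : (yMat e).det = 2 := by
  cases e <;> simp [yMat, Matrix.det_fin_two]

theorem det_wordMat (u : List Bool) : (wordMat u).det = 1 := by
  induction u with
  | nil => exact Matrix.det_one
  | cons d u ih => rw [wordMat_cons, Matrix.det_mul, det_digitMat, ih, one_mul]

/-- In terms of t ↦ 2t, the rules for e = 1 are 2(t + 1) = 2t + 2, then 2(t + 1)/(t + 2) = 1 + t/(t
+ 2) and 2t/(1 + 2t) for the prefixes 1, 01 and 00. -/
theorem yMat_same (e : Bool) :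
    yMat e * digitMat e = digitMat e * (digitMat e * yMat e) := by
  cases e <;> decide

theorem yMat_swap (e : Bool) :
    yMat e * (digitMat (!e) * digitMat e) = digitMat e * (digitMat (!e) * yMat (!e)) := by
  cases e <;> decide

theorem yMat_contract (e : Bool) :
    yMat e * (digitMat (!e) * digitMat (!e)) = digitMat (!e) * yMat e := by
  cases e <;> decide

/-- The vector of the sequence `p000…`. -/
def cusp (p : List Bool) : Fin 2 → ℤ := wordMat p *ᵥ ![0, 1]

theorem cusp_append (u p : List Bool) : cusp (u ++ p) = wordMat u *ᵥ cusp p := by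
  rw [cusp, wordMat_append, cusp, Matrix.mulVec_mulVec]

theorem cusp_cons (d : Bool) (p : List Bool) : cusp (d :: p) = digitMat d *ᵥ cusp p := by
  rw [cusp, wordMat_cons, cusp, Matrix.mulVec_mulVec]

theorem cusp_nil : cusp [] = ![0, 1] := by
  rw [cusp, show wordMat [] = 1 from rfl, Matrix.one_mulVec]

theorem cusp_false : cusp [false] = cusp [] := by
  rw [cusp_cons, cusp_nil]; decide

theorem cusp_append_false (p : List Bool) : cusp (p ++ [false]) = cusp p := by
  rw [cusp_append, cusp_false, ← cusp_append, List.append_nil]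

theorem cusp_replicate (n : ℕ) : cusp (List.replicate n false) = cusp [] := by
  induction n with
  | zero => rfl
  | succ n ih => rw [List.replicate_succ', cusp_append_false, ih]

/-- The sequence `000…`. -/
def zeros : Stream' Bool := Stream'.const false

theorem zeros_eq : zeros = [false] ++ₛ zeros := Stream'.const_eq false

theorem append_false_zeros (p : List Bool) : (p ++ [false]) ++ₛ zeros = p ++ₛ zeros := by
  rw [Stream'.append_append_stream, ← zeros_eq]

/-- The two words differ only by trailing zeros, and the matrix of the digit 0 fixes the vector (0,
1). -/
theorem cusp_eq_of_eq {p q : List Bool} (h : p ++ₛ zeros = q ++ₛ zeros) : cusp p = cusp q := by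
  induction p generalizing q with
  | nil => rw [eq_replicate_of_const h, cusp_replicate]
  | cons d p ih =>
    cases q with
    | nil => rw [eq_replicate_of_const h.symm, cusp_replicate]
    | cons e q =>
      obtain rfl : d = e := congrArg Stream'.head h
      rw [cusp_cons, cusp_cons, ih (congrArg Stream'.tail h)]

theorem yFun_zeros (e : Bool) : yFun e zeros = zeros := by
  have h (n : ℕ) : ∀ e, yFun e zeros n = false := by
    induction n using Nat.strong_induction_on with
    | _ n ih =>
      intro e
      cases e
      · rw [zeros_eq]
        have := yFun_same false zeros
        change yFun false ([false] ++ₛ zeros) = _ at this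
        rw [this]
        rcases n with _ | _ | n
        · rfl
        · rfl
        · exact ih n (by omega) false
      · rw [zeros_eq, zeros_eq]
        have := yFun_contract true zeros
        change yFun true ([false] ++ₛ ([false] ++ₛ zeros)) = _ at this
        rw [this]
        rcases n with _ | n
        · rfl
        · exact ih n (by omega) true
  exact funext fun n => h n e

theorem exists_yFun_cusp_nil (e : Bool) : ∃ (p' : List Bool) (g : ℤ),
    yFun e ([] ++ₛ zeros) = p' ++ₛ zeros ∧ yMat e *ᵥ cusp [] = g • cusp p' := by
  refine ⟨[], if e then 1 else 2, yFun_zeros e, ?_⟩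
  rw [cusp_nil]
  cases e <;> decide

theorem exists_yFun_cusp_cons {e d d' : Bool} {q : List Bool} (hd : d ≠ e)
    (hq : ∀ e, ∃ (p' : List Bool) (g : ℤ),
      yFun e (q ++ₛ zeros) = p' ++ₛ zeros ∧ yMat e *ᵥ cusp q = g • cusp p') :
    ∃ (p' : List Bool) (g : ℤ), yFun e ((d :: d' :: q) ++ₛ zeros) = p' ++ₛ zeros ∧
      yMat e *ᵥ cusp (d :: d' :: q) = g • cusp p' := by
  obtain rfl : d = !e := Bool.eq_not.2 hd
  by_cases hd' : d' = e
  · subst hd'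
    obtain ⟨p', g, h₁, h₂⟩ := hq (!d')
    refine ⟨d' :: (!d') :: p', g, ?_, ?_⟩
    · exact (yFun_swap d' _).trans (by rw [h₁]; rfl)
    · rw [cusp_cons, cusp_cons, Matrix.mulVec_mulVec, Matrix.mulVec_mulVec, mul_assoc, yMat_swap,
        ← Matrix.mulVec_mulVec, ← Matrix.mulVec_mulVec, h₂, Matrix.mulVec_smul,
        Matrix.mulVec_smul, ← cusp_cons, ← cusp_cons]
  · obtain rfl : d' = !e := Bool.eq_not.2 hd'
    obtain ⟨p', g, h₁, h₂⟩ := hq e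
    refine ⟨(!e) :: p', g, ?_, ?_⟩
    · exact (yFun_contract e _).trans (by rw [h₁]; rfl)
    · rw [cusp_cons, cusp_cons, Matrix.mulVec_mulVec, Matrix.mulVec_mulVec, mul_assoc,
        yMat_contract, ← Matrix.mulVec_mulVec, h₂, Matrix.mulVec_smul, ← cusp_cons]

/-- A factor g is needed because the matrix of y^(±1) has determinant 2: already at 000… the matrix
of y⁻¹ doubles the vector. -/
theorem exists_yFun_cusp (p : List Bool) (e : Bool) : ∃ (p' : List Bool) (g : ℤ),
    yFun e (p ++ₛ zeros) = p' ++ₛ zeros ∧ yMat e *ᵥ cusp p = g • cusp p' := by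
  induction hn : p.length using Nat.strong_induction_on generalizing p e with
  | _ n ih =>
    rcases p with _ | ⟨d, p⟩
    · exact exists_yFun_cusp_nil e
    · by_cases hd : d = e
      · subst hd
        obtain ⟨p', g, h₁, h₂⟩ := ih p.length (by simp [← hn]) p d rfl
        refine ⟨d :: d :: p', g, (yFun_same d _).trans (by rw [h₁]; rfl), ?_⟩
        rw [cusp_cons, Matrix.mulVec_mulVec, yMat_same, ← Matrix.mulVec_mulVec,
          ← Matrix.mulVec_mulVec, h₂, Matrix.mulVec_smul, Matrix.mulVec_smul, ← cusp_cons,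
          ← cusp_cons]
      · rcases p with _ | ⟨d', q⟩
        -- The rule for a digit d ≠ e needs a second digit. It is supplied by the zeros that follow.
        · have := exists_yFun_cusp_cons (d' := false) hd exists_yFun_cusp_nil
          rwa [show [d, false] = [d] ++ [false] from rfl, append_false_zeros,
            cusp_append_false] at this
        · exact exists_yFun_cusp_cons hd fun e => ih q.length (by rw [← hn]; simp) q e rfl

/-! ### The action of trees -/

namespace YTree

/-- The permutation described by a tree. -/
def perm : YTree → RightPerm
  | leaf => 1
  | node c => loc [false] (perm (c false)) * loc [true] (perm (c true))
  | up e T => perm T * sg (y []) e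

theorem app_perm_node (c : Bool → YTree) (d : Bool) (ξ : Stream' Bool) :
    app (perm (node c)) ([d] ++ₛ ξ) = [d] ++ₛ app (perm (c d)) ξ := by
  rw [perm, app_mul]
  cases d
  · have := app_loc_incomp (incomp_cons_not true [] []) (perm (c true)) (app (perm (c false)) ξ)
    rw [Bool.not_true] at this
    rw [app_loc_append, this]
  · have := app_loc_incomp (incomp_cons_not false [] []) (perm (c false)) ξ
    rw [Bool.not_false] at this
    rw [this, app_loc_append]

theorem app_sg_y (e : Bool) (ξ : Stream' Bool) : app (sg (y []) e) ξ = yFun e ξ := by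
  cases e
  · exact app_y_nil_inv ξ
  · exact app_y_nil ξ

/-- `M` is the product of the matrices of the digits and signs on the branch `u` of the tree, and
`k` is the number of signs on this branch. -/
inductive Branch : YTree → List Bool → Matrix (Fin 2) (Fin 2) ℤ → ℕ → Prop
  | leaf (u : List Bool) : Branch leaf u (wordMat u) 0
  | node (c : Bool → YTree) (d : Bool) (u : List Bool) (M : Matrix (Fin 2) (Fin 2) ℤ) (k : ℕ)
      (h : Branch (c d) u M k) : Branch (node c) (d :: u) (digitMat d * M) k
  | up (e : Bool) (T : YTree) (u : List Bool) (M : Matrix (Fin 2) (Fin 2) ℤ) (k : ℕ)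
      (h : Branch T u M k) : Branch (up e T) u (yMat e * M) (k + 1)

variable {T : YTree} {u : List Bool} {M : Matrix (Fin 2) (Fin 2) ℤ} {k : ℕ}

theorem Branch.det_eq (h : Branch T u M k) : M.det = 2 ^ k := by
  induction h with
  | leaf u => exact det_wordMat u
  | node c d u M k _ ih => rw [Matrix.det_mul, det_digitMat, ih, one_mul]
  | up e T u M k _ ih => rw [Matrix.det_mul, det_yMat, ih, pow_succ']

theorem Branch.exists_cusp (h : Branch T u M k) (p : List Bool) : ∃ (p' : List Bool) (g : ℤ),
    app T.perm ((u ++ p) ++ₛ zeros) = p' ++ₛ zeros ∧ M *ᵥ cusp p = g • cusp p' := by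
  induction h with
  | leaf u => exact ⟨u ++ p, 1, rfl, by rw [one_smul, cusp_append]⟩
  | node c d u M k _ ih =>
    obtain ⟨p', g, h₁, h₂⟩ := ih
    refine ⟨d :: p', g, ?_, ?_⟩
    · exact (app_perm_node c d ((u ++ p) ++ₛ zeros)).trans (by rw [h₁]; rfl)
    · rw [← Matrix.mulVec_mulVec, h₂, Matrix.mulVec_smul, ← cusp_cons]
  | up e T u M k _ ih =>
    obtain ⟨p', g, h₁, h₂⟩ := ih
    obtain ⟨q, g', h₃, h₄⟩ := exists_yFun_cusp p' e
    refine ⟨q, g * g', ?_, ?_⟩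
    · rw [perm, app_mul, h₁, app_sg_y, h₃]
    · rw [← Matrix.mulVec_mulVec, h₂, Matrix.mulVec_smul, h₄, smul_smul]

/-- The covector modulo `2` that belongs to a state. -/
def stateVec : Option Bool → Fin 2 → ZMod 2
  | some true => ![0, 1]
  | some false => ![1, 0]
  | none => ![1, 1]

/-- Reduction of matrices modulo `2`. -/
abbrev redMat (M : Matrix (Fin 2) (Fin 2) ℤ) : Matrix (Fin 2) (Fin 2) (ZMod 2) :=
  (Int.castRingHom (ZMod 2)).mapMatrix M

theorem redMat_digitMat (d : Bool) : redMat (digitMat d) =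
    if d then !![1, 1; 0, 1] else !![1, 0; 1, 1] := by
  cases d <;> decide

theorem redMat_yMat (e : Bool) : redMat (yMat e) =
    if e then !![0, 0; 0, 1] else !![1, 0; 0, 0] := by
  cases e <;> decide

theorem stateVec_digit (q : Option Bool) (d : Bool) :
    stateVec q ᵥ* redMat (digitMat d) = stateVec (step d q) := by
  rw [redMat_digitMat]
  revert q d
  decide

/-- Modulo 2 the matrix of y^e has rank one. The only nonzero covector that it kills is that of the
opposite state, which is exactly the case of cancellation, and it sends the other two to the
covector of e. -/
theorem stateVec_y (q : Option Bool) (e : Bool) (h : q ≠ some (!e)) :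
    stateVec q ᵥ* redMat (yMat e) = stateVec (some e) := by
  rw [redMat_yMat]
  revert q e
  decide

theorem Branch.stateVec_ne_zero (h : Branch T u M k) (hr : T.Reduced) {q : Option Bool}
    (hq : NoCancel q T) : stateVec q ᵥ* redMat M ≠ 0 := by
  induction h generalizing q with
  | leaf u =>
    clear hq hr
    induction u generalizing q with
    | nil =>
      rw [show wordMat [] = 1 from rfl, redMat, map_one, Matrix.vecMul_one]
      revert q; decide
    | cons d u ih =>
      rw [wordMat_cons, redMat, map_mul, ← Matrix.vecMul_vecMul, stateVec_digit]
      exact ih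
  | node c d u M k _ ih =>
    rw [redMat, map_mul, ← Matrix.vecMul_vecMul, stateVec_digit]
    exact ih (hr d) (hq d)
  | up e T u M k _ ih =>
    rw [redMat, map_mul, ← Matrix.vecMul_vecMul, stateVec_y q e hq]
    exact ih hr.1 hr.2

theorem step_step (d : Bool) (q : Option Bool) : step d (step d q) = q := by
  revert d q; decide

/-- Digits permute the states, so one can start above the first sign of the branch in the state that
arrives there as that very sign. In a reduced tree nothing below kills it. -/
theorem Branch.redMat_ne_zero (h : Branch T u M k) (hr : T.Reduced) : redMat M ≠ 0 := by
  suffices ∃ q, stateVec q ᵥ* redMat M ≠ 0 by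
    obtain ⟨q, hq⟩ := this
    intro h0
    rw [h0, Matrix.vecMul_zero] at hq
    exact hq rfl
  induction h with
  | leaf u => exact ⟨none, (Branch.leaf u).stateVec_ne_zero trivial trivial⟩
  | node c d u M k _ ih =>
    obtain ⟨q, hq⟩ := ih (hr d)
    refine ⟨step d q, ?_⟩
    rw [redMat, map_mul, ← Matrix.vecMul_vecMul, stateVec_digit]
    have : step d (step d q) = q := step_step d q
    rwa [this]
  | up e T u M k h _ =>
    exact ⟨some e, (Branch.up e T u M k h).stateVec_ne_zero hr (by simp [NoCancel])⟩

/-- There are no signs in the tree. -/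
def SignFree : YTree → Prop
  | leaf => True
  | node c => ∀ d, SignFree (c d)
  | up _ _ => False

/-- A leaf can be followed by any word, so branches can be made as long as prefix replacement by an
element of F requires. -/
theorem exists_branch (T : YTree) (n : ℕ) : ∃ u M k, n ≤ u.length ∧ Branch T u M k := by
  induction T with
  | leaf => exact ⟨List.replicate n false, _, _, by simp, .leaf _⟩
  | node c ih =>
    obtain ⟨u, M, k, hu, h⟩ := ih false
    exact ⟨false :: u, _, _, by simp; omega, .node _ _ _ _ _ h⟩
  | up e T ih =>
    obtain ⟨u, M, k, hu, h⟩ := ih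
    exact ⟨u, _, _, hu, .up _ _ _ _ _ h⟩

theorem exists_branch_of_not_signFree (hT : ¬ T.SignFree) (n : ℕ) :
    ∃ u M k, n ≤ u.length ∧ Branch T u M (k + 1) := by
  induction T with
  | leaf => exact (hT trivial).elim
  | node c ih =>
    rw [SignFree, not_forall] at hT
    obtain ⟨d, hd⟩ := hT
    obtain ⟨u, M, k, hu, h⟩ := ih d hd
    exact ⟨d :: u, _, _, by simp; omega, .node _ _ _ _ _ h⟩
  | up e T _ =>
    obtain ⟨u, M, k, hu, h⟩ := exists_branch T n
    exact ⟨u, _, _, hu, .up _ _ _ _ _ h⟩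

/-- A 2 × 2 matrix with the three pairwise independent eigenvectors (0, 1), (1, 1), (1, 2) is
scalar. -/
theorem eq_smul_of_cusps {N : Matrix (Fin 2) (Fin 2) ℤ}
    (h : ∀ p, ∃ g : ℤ, N *ᵥ cusp p = g • cusp p) : N = N 0 0 • (1 : Matrix (Fin 2) (Fin 2) ℤ) := by
  have c₁ : cusp [true] = ![1, 1] := by rw [cusp_cons, cusp_nil]; decide
  have c₂ : cusp [false, true] = ![1, 2] := by rw [cusp_cons, c₁]; decide
  obtain ⟨g₀, h₀⟩ := h []
  obtain ⟨g₁, h₁⟩ := h [true]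
  obtain ⟨g₂, h₂⟩ := h [false, true]
  rw [cusp_nil] at h₀
  rw [c₁] at h₁
  rw [c₂] at h₂
  have a₀ := congrFun h₀ 0
  have b₀ := congrFun h₀ 1
  have a₁ := congrFun h₁ 0
  have b₁ := congrFun h₁ 1
  have a₂ := congrFun h₂ 0
  have b₂ := congrFun h₂ 1
  simp [Matrix.mulVec, dotProduct, Fin.sum_univ_two] at a₀ b₀ a₁ b₁ a₂ b₂
  ext i j
  fin_cases i <;> fin_cases j <;> simp <;> linarith

/-- A reduced tree with a sign does not describe an element of `F`. -/
theorem signFree_of_perm_mem (hr : T.Reduced) (h : T.perm ∈ F) : T.SignFree := by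
  by_contra hT
  obtain ⟨n, hn⟩ := locPrefix_of_mem_F h 0
  obtain ⟨u, M, k, hu, hb⟩ := exists_branch_of_not_signFree hT n
  obtain ⟨v, -, huv⟩ := hn u hu
  -- The action on the cone of u is given by M along the branch and by the word v as a prefix
  -- replacement. Both send cusps to the same cusps, so M is proportional to the matrix of v, whose
  -- inverse is its adjugate.
  have hN (p : List Bool) : ∃ g : ℤ, ((wordMat v).adjugate * M) *ᵥ cusp p = g • cusp p := by
    obtain ⟨p', g, h₁, h₂⟩ := hb.exists_cusp p
    refine ⟨g, ?_⟩
    rw [huv.append p] at h₁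
    rw [← Matrix.mulVec_mulVec, h₂, ← cusp_eq_of_eq h₁, cusp_append, Matrix.mulVec_smul,
      Matrix.mulVec_mulVec, Matrix.adjugate_mul, det_wordMat, one_smul, Matrix.one_mulVec]
  have hN' := eq_smul_of_cusps hN
  generalize ((wordMat v).adjugate * M) 0 0 = g at hN'
  have hM : M = g • wordMat v := by
    have : wordMat v * ((wordMat v).adjugate * M) = wordMat v * (g • 1) := by rw [hN']
    rwa [← mul_assoc, Matrix.mul_adjugate, det_wordMat, one_smul, one_mul, mul_smul_comm,
      mul_one] at this
  have hdet := hb.det_eq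
  rw [hM, Matrix.det_smul, det_wordMat, mul_one, Fintype.card_fin] at hdet
  -- Comparing determinants gives g² = 2^(k+1). So g is even, and M vanishes modulo 2.
  have h2 : (2 : ℤ) ∣ g := Int.prime_two.dvd_of_dvd_pow (hdet ▸ dvd_pow_self 2 (Nat.succ_ne_zero k))
  obtain ⟨g, rfl⟩ := h2
  refine hb.redMat_ne_zero hr ?_
  rw [hM]
  ext i j
  have : (2 : ZMod 2) = 0 := rfl
  rw [redMat, RingHom.mapMatrix_apply, Matrix.map_apply, Matrix.smul_apply, smul_eq_mul, mul_assoc,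
    map_mul, map_ofNat, this, zero_mul, Matrix.zero_apply]

end YTree

open YTree

/-! ### Faithfulness of models -/

namespace Model

variable {A : List Bool → Prop} {K : Type*} [Group K] (m : Model A K)

theorem map_val {φ : K →* RightPerm} (hY : ∀ s, A s → φ (m.Y s) = y s) {T : YTree}
    {s : List Bool} (hT : T.Allowed A s) : φ (m.val T s) = loc s T.perm := by
  induction T generalizing s with
  | leaf => rw [val, perm, map_one, map_one]
  | node c ih => rw [val, perm, map_mul, map_mul, loc_loc, loc_loc, ih _ (hT _), ih _ (hT _)]
  | up e T ih => rw [val, perm, map_mul, map_mul, map_sg, map_sg, ih hT.2, hY s hT.1, ← y_eq_loc]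

theorem val_eq_one {T : YTree} (hT : T.SignFree) (s : List Bool) : m.val T s = 1 := by
  induction T generalizing s with
  | leaf => rfl
  | node c ih => rw [val, ih _ (hT _), ih _ (hT _), one_mul]
  | up e T _ => exact hT.elim

/-- A model that is generated by its symbols is isomorphic to its image in `RightPerm`. -/
theorem Generates.injective {m : Model A K} (h : m.Generates) (hA : IsAdmissible A)
    {φ : K →* RightPerm} (hψ : ∀ f, φ (m.ψ f) = f) (hY : ∀ s, A s → φ (m.Y s) = y s) :
    Function.Injective φ := by
  rw [injective_iff_map_eq_one]
  intro w hw
  obtain ⟨f, -, T, hT, hr, rfl⟩ := h.form hA w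
  rw [map_mul, hψ, m.map_val hY hT, loc_nil] at hw
  -- As w acts trivially, the tree acts as f⁻¹, an element of F.
  have hT' := signFree_of_perm_mem hr (by rw [eq_inv_of_mul_eq_one_right hw]; exact inv_mem f.2)
  have hval := m.val_eq_one hT' []
  have h1 := m.map_val hY hT
  rw [hval, map_one, loc_nil] at h1
  rw [← h1, mul_one] at hw
  rw [hval, mul_one, show f = 1 from Subtype.ext hw, map_one]

end Model

end Cantor

namespace Cantor

/-! ### Models with finitely many relations -/

theorem eq_top_of_mem {H : Subgroup F} (h : xF [] ∈ H) (h1 : xF [true] ∈ H) : H = ⊤ := by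
  rw [eq_top_iff]
  rintro ⟨f, hf⟩ -
  have hle : F ≤ H.map F.subtype := by
    refine F_eq_closure.le.trans ((Subgroup.closure_le _).2 ?_)
    rintro _ (rfl | rfl)
    exacts [⟨_, h, rfl⟩, ⟨_, h1, rfl⟩]
  obtain ⟨g, hg, e⟩ := hle hf
  rwa [show (⟨f, hf⟩ : F) = g from Subtype.ext e.symm]

theorem hom_F_ext {K : Type*} [Group K] {ψ ψ' : F →* K} (h : ψ (xF []) = ψ' (xF []))
    (h1 : ψ (xF [true]) = ψ' (xF [true])) : ψ = ψ' :=
  MonoidHom.eq_of_eqOn_top fun f _ => by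
    have : ψ.eqLocus ψ' = ⊤ := eq_top_of_mem h h1
    exact show f ∈ ψ.eqLocus ψ' by rw [this]; trivial

/-- Localization as an endomorphism of `F`. -/
def locF (s : List Bool) : F →* F :=
  ((loc s).comp F.subtype).codRestrict F fun f => loc_mem_F s f.2

theorem locF_xF (s t : List Bool) : locF s (xF t) = xF (s ++ t) := Subtype.ext (loc_x s t)

/-- F is generated by x and x_1, so its copy behind s is generated by x_s and x_{s1}. -/
theorem commute_locF {K : Type*} [Group K] {ψ : F →* K} {c : K} {s : List Bool}
    (h : Commute c (ψ (xF s))) (h1 : Commute c (ψ (xF (s ++ [true])))) (f : F) :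
    Commute c (ψ (locF s f)) := by
  have : (Subgroup.centralizer {c}).comap (ψ.comp (locF s)) = ⊤ := by
    refine eq_top_of_mem ?_ ?_ <;>
    · rw [Subgroup.mem_comap, MonoidHom.comp_apply, locF_xF, Subgroup.mem_centralizer_singleton_iff]
      first | exact h1.eq.symm | (rw [List.append_nil]; exact h.eq.symm)
  have hf : f ∈ (Subgroup.centralizer {c}).comap (ψ.comp (locF s)) := by rw [this]; trivial
  exact (Subgroup.mem_centralizer_singleton_iff.1 hf).symm

/-- The stabilizer of the cone of 10 is the product of the copies of F behind 0 and behind 11. Its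
four generators account for four of the nine relations. -/
theorem commute_of_maps_10 {K : Type*} [Group K] {ψ : F →* K} {c : K}
    (h0 : Commute c (ψ (xF [false]))) (h01 : Commute c (ψ (xF [false, true])))
    (h11 : Commute c (ψ (xF [true, true]))) (h111 : Commute c (ψ (xF [true, true, true])))
    {f : F} (hf : Maps f [true, false] [true, false]) : Commute c (ψ f) := by
  obtain ⟨f₁, hf₁, f₂, hf₂, h⟩ := stabilizer_10 f.2 hf
  rw [show f = locF [false] ⟨f₁, hf₁⟩ * locF [true, true] ⟨f₂, hf₂⟩ from Subtype.ext h, map_mul]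
  exact (commute_locF h0 h01 _).mul_right (commute_locF h11 h111 _)

theorem commute_of_maps_0 {K : Type*} [Group K] {ψ : F →* K} {c : K}
    (h1 : Commute c (ψ (xF [true]))) (h11 : Commute c (ψ (xF [true, true])))
    {f : F} (hf : Maps f [false] [false]) : Commute c (ψ f) := by
  obtain ⟨f₁, hf₁, h⟩ := stabilizer_0 f.2 hf
  rw [show f = locF [true] ⟨f₁, hf₁⟩ from Subtype.ext h]
  exact commute_locF h1 h11 _

theorem commute_of_maps_1 {K : Type*} [Group K] {ψ : F →* K} {c : K}
    (h0 : Commute c (ψ (xF [false]))) (h01 : Commute c (ψ (xF [false, true])))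
    {f : F} (hf : Maps f [true] [true]) : Commute c (ψ f) := by
  obtain ⟨f₁, hf₁, h⟩ := stabilizer_1 f.2 hf
  rw [show f = locF [false] ⟨f₁, hf₁⟩ from Subtype.ext h]
  exact commute_locF h0 h01 _

theorem commute_of_maps_nil {K : Type*} [Group K] {ψ : F →* K} {c : K}
    {f : F} (hf : Maps f [] []) : Commute c (ψ f) := by
  rw [show f = 1 from Subtype.ext (stabilizer_nil hf), map_one]
  exact Commute.one_right c

/-- Elements `x_s` and `y_s` of a group, for `s` in `A` in the latter case, such that the first
three relations hold. -/
structure PreModel (A : List Bool → Prop) (M : Type*) [Group M] where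
  X : List Bool → M
  Y : List Bool → M
  pentagon : ∀ s, X s ^ 2 = X (s ++ [false]) * X s * X (s ++ [true])
  conj_x : ∀ t s u, XAct t s u → X t * X s = X s * X u
  conj_y : ∀ t s u, XAct t s u → A t → Y t * X s = X s * Y u

/-- Elements `x_s` and `y_s` of a group, for `s` in `A` in the latter case, such that all relations
hold. -/
structure WeakModel (A : List Bool → Prop) (M : Type*) [Group M] extends PreModel A M where
  comm_y : ∀ s t, Incomp s t → A s → A t → Commute (Y s) (Y t)
  expand : ∀ s, A s →
    Y s = X s * Y (s ++ [false]) * (Y (s ++ [true, false]))⁻¹ * Y (s ++ [true, true])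

/-! ### Extending a homomorphism from F to the y_s -/

/-- The homomorphism `ψ` is extended to the `y_s` with given values `C r` for representatives `r`
of the orbits of words. -/
noncomputable def baseY {K : Type*} [Group K] (ψ : F →* K) (C : List Bool → K) (s : List Bool) : K :=
  ψ ⟨_, (exists_maps_rep s).choose_spec.1⟩ * C (rep s) *
    (ψ ⟨_, (exists_maps_rep s).choose_spec.1⟩)⁻¹

section baseY

variable {A : List Bool → Prop} {K : Type*} [Group K] {ψ : F →* K} {C : List Bool → K}
  (hA : IsAdmissible A)
  (hC : ∀ r, rep r = r → A r → ∀ f : F, Maps f r r → Commute (C r) (ψ f))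

include hA hC

/-- The choice of the element of F does not matter: two elements carrying s to its representative
differ by one that fixes the cone of the representative, which commutes with the value of C there.
-/
theorem baseY_eq {s : List Bool} (hs : A s) {f : F} (hf : Maps f s (rep s)) :
    baseY ψ C s = ψ f * C (rep s) * (ψ f)⁻¹ := by
  have hg := (exists_maps_rep s).choose_spec.2
  have hgF := (exists_maps_rep s).choose_spec.1
  change ψ ⟨_, hgF⟩ * C (rep s) * (ψ ⟨_, hgF⟩)⁻¹ = _
  generalize (exists_maps_rep s).choose = g at hg hgF ⊢
  have h := hC (rep s) (rep_eq_of_maps f.2 hf).symm (hA.maps _ f.2 _ _ hf hs)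
    (⟨g, hgF⟩⁻¹ * f) (hg.inv.mul hf)
  rw [map_mul, map_inv] at h
  have h' := h.eq
  generalize ψ ⟨g, hgF⟩ = u at *
  calc u * C (rep s) * u⁻¹ = u * (C (rep s) * (u⁻¹ * ψ f)) * (ψ f)⁻¹ := by group
    _ = _ := by rw [h']; group

theorem baseY_mul {s t : List Bool} (hs : A s) {f : F} (hf : Maps f s t) :
    baseY ψ C s * ψ f = ψ f * baseY ψ C t := by
  obtain ⟨g, hg, hgt⟩ := exists_maps_rep t
  have hrep := rep_eq_of_maps f.2 hf
  have h := baseY_eq hA hC hs (f := f * ⟨g, hg⟩) (hf.mul (hrep ▸ hgt))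
  rw [h, baseY_eq hA hC (hA.maps _ f.2 _ _ hf hs) (f := ⟨g, hg⟩) hgt, map_mul, hrep]
  group

theorem baseY_rep {r : List Bool} (hr : rep r = r) (h : A r) : baseY ψ C r = C r := by
  have := baseY_eq hA hC h (f := 1) (by rw [hr]; exact maps_one r)
  rwa [map_one, one_mul, inv_one, mul_one, hr] at this

/-- The elements `baseY ψ C s` satisfy the relations involving conjugation. -/
noncomputable def basePreModel : PreModel A K where
  X s := ψ (xF s)
  Y := baseY ψ C
  pentagon s := by
    rw [← map_pow, ← map_mul, ← map_mul]
    exact congrArg ψ (Subtype.ext (x_pentagon s))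
  conj_x t s u h := by
    rw [← map_mul, ← map_mul]
    exact congrArg ψ (Subtype.ext h.maps.x_mul)
  conj_y t s u h ht := baseY_mul hA hC ht (f := xF s) h.maps

/-- It suffices to require the remaining relations for representatives of the orbits. -/
noncomputable def baseModel
    (hcomm : ∀ i j k, A (basePair i j k).1 → A (basePair i j k).2 →
      Commute (baseY ψ C (basePair i j k).1) (baseY ψ C (basePair i j k).2))
    (hexp : ∀ r, rep r = r → A r → baseY ψ C r = ψ (xF r) * baseY ψ C (r ++ [false]) *
      (baseY ψ C (r ++ [true, false]))⁻¹ * baseY ψ C (r ++ [true, true])) : Model A K where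
  ψ := ψ
  Y := baseY ψ C
  conj f t u ht h := baseY_mul hA hC ht h
  comm s t h hs ht := by
    obtain ⟨p, d, a, b, rfl, rfl⟩ := h.exists_split
    have key (p a b : List Bool) (hs : A (p ++ false :: a)) (ht : A (p ++ true :: b)) :
        Commute (baseY ψ C (p ++ false :: a)) (baseY ψ C (p ++ true :: b)) := by
      obtain ⟨i, j, k, g, hg, h₁, h₂⟩ := exists_maps_basePair p a b
      have e₁ := eq_mul_inv_of_mul_eq (baseY_mul hA hC hs (f := ⟨g, hg⟩) h₁)
      have e₂ := eq_mul_inv_of_mul_eq (baseY_mul hA hC ht (f := ⟨g, hg⟩) h₂)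
      rw [e₁, e₂]
      have := hcomm i j k (hA.maps g hg _ _ h₁ hs) (hA.maps g hg _ _ h₂ ht)
      exact (Commute.conj_iff _).2 this
    cases d
    · exact key p a b hs ht
    · exact (key p b a ht hs).symm
  expand s hs := by
    obtain ⟨g, hg, hgs⟩ := exists_maps_rep s
    have hrep : rep (rep s) = rep s := (rep_eq_of_maps hg hgs).symm
    have h := hexp (rep s) hrep (hA.maps g hg _ _ hgs hs)
    have e (v : List Bool) : baseY ψ C (s ++ v) =
        ψ ⟨g, hg⟩ * baseY ψ C (rep s ++ v) * (ψ ⟨g, hg⟩)⁻¹ :=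
      eq_mul_inv_of_mul_eq (baseY_mul hA hC (hA.append _ _ hs) (f := ⟨g, hg⟩) (hgs.append v))
    have e₀ := e []
    rw [List.append_nil, List.append_nil] at e₀
    have ex : ψ (xF s) = ψ ⟨g, hg⟩ * ψ (xF (rep s)) * (ψ ⟨g, hg⟩)⁻¹ := by
      rw [eq_mul_inv_iff_mul_eq, ← map_mul, ← map_mul]
      exact congrArg ψ (Subtype.ext hgs.x_mul)
    rw [e₀, e, e, e, ex, h]
    group

end baseY

theorem XAct.one_zero_zero (v : List Bool) :
    XAct (true :: false :: false :: v) [true] (true :: false :: v) := XAct.zero_zero [true] v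

theorem XAct.one_zero_one (v : List Bool) :
    XAct (true :: false :: true :: v) [true] (true :: true :: false :: v) := XAct.zero_one [true] v

/-! ### Short words for some of the symbols -/

namespace PreModel

variable {A : List Bool → Prop} {M : Type*} [Group M] (m : PreModel A M)

theorem X_mem {H : Subgroup M} (h : m.X [] ∈ H) (h1 : m.X [true] ∈ H) (s : List Bool) :
    m.X s ∈ H :=
  mem_of_relations m.pentagon (fun s t u h => m.conj_x t s u h) h h1 s

theorem Y_mem (hA : IsAdmissible A) {H : Subgroup M} (hX : ∀ s, m.X s ∈ H)
    (hnil : A [] → m.Y [] ∈ H) (h0 : A [false] → m.Y [false] ∈ H) (h1 : A [true] → m.Y [true] ∈ H)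
    (h10 : A [true, false] → m.Y [true, false] ∈ H) (s : List Bool) : A s → m.Y s ∈ H := by
  refine XAct.word_induction (P := fun s => A s → m.Y s ∈ H) ?_ ?_ hnil h0 h1 h10 s
  · intro t u h ht hu
    have hAt := hA.maps _ (inv_mem (x_mem_F _)) _ _ h.maps.inv hu
    rw [← inv_mul_eq_iff_eq_mul.2 (m.conj_y t [] u h hAt)]
    exact mul_mem (inv_mem (hX _)) (mul_mem (ht hAt) (hX _))
  · intro k t u h hu ht
    rw [eq_mul_inv_of_mul_eq (m.conj_y t _ u h ht)]
    exact mul_mem (mul_mem (hX _) (hu (hA.maps _ (x_mem_F _) _ _ h.maps ht))) (inv_mem (hX _))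

/-- The words in `a`, `b`, `c` evaluate to the expected elements. -/
structure Evaluates (π : FreeGroup (Fin 3) →* M) : Prop where
  a : π Word.a = m.X []
  b : π Word.b = m.X [true]
  c : π Word.c = m.Y [true, false]

theorem X_conj {t s u : List Bool} (h : XAct t s u) : m.X u = (m.X s)⁻¹ * m.X t * m.X s := by
  rw [mul_assoc, m.conj_x t s u h, inv_mul_cancel_left]

theorem X_conj' {t s u : List Bool} (h : XAct t s u) : m.X t = m.X s * m.X u * (m.X s)⁻¹ :=
  eq_mul_inv_of_mul_eq (m.conj_x t s u h)

theorem Y_conj {t s u : List Bool} (h : XAct t s u) (ht : A t) :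
    m.Y u = (m.X s)⁻¹ * m.Y t * m.X s := by
  rw [mul_assoc, m.conj_y t s u h ht, inv_mul_cancel_left]

theorem Y_conj' {t s u : List Bool} (h : XAct t s u) (ht : A t) :
    m.Y t = m.X s * m.Y u * (m.X s)⁻¹ :=
  eq_mul_inv_of_mul_eq (m.conj_y t s u h ht)

theorem X_zero (s : List Bool) : m.X (s ++ [false]) = m.X s ^ 2 * (m.X (s ++ [true]))⁻¹ * (m.X s)⁻¹ := by
  rw [m.pentagon]; group

theorem X_11 : m.X [true, true] = (m.X [])⁻¹ * m.X [true] * m.X [] := m.X_conj (XAct.one_nil [])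

theorem X_111 : m.X [true, true, true] = (m.X [])⁻¹ ^ 2 * m.X [true] * m.X [] ^ 2 := by
  rw [m.X_conj (XAct.one_nil [true]), m.X_11]; simp only [pow_succ, pow_zero, one_mul, mul_assoc]

theorem X_1111 : m.X [true, true, true, true] = (m.X [])⁻¹ ^ 3 * m.X [true] * m.X [] ^ 3 := by
  rw [m.X_conj (XAct.one_nil [true, true]), m.X_111]; simp only [pow_succ, pow_zero, one_mul, mul_assoc]

namespace Evaluates

variable {m} {π : FreeGroup (Fin 3) →* M} (h : m.Evaluates π)

include h

theorem x0 : π Word.x0 = m.X [false] := by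
  rw [show [false] = [] ++ [false] from rfl, m.X_zero, Word.x0]
  simp only [map_mul, map_pow, map_inv, h.a, h.b, List.nil_append]

theorem x11 : π Word.x11 = m.X [true, true] := by
  rw [m.X_11, Word.x11]
  simp only [map_mul, map_inv, h.a, h.b]

theorem x111 : π Word.x111 = m.X [true, true, true] := by
  rw [m.X_111, Word.x111]
  simp only [map_mul, map_pow, map_inv, h.a, h.b]

theorem x10 : π Word.x10 = m.X [true, false] := by
  rw [show [true, false] = [true] ++ [false] from rfl, m.X_zero,
    show [true] ++ [true] = [true, true] from rfl, m.X_11, Word.x10]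
  simp only [map_mul, map_pow, map_inv, h.a, h.b]
  group

theorem x01 : π Word.x01 = m.X [false, true] := by
  rw [m.X_conj' (XAct.zero_one_nil []), ← h.x10, Word.x01]
  simp only [map_mul, map_inv, h.a]

variable (hA : ∀ s, false ∈ s → true ∈ s → A s)

include hA

theorem y01 : π Word.y01 = m.Y [false, true] := by
  rw [m.Y_conj' (XAct.zero_one_nil []) (hA _ (by simp) (by simp)), Word.y01]
  simp only [map_mul, map_inv, h.a, h.c]

theorem y001 : π Word.y001 = m.Y [false, false, true] := by
  rw [m.Y_conj' (XAct.zero_zero_nil [true]) (hA _ (by simp) (by simp)), ← h.y01 hA, Word.y01,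
    Word.y001]
  simp only [map_mul, map_pow, map_inv, h.a, h.c]
  simp only [pow_succ, pow_zero, one_mul, mul_assoc]

theorem y100 : π Word.y100 = m.Y [true, false, false] := by
  rw [m.Y_conj' (XAct.one_zero_zero []) (hA _ (by simp) (by simp)), Word.y100]
  simp only [map_mul, map_inv, h.b, h.c]

/-- The conjugator reflects the path from 1010 by x_1 to 1100, by x⁻¹ to 100, and by x_1 to 10. -/
theorem y1010 : π Word.y1010 = m.Y [true, false, true, false] := by
  rw [m.Y_conj' (XAct.one_zero_one [false]) (hA _ (by simp) (by simp)),
    m.Y_conj (XAct.one_nil [false, false]) (hA _ (by simp) (by simp)), ← h.y100 hA, Word.y100,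
    Word.y1010]
  simp only [map_mul, map_inv, h.a, h.b, h.c]
  group

/-- The path leads from 1011 by x_1 to 1101, by x⁻¹ to 101, by x_1 to 110, and by x⁻¹ to 10. -/
theorem y1011 : π Word.y1011 = m.Y [true, false, true, true] := by
  rw [m.Y_conj' (XAct.one_zero_one [true]) (hA _ (by simp) (by simp)),
    m.Y_conj (XAct.one_nil [false, true]) (hA _ (by simp) (by simp)),
    m.Y_conj' (XAct.one_zero_one []) (hA _ (by simp) (by simp)),
    m.Y_conj (XAct.one_nil [false]) (hA _ (by simp) (by simp)), Word.y1011]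
  simp only [map_mul, map_inv, h.a, h.b, h.c]
  group

end Evaluates

end PreModel

/-! ### The finite presentation of `G₀` -/

/-- The word contains both digits. -/
def NonConst (s : List Bool) : Prop := false ∈ s ∧ true ∈ s

theorem isAdmissible_nonConst : IsAdmissible NonConst where
  append _ _ h := ⟨List.mem_append_left _ h.1, List.mem_append_left _ h.2⟩
  maps _ hf _ _ h ht := ⟨(mem_iff_of_maps hf h false).1 ht.1, (mem_iff_of_maps hf h true).1 ht.2⟩

theorem isAdmissible_true : IsAdmissible fun _ => True where
  append _ _ _ := trivial
  maps _ _ _ _ _ _ := trivial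

theorem NonConst.eq_of_rep {r : List Bool} (h : NonConst r) (hr : rep r = r) :
    r = [true, false] := by
  rw [← hr, rep, if_pos h.2, if_pos h.1]

theorem rep_mem (r : List Bool) : rep r = [] ∨ rep r = [false] ∨ rep r = [true] ∨
    rep r = [true, false] := by
  unfold rep
  split_ifs <;> simp

/-- The conjugation relations for the `x_s` alone. -/
def preModelOfHom {K : Type*} [Group K] (ψ : F →* K) (c : K) : PreModel (fun _ => False) K where
  X s := ψ (xF s)
  Y _ := c
  pentagon s := by
    rw [← map_pow, ← map_mul, ← map_mul]
    exact congrArg ψ (Subtype.ext (x_pentagon s))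
  conj_x t s u h := by
    rw [← map_mul, ← map_mul]
    exact congrArg ψ (Subtype.ext h.maps.x_mul)
  conj_y _ _ _ _ h := h.elim

theorem WeakModel.map_nine {A : List Bool → Prop} {M : Type*} [Group M] (m : WeakModel A M)
    (hA : ∀ s, false ∈ s → true ∈ s → A s) {π : FreeGroup (Fin 3) →* M}
    (h : m.toPreModel.Evaluates π) (i : Fin 9) : π (Word.nine i) = 1 := by
  have hcx {t : List Bool} (ht : XAct [true, false] t [true, false]) :=
    m.conj_y _ _ _ ht (hA _ (by simp) (by simp))
  have hinc {s t : List Bool} (h₁ : ¬ s <+: t) (h₂ : ¬ t <+: s) := XAct.incompatible s t h₁ h₂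
  fin_cases i
  · change π (Word.b * Word.a⁻¹ ^ 2 * Word.b * Word.a *
      (Word.a⁻¹ * Word.b * Word.a * Word.b * Word.a⁻¹)⁻¹) = 1
    -- The relation x_11 x_1 = x_1 x_111, written in a and b and multiplied by a⁻¹ on the right. The
    -- second one is x_111 x_1 = x_1 x_1111.
    have := m.conj_x _ _ _ (XAct.one [true] [])
    rw [show [true] ++ [true] = [true, true] from rfl,
      show [true] ++ [true, true] = [true, true, true] from rfl, m.X_11, m.X_111] at this
    rw [map_mul, map_inv, mul_inv_eq_one]
    simp only [map_mul, map_inv, map_pow, h.a, h.b]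
    rw [eq_mul_inv_iff_mul_eq, this, pow_two (m.X [])]
    simp only [mul_assoc]
  · change π (Word.b * Word.a⁻¹ ^ 3 * Word.b * Word.a ^ 2 *
      (Word.a⁻¹ ^ 2 * Word.b * Word.a ^ 2 * Word.b * Word.a⁻¹)⁻¹) = 1
    have := m.conj_x _ _ _ (XAct.one [true] [true])
    rw [show [true] ++ [true, true] = [true, true, true] from rfl,
      show [true] ++ [true, true, true] = [true, true, true, true] from rfl, m.X_111,
      m.X_1111] at this
    rw [map_mul, map_inv, mul_inv_eq_one]
    simp only [map_mul, map_inv, map_pow, h.a, h.b]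
    rw [eq_mul_inv_iff_mul_eq, this, pow_succ (m.X []) 2]
    simp only [mul_assoc]
  · change π (Word.c * Word.x0 * (Word.x0 * Word.c)⁻¹) = 1
    rw [map_mul, map_inv, mul_inv_eq_one, map_mul, map_mul, h.c, h.x0]
    exact hcx (hinc (by decide) (by decide))
  · change π (Word.c * Word.x01 * (Word.x01 * Word.c)⁻¹) = 1
    rw [map_mul, map_inv, mul_inv_eq_one, map_mul, map_mul, h.c, h.x01]
    exact hcx (hinc (by decide) (by decide))
  · change π (Word.c * Word.x11 * (Word.x11 * Word.c)⁻¹) = 1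
    rw [map_mul, map_inv, mul_inv_eq_one, map_mul, map_mul, h.c, h.x11]
    exact hcx (hinc (by decide) (by decide))
  · change π (Word.c * Word.x111 * (Word.x111 * Word.c)⁻¹) = 1
    rw [map_mul, map_inv, mul_inv_eq_one, map_mul, map_mul, h.c, h.x111]
    exact hcx (hinc (by decide) (by decide))
  · change π (Word.y01 * Word.c * (Word.c * Word.y01)⁻¹) = 1
    rw [map_mul, map_inv, mul_inv_eq_one, map_mul, map_mul, h.c, h.y01 hA]
    exact m.comm_y _ _ ⟨by decide, by decide⟩ (hA _ (by simp) (by simp)) (hA _ (by simp) (by simp))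
  · change π (Word.y001 * Word.c * (Word.c * Word.y001)⁻¹) = 1
    rw [map_mul, map_inv, mul_inv_eq_one, map_mul, map_mul, h.c, h.y001 hA]
    exact m.comm_y _ _ ⟨by decide, by decide⟩ (hA _ (by simp) (by simp)) (hA _ (by simp) (by simp))
  · change π (Word.c * (Word.x10 * Word.y100 * Word.y1010⁻¹ * Word.y1011)⁻¹) = 1
    rw [map_mul, map_inv, mul_inv_eq_one]
    simp only [map_mul, map_inv, h.c, h.x10, h.y100 hA, h.y1010 hA, h.y1011 hA]
    exact m.expand _ (hA _ (by simp) (by simp))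

theorem exists_hom_of_nine {K : Type*} [Group K] {π : FreeGroup (Fin 3) →* K}
    (h : ∀ i, π (Word.nine i) = 1) :
    ∃ ψ : F →* K, ψ (xF []) = π Word.a ∧ ψ (xF [true]) = π Word.b := by
  have h0 := h 0
  have h1 := h 1
  change π (Word.b * Word.a⁻¹ ^ 2 * Word.b * Word.a *
      (Word.a⁻¹ * Word.b * Word.a * Word.b * Word.a⁻¹)⁻¹) = 1 at h0
  change π (Word.b * Word.a⁻¹ ^ 3 * Word.b * Word.a ^ 2 *
      (Word.a⁻¹ ^ 2 * Word.b * Word.a ^ 2 * Word.b * Word.a⁻¹)⁻¹) = 1 at h1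
  rw [map_mul, map_inv, mul_inv_eq_one] at h0 h1
  simp only [map_mul, map_inv, map_pow] at h0 h1
  rw [eq_mul_inv_iff_mul_eq] at h0 h1
  refine exists_hom_F ?_ ?_
  · rw [← h0, pow_two (π Word.a)]
    simp only [mul_assoc]
  · rw [← h1, pow_succ (π Word.a) 2]
    simp only [mul_assoc]

/-- The relations say that `c` commutes with the elements of `F` that fix the cone `10`. -/
theorem commute_of_nine {K : Type*} [Group K] {π : FreeGroup (Fin 3) →* K}
    (h : ∀ i, π (Word.nine i) = 1) {ψ : F →* K} (ha : ψ (xF []) = π Word.a)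
    (hb : ψ (xF [true]) = π Word.b) {f : F} (hf : Maps f [true, false] [true, false]) :
    Commute (π Word.c) (ψ f) := by
  have e : (preModelOfHom ψ (π Word.c)).Evaluates π := ⟨ha.symm, hb.symm, rfl⟩
  have key {w v : FreeGroup (Fin 3)} (hw : π (w * v * (v * w)⁻¹) = 1) :
      Commute (π w) (π v) := by
    rwa [map_mul, map_inv, mul_inv_eq_one, map_mul, map_mul] at hw
  have h2 := key (h 2)
  have h3 := key (h 3)
  have h4 := key (h 4)
  have h5 := key (h 5)
  rw [e.x0] at h2
  rw [e.x01] at h3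
  rw [e.x11] at h4
  rw [e.x111] at h5
  exact commute_of_maps_10 h2 h3 h4 h5 hf

theorem map_baseY {A : List Bool → Prop} {K : Type*} [Group K] {ψ : F →* K} {C : List Bool → K}
    {φ : K →* RightPerm} (hφψ : ∀ f, φ (ψ f) = f) (hφC : ∀ r, rep r = r → A r → φ (C r) = y r)
    (hA : IsAdmissible A) {s : List Bool} (hs : A s) : φ (baseY ψ C s) = y s := by
  obtain ⟨hgF, hgs⟩ := (exists_maps_rep s).choose_spec
  have hrep : rep (rep s) = rep s := (rep_eq_of_maps hgF hgs).symm
  rw [baseY, map_mul, map_mul, map_inv, hφψ, hφC _ hrep (hA.maps _ hgF _ _ hgs hs),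
    mul_inv_eq_iff_eq_mul]
  exact hgs.y_mul.symm

theorem generates_of_mem {A : List Bool → Prop} {K : Type*} [Group K] {m : Model A K}
    {ι : Type*} {π : FreeGroup ι →* K} (hπ : Function.Surjective π)
    (h : ∀ i, (∃ s, m.ψ (xF s) = π (.of i)) ∨ ∃ s, A s ∧ m.Y s = π (.of i)) : m.Generates := by
  rw [Model.Generates, eq_top_iff, ← MonoidHom.range_eq_top.2 hπ, MonoidHom.range_eq_map,
    ← FreeGroup.closure_range_of, MonoidHom.map_closure, Subgroup.closure_le]
  rintro _ ⟨_, ⟨i, rfl⟩, rfl⟩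
  obtain ⟨f, hf⟩ | ⟨s, hs, e⟩ := h i
  · exact Subgroup.subset_closure (Or.inl ⟨f, hf⟩)
  · exact Subgroup.subset_closure (Or.inr ⟨s, hs, e⟩)

theorem comp_eq_subtype {K : Type*} [Group K] {ψ : F →* K} {φ : K →* RightPerm}
    (h : φ (ψ (xF [])) = x []) (h1 : φ (ψ (xF [true])) = x [true]) (f : F) : φ (ψ f) = f :=
  DFunLike.congr_fun (hom_F_ext (ψ := φ.comp ψ) (ψ' := F.subtype) h h1) f

/-- The nine relations imply the relations between the `x_s` and `y_s` with nonconstant `s`. -/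
theorem injective_of_nine {K : Type*} [Group K] {π : FreeGroup (Fin 3) →* K}
    (h : ∀ i, π (Word.nine i) = 1) (hπ : Function.Surjective π) {φ : K →* RightPerm}
    (ha : φ (π Word.a) = x []) (hb : φ (π Word.b) = x [true]) (hc : φ (π Word.c) = y [true, false]) :
    Function.Injective φ := by
  obtain ⟨ψ, hψa, hψb⟩ := exists_hom_of_nine h
  have hA := isAdmissible_nonConst
  obtain ⟨c, hcπ⟩ : ∃ c, π Word.c = c := ⟨_, rfl⟩
  have hC : ∀ r, rep r = r → NonConst r → ∀ f : F, Maps f r r →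
      Commute ((fun _ => c) r) (ψ f) := by
    intro r hr hn f hf
    obtain rfl := hn.eq_of_rep hr
    exact hcπ ▸ commute_of_nine h hψa hψb hf
  have h10 : NonConst [true, false] := ⟨by simp, by simp⟩
  have e : (basePreModel hA hC).Evaluates π :=
    ⟨hψa.symm, hψb.symm, hcπ.trans (baseY_rep hA hC rfl h10).symm⟩
  have hA' : ∀ s, false ∈ s → true ∈ s → NonConst s := fun _ h₁ h₂ => ⟨h₁, h₂⟩
  have h6 : π (Word.y01 * Word.c * (Word.c * Word.y01)⁻¹) = 1 := h 6
  have h7 : π (Word.y001 * Word.c * (Word.c * Word.y001)⁻¹) = 1 := h 7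
  have h8 : π (Word.c * (Word.x10 * Word.y100 * Word.y1010⁻¹ * Word.y1011)⁻¹) = 1 := h 8
  rw [map_mul, map_inv, mul_inv_eq_one, map_mul, map_mul, e.c] at h6 h7
  rw [e.y01 hA'] at h6
  rw [e.y001 hA'] at h7
  rw [map_mul, map_inv, mul_inv_eq_one] at h8
  simp only [map_mul, map_inv, e.c, e.x10, e.y100 hA', e.y1010 hA', e.y1011 hA'] at h8
  let m : Model NonConst K := baseModel hA hC
    (by
      intro i j k h₁ h₂
      -- Six of the base pairs contain a constant word. Only (01, 10) and (001, 10) remain.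
      cases i <;> cases j <;> cases k
      · exact absurd h₁ (by simp [basePair, NonConst])
      · exact absurd h₁ (by simp [basePair, NonConst])
      · exact absurd h₁ (by simp [basePair, NonConst])
      · exact absurd h₁ (by simp [basePair, NonConst])
      · exact absurd h₂ (by simp [basePair, NonConst])
      · exact absurd h₂ (by simp [basePair, NonConst])
      · exact h6
      · exact h7)
    (by
      intro r hr hn
      obtain rfl := hn.eq_of_rep hr
      exact h8)
  refine Model.Generates.injective (m := m) (generates_of_mem hπ fun i => ?_) hA
    (comp_eq_subtype (hψa ▸ ha) (hψb ▸ hb)) fun s hs => map_baseY (C := fun _ => c)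
      (comp_eq_subtype (hψa ▸ ha) (hψb ▸ hb)) (fun r hr hn => ?_) hA hs
  · fin_cases i
    · exact Or.inl ⟨_, hψa⟩
    · exact Or.inl ⟨_, hψb⟩
    · exact Or.inr ⟨_, h10, e.c.symm⟩
  · obtain rfl := hn.eq_of_rep hr
    exact hcπ ▸ hc

/-! ### A finite presentation of `G` -/

namespace Word

/-- Words in the letters `a`, `b`, `c` as words in `a`, `b`, `c` and three letters for `y_0`, `y_1`
and `y`. -/
def emb : FreeGroup (Fin 3) →* FreeGroup (Fin 6) := FreeGroup.map (Fin.castAdd 3)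

def y0 : FreeGroup (Fin 6) := FreeGroup.of 3
def y1 : FreeGroup (Fin 6) := FreeGroup.of 4
def ynil : FreeGroup (Fin 6) := FreeGroup.of 5
def y00 : FreeGroup (Fin 6) := emb a * y0 * (emb a)⁻¹
def y11 : FreeGroup (Fin 6) := (emb a)⁻¹ * y1 * emb a
def y111 : FreeGroup (Fin 6) := (emb a)⁻¹ * y11 * emb a
def y110 : FreeGroup (Fin 6) := (emb a)⁻¹ * emb c * emb a
def y101 : FreeGroup (Fin 6) := emb b * y110 * (emb b)⁻¹
def y010 : FreeGroup (Fin 6) := emb a * emb y100 * (emb a)⁻¹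
def y011 : FreeGroup (Fin 6) := emb a * y101 * (emb a)⁻¹

/-- The pairs of words that commute according to the finite presentation of `G`, other than words
in `a`, `b`, `c`. -/
def pairs : Fin 10 → FreeGroup (Fin 6) × FreeGroup (Fin 6) :=
  -- The first four pairs involve generators of the stabilizers of the cones of 0 and 1. The other
  -- six are the base pairs that contain a constant word.
  ![(y0, emb b), (y0, emb x11), (y1, emb x0), (y1, emb x01), (y0, y1), (y00, y1), (y0, emb c),
    (y00, emb c), (emb y01, y1), (emb y01, y11)]

/-- The expansions of `y_0`, `y_1` and `y`. -/
def expansions : Fin 3 → FreeGroup (Fin 6) :=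
  ![y0 * (emb x0 * y00 * y010⁻¹ * y011)⁻¹, y1 * (emb b * emb c * y110⁻¹ * y111)⁻¹,
    ynil * (emb a * y0 * (emb c)⁻¹ * y11)⁻¹]

/-- The relations of a finite presentation of `G`. -/
def finiteRels : Fin 9 ⊕ Fin 10 ⊕ Fin 3 → FreeGroup (Fin 6) :=
  Sum.elim (fun i => emb (nine i)) (Sum.elim
    (fun i => (pairs i).1 * (pairs i).2 * ((pairs i).2 * (pairs i).1)⁻¹) expansions)

end Word

namespace PreModel

variable {M : Type*} [Group M] (m : PreModel (fun _ => True) M)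

/-- The words in six letters evaluate to the expected elements. -/
structure EvaluatesAll (π : FreeGroup (Fin 6) →* M) : Prop where
  base : m.Evaluates (π.comp Word.emb)
  y0 : π Word.y0 = m.Y [false]
  y1 : π Word.y1 = m.Y [true]
  ynil : π Word.ynil = m.Y []

namespace EvaluatesAll

variable {m} {π : FreeGroup (Fin 6) →* M} (h : m.EvaluatesAll π)

include h

theorem a : π (Word.emb Word.a) = m.X [] := h.base.a

theorem b : π (Word.emb Word.b) = m.X [true] := h.base.b

theorem c : π (Word.emb Word.c) = m.Y [true, false] := h.base.c

theorem y00 : π Word.y00 = m.Y [false, false] := by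
  rw [m.Y_conj' (XAct.zero_zero_nil []) trivial, ← h.y0, ← h.a]; simp only [Word.y00, map_mul, map_inv]

theorem y11 : π Word.y11 = m.Y [true, true] := by
  rw [m.Y_conj (XAct.one_nil []) trivial, ← h.y1, ← h.a]; simp only [Word.y11, map_mul, map_inv]

theorem y111 : π Word.y111 = m.Y [true, true, true] := by
  rw [m.Y_conj (XAct.one_nil [true]) trivial, ← h.y11, ← h.a]
  simp only [Word.y111, map_mul, map_inv]

theorem y110 : π Word.y110 = m.Y [true, true, false] := by
  rw [m.Y_conj (XAct.one_nil [false]) trivial, ← h.c, ← h.a]; simp only [Word.y110, map_mul, map_inv]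

theorem y101 : π Word.y101 = m.Y [true, false, true] := by
  rw [m.Y_conj' (XAct.one_zero_one []) trivial, ← h.y110, ← h.b]
  simp only [Word.y101, map_mul, map_inv]

theorem y010 : π Word.y010 = m.Y [false, true, false] := by
  have h100 : π (Word.emb Word.y100) = m.Y [true, false, false] :=
    h.base.y100 fun _ _ _ => trivial
  rw [m.Y_conj' (XAct.zero_one_nil [false]) trivial, ← h100, ← h.a]
  simp only [Word.y010, map_mul, map_inv]

theorem y011 : π Word.y011 = m.Y [false, true, true] := by
  rw [m.Y_conj' (XAct.zero_one_nil [true]) trivial, ← h.y101, ← h.a]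
  simp only [Word.y011, map_mul, map_inv]

end EvaluatesAll

end PreModel

/-- The elements denoted by the words in `Word.pairs`. -/
theorem WeakModel.commute_pairs {M : Type*} [Group M] (m : WeakModel (fun _ => True) M)
    {π : FreeGroup (Fin 6) →* M} (h : m.toPreModel.EvaluatesAll π) (i : Fin 10) :
    Commute (π (Word.pairs i).1) (π (Word.pairs i).2) := by
  have hyx {s t : List Bool} (h₁ : ¬ s <+: t) (h₂ : ¬ t <+: s) : Commute (m.Y t) (m.X s) :=
    m.conj_y _ _ _ (XAct.incompatible s t h₁ h₂) trivial
  have hyy {s t : List Bool} (h₁ : Incomp s t) : Commute (m.Y s) (m.Y t) :=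
    m.comm_y _ _ h₁ trivial trivial
  have h01 : π (Word.emb Word.y01) = m.Y [false, true] := h.base.y01 fun _ _ _ => trivial
  have hx0 : π (Word.emb Word.x0) = m.X [false] := h.base.x0
  have hx01 : π (Word.emb Word.x01) = m.X [false, true] := h.base.x01
  have hx11 : π (Word.emb Word.x11) = m.X [true, true] := h.base.x11
  fin_cases i
  · change Commute (π Word.y0) (π (Word.emb Word.b))
    rw [h.y0, h.b]
    exact hyx (by decide) (by decide)
  · change Commute (π Word.y0) (π (Word.emb Word.x11))
    rw [h.y0, hx11]
    exact hyx (by decide) (by decide)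
  · change Commute (π Word.y1) (π (Word.emb Word.x0))
    rw [h.y1, hx0]
    exact hyx (by decide) (by decide)
  · change Commute (π Word.y1) (π (Word.emb Word.x01))
    rw [h.y1, hx01]
    exact hyx (by decide) (by decide)
  · change Commute (π Word.y0) (π Word.y1)
    rw [h.y0, h.y1]
    exact hyy ⟨by decide, by decide⟩
  · change Commute (π Word.y00) (π Word.y1)
    rw [h.y00, h.y1]
    exact hyy ⟨by decide, by decide⟩
  · change Commute (π Word.y0) (π (Word.emb Word.c))
    rw [h.y0, h.c]
    exact hyy ⟨by decide, by decide⟩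
  · change Commute (π Word.y00) (π (Word.emb Word.c))
    rw [h.y00, h.c]
    exact hyy ⟨by decide, by decide⟩
  · change Commute (π (Word.emb Word.y01)) (π Word.y1)
    rw [h01, h.y1]
    exact hyy ⟨by decide, by decide⟩
  · change Commute (π (Word.emb Word.y01)) (π Word.y11)
    rw [h01, h.y11]
    exact hyy ⟨by decide, by decide⟩

theorem WeakModel.map_finiteRels {M : Type*} [Group M] (m : WeakModel (fun _ => True) M)
    {π : FreeGroup (Fin 6) →* M} (h : m.toPreModel.EvaluatesAll π)
    (i : Fin 9 ⊕ Fin 10 ⊕ Fin 3) : π (Word.finiteRels i) = 1 := by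
  rcases i with i | i | i
  · exact m.map_nine (fun _ _ _ => trivial) h.base i
  · change π ((Word.pairs i).1 * (Word.pairs i).2 * ((Word.pairs i).2 * (Word.pairs i).1)⁻¹) = 1
    rw [map_mul, map_inv, mul_inv_eq_one, map_mul, map_mul]
    exact m.commute_pairs h i
  · have hx0 : π (Word.emb Word.x0) = m.X [false] := h.base.x0
    fin_cases i
    · change π (Word.y0 * (Word.emb Word.x0 * Word.y00 * Word.y010⁻¹ * Word.y011)⁻¹) = 1
      rw [map_mul, map_inv, mul_inv_eq_one]
      simp only [map_mul, map_inv, h.y0, hx0, h.y00, h.y010, h.y011]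
      exact m.expand _ trivial
    · change π (Word.y1 * (Word.emb Word.b * Word.emb Word.c * Word.y110⁻¹ * Word.y111)⁻¹) = 1
      rw [map_mul, map_inv, mul_inv_eq_one]
      simp only [map_mul, map_inv, h.y1, h.b, h.c, h.y110, h.y111]
      exact m.expand _ trivial
    · change π (Word.ynil * (Word.emb Word.a * Word.y0 * (Word.emb Word.c)⁻¹ * Word.y11)⁻¹) = 1
      rw [map_mul, map_inv, mul_inv_eq_one]
      simp only [map_mul, map_inv, h.ynil, h.a, h.y0, h.c, h.y11]
      exact m.expand _ trivial

/-- The finitely many relations imply all relations between the `x_s` and `y_s`. -/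
theorem injective_of_finiteRels {K : Type*} [Group K] {π : FreeGroup (Fin 6) →* K}
    (h : ∀ i, π (Word.finiteRels i) = 1) (hπ : Function.Surjective π) {φ : K →* RightPerm}
    (ha : φ (π (Word.emb Word.a)) = x []) (hb : φ (π (Word.emb Word.b)) = x [true])
    (hc : φ (π (Word.emb Word.c)) = y [true, false]) (h0 : φ (π Word.y0) = y [false])
    (h1 : φ (π Word.y1) = y [true]) (hnil : φ (π Word.ynil) = y []) :
    Function.Injective φ := by
  have hnine (i : Fin 9) : (π.comp Word.emb) (Word.nine i) = 1 := h (.inl i)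
  have hpairs (i : Fin 10) : Commute (π (Word.pairs i).1) (π (Word.pairs i).2) := by
    have := h (.inr (.inl i))
    change π ((Word.pairs i).1 * (Word.pairs i).2 * ((Word.pairs i).2 * (Word.pairs i).1)⁻¹) = 1
      at this
    rwa [map_mul, map_inv, mul_inv_eq_one, map_mul, map_mul] at this
  obtain ⟨ψ, hψa, hψb⟩ := exists_hom_of_nine hnine
  have hA := isAdmissible_true
  obtain ⟨C, hCnil, hC0, hC1, hC10⟩ : ∃ C : List Bool → K, C [] = π Word.ynil ∧
      C [false] = π Word.y0 ∧ C [true] = π Word.y1 ∧ C [true, false] = π (Word.emb Word.c) :=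
    ⟨fun s => if s = [] then π Word.ynil else if s = [false] then π Word.y0 else
      if s = [true] then π Word.y1 else π (Word.emb Word.c), by simp, by simp, by simp, by simp⟩
  have hC : ∀ r, rep r = r → True → ∀ f : F, Maps f r r → Commute (C r) (ψ f) := by
    have e : (preModelOfHom ψ (π (Word.emb Word.c))).Evaluates (π.comp Word.emb) :=
      ⟨hψa.symm, hψb.symm, rfl⟩
    have ex0 : π (Word.emb Word.x0) = ψ (xF [false]) := e.x0
    have ex01 : π (Word.emb Word.x01) = ψ (xF [false, true]) := e.x01
    have ex11 : π (Word.emb Word.x11) = ψ (xF [true, true]) := e.x11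
    intro r hr _ f hf
    -- There is one case for each orbit of words. The stabilizer of the cone of the empty word is
    -- trivial, so y itself needs no commutation relation.
    obtain hr' | hr' | hr' | hr' := rep_mem r <;> obtain rfl := hr.symm.trans hr'
    · exact commute_of_maps_nil hf
    · rw [hC0]
      refine commute_of_maps_0 ?_ ?_ hf
      · rw [hψb]; exact hpairs 0
      · exact ex11 ▸ hpairs 1
    · rw [hC1]
      refine commute_of_maps_1 ?_ ?_ hf
      · exact ex0 ▸ hpairs 2
      · exact ex01 ▸ hpairs 3
    · rw [hC10]
      exact commute_of_nine hnine hψa hψb hf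
  have e : (basePreModel hA hC).EvaluatesAll π :=
    ⟨⟨hψa.symm, hψb.symm, hC10.symm.trans (baseY_rep hA hC rfl trivial).symm⟩,
      hC0.symm.trans (baseY_rep hA hC rfl trivial).symm,
      hC1.symm.trans (baseY_rep hA hC rfl trivial).symm,
      hCnil.symm.trans (baseY_rep hA hC rfl trivial).symm⟩
  have hA' : ∀ s : List Bool, false ∈ s → true ∈ s → True := fun _ _ _ => trivial
  have e01 := e.base.y01 hA'
  have e001 := e.base.y001 hA'
  have hcomm : ∀ i j k, True → True →
      Commute (baseY ψ C (basePair i j k).1) (baseY ψ C (basePair i j k).2) := by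
    have key {w v : FreeGroup (Fin 6)} {s t : List Bool} (h : π w = (basePreModel hA hC).Y s)
        (h' : π v = (basePreModel hA hC).Y t) (H : Commute (π w) (π v)) :
        Commute (baseY ψ C s) (baseY ψ C t) := by
      rw [h, h'] at H
      exact H
    intro i j k _ _
    cases i <;> cases j <;> cases k
    · exact key e.y0 e.y1 (hpairs 4)
    · exact key e.y00 e.y1 (hpairs 5)
    · exact key e.y0 e.c (hpairs 6)
    · exact key e.y00 e.c (hpairs 7)
    · exact key e01 e.y1 (hpairs 8)
    · exact key e01 e.y11 (hpairs 9)
    · have h6 := hnine 6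
      change (π.comp Word.emb) (Word.y01 * Word.c * (Word.c * Word.y01)⁻¹) = 1 at h6
      rwa [map_mul, map_inv, mul_inv_eq_one, map_mul, map_mul, e.base.c, e01] at h6
    · have h7 := hnine 7
      change (π.comp Word.emb) (Word.y001 * Word.c * (Word.c * Word.y001)⁻¹) = 1 at h7
      rwa [map_mul, map_inv, mul_inv_eq_one, map_mul, map_mul, e.base.c, e001] at h7
  have hexp : ∀ r, rep r = r → True → baseY ψ C r = ψ (xF r) * baseY ψ C (r ++ [false]) *
      (baseY ψ C (r ++ [true, false]))⁻¹ * baseY ψ C (r ++ [true, true]) := by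
    have ex0 : π (Word.emb Word.x0) = ψ (xF [false]) := e.base.x0
    have h2 := h (.inr (.inr 2))
    change π (Word.ynil * (Word.emb Word.a * Word.y0 * (Word.emb Word.c)⁻¹ * Word.y11)⁻¹) = 1 at h2
    have h1 := h (.inr (.inr 1))
    change π (Word.y1 * (Word.emb Word.b * Word.emb Word.c * Word.y110⁻¹ * Word.y111)⁻¹) = 1 at h1
    have h0 := h (.inr (.inr 0))
    change π (Word.y0 * (Word.emb Word.x0 * Word.y00 * Word.y010⁻¹ * Word.y011)⁻¹) = 1 at h0
    rw [map_mul, map_inv, mul_inv_eq_one] at h0 h1 h2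
    simp only [map_mul, map_inv, e.y0, ex0, e.y00, e.y010, e.y011] at h0
    simp only [map_mul, map_inv, e.y1, e.b, e.c, e.y110, e.y111] at h1
    simp only [map_mul, map_inv, e.ynil, e.a, e.y0, e.c, e.y11] at h2
    intro r hr _
    obtain hr' | hr' | hr' | hr' := rep_mem r <;> obtain rfl := hr.symm.trans hr'
    · exact h2
    · exact h0
    · exact h1
    · have h8 := hnine 8
      change (π.comp Word.emb)
        (Word.c * (Word.x10 * Word.y100 * Word.y1010⁻¹ * Word.y1011)⁻¹) = 1 at h8
      rw [map_mul, map_inv, mul_inv_eq_one] at h8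
      simp only [map_mul, map_inv, e.base.c, e.base.x10, e.base.y100 hA', e.base.y1010 hA',
        e.base.y1011 hA'] at h8
      exact h8
  let m : Model (fun _ => True) K := baseModel hA hC (fun i j k _ _ => hcomm i j k trivial trivial)
    (fun r hr _ => hexp r hr trivial)
  have hφψ := comp_eq_subtype (φ := φ) (ψ := ψ) (hψa ▸ ha) (hψb ▸ hb)
  refine Model.Generates.injective (m := m) (generates_of_mem hπ fun i => ?_) hA hφψ
    fun s hs => map_baseY (A := fun _ => True) (C := C) hφψ (fun r hr _ => ?_) hA hs
  · fin_cases i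
    · exact Or.inl ⟨_, hψa⟩
    · exact Or.inl ⟨_, hψb⟩
    · exact Or.inr ⟨_, trivial, e.c.symm⟩
    · exact Or.inr ⟨_, trivial, e.y0.symm⟩
    · exact Or.inr ⟨_, trivial, e.y1.symm⟩
    · exact Or.inr ⟨_, trivial, e.ynil.symm⟩
  · obtain hr' | hr' | hr' | hr' := rep_mem r <;> obtain rfl := hr.symm.trans hr'
    · exact hCnil ▸ hnil
    · exact hC0 ▸ h0
    · exact hC1 ▸ h1
    · exact hC10 ▸ hc

/-! ### Presentations -/

theorem isPresentation_of_injective {ι K : Type*} [Group K] {f : ι → K} {rels : Set (FreeGroup ι)}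
    {H : Subgroup K} (hH : Subgroup.closure (Set.range f) = H)
    (h : ∀ r ∈ rels, FreeGroup.lift f r = 1)
    (hinj : Function.Injective (PresentedGroup.toGroup h)) : IsPresentation f rels H := by
  refine ⟨(FreeGroup.range_lift_eq_closure ..).trans hH, le_antisymm (fun w hw => ?_)
    (Subgroup.normalClosure_le_normal h)⟩
  refine PresentedGroup.mk_eq_one_iff.1 (hinj ?_)
  rw [map_one]
  exact hw

theorem IsPresentation.isFinitelyPresented {n : ℕ} {K : Type*} [Group K] {f : Fin n → K}
    {rels : Set (FreeGroup (Fin n))} {H : Subgroup K} (h : IsPresentation f rels H)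
    (hfin : rels.Finite) : Group.IsFinitelyPresented H := by
  obtain ⟨rfl, hker⟩ := h
  refine ⟨n, (FreeGroup.lift f).rangeRestrict, (FreeGroup.lift f).rangeRestrict_surjective,
    rels, hfin, ?_⟩
  rw [MonoidHom.ker_rangeRestrict, hker]

/-- The elements `x_s` and `y_s` of the group of permutations. -/
def permModel (A : List Bool → Prop) : WeakModel A RightPerm where
  X := x
  Y := y
  pentagon := x_pentagon
  conj_x _ _ _ h := h.maps.x_mul
  conj_y _ _ _ h _ := h.maps.y_mul
  comm_y _ _ h _ _ := commute_y h
  expand s _ := y_expand s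

/-- The elements `x_s` and `y_s` of the group presented by `R`. -/
def presentedModel : WeakModel (fun _ => True) (PresentedGroup R) where
  X s := PresentedGroup.mk R (fx s)
  Y s := PresentedGroup.mk R (fy s)
  pentagon s := PresentedGroup.mk_eq_mk_of_mul_inv_mem (R.pentagon s)
  conj_x t s u h := PresentedGroup.mk_eq_mk_of_mul_inv_mem (R.conj_x s t u h)
  conj_y t s u h _ := PresentedGroup.mk_eq_mk_of_mul_inv_mem (R.conj_y s t u h)
  comm_y s t h _ _ := PresentedGroup.mk_eq_mk_of_mul_inv_mem (R.comm_y s t h.1 h.2)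
  expand s _ := PresentedGroup.mk_eq_mk_of_mul_inv_mem (R.expand s)

/-- The symbol `x_s` of `S₀`. -/
def fx₀ (s : List Bool) : FreeGroup S₀ := FreeGroup.of ⟨Gen.x s, fun _ h => nomatch h⟩

open scoped Classical in
/-- The symbol `y_s` of `S₀`. -/
noncomputable def fy₀ (s : List Bool) : FreeGroup S₀ :=
  if h : NonConst s then FreeGroup.of ⟨Gen.y s, fun _ h' => Gen.y.inj h' ▸ h⟩ else 1

theorem map_fx₀ (s : List Bool) : FreeGroup.map (Subtype.val : S₀ → Gen) (fx₀ s) = fx s := rfl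

theorem map_fy₀ {s : List Bool} (h : NonConst s) :
    FreeGroup.map (Subtype.val : S₀ → Gen) (fy₀ s) = fy s := by
  rw [fy₀, dif_pos h]; rfl

theorem mk_R₀_eq {v w : FreeGroup S₀} {v' w' : FreeGroup Gen} (h : v' * w'⁻¹ ∈ R)
    (hv : FreeGroup.map Subtype.val v = v') (hw : FreeGroup.map Subtype.val w = w') :
    PresentedGroup.mk R₀ v = PresentedGroup.mk R₀ w :=
  PresentedGroup.mk_eq_mk_of_mul_inv_mem <| show FreeGroup.map Subtype.val (v * w⁻¹) ∈ R by
    rwa [map_mul, map_inv, hv, hw]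

/-- The elements `x_s` and `y_s` of the group presented by `R₀`. -/
noncomputable def presentedModel₀ : WeakModel NonConst (PresentedGroup R₀) where
  X s := PresentedGroup.mk R₀ (fx₀ s)
  Y s := PresentedGroup.mk R₀ (fy₀ s)
  pentagon s := mk_R₀_eq (R.pentagon s) rfl rfl
  conj_x t s u h := mk_R₀_eq (R.conj_x s t u h) rfl rfl
  conj_y t s u h ht := mk_R₀_eq (R.conj_y s t u h) (by rw [map_mul, map_fy₀ ht, map_fx₀]) (by
    rw [map_mul, map_fy₀ (isAdmissible_nonConst.maps _ (x_mem_F s) _ _ h.maps ht), map_fx₀])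
  comm_y s t h hs ht := mk_R₀_eq (R.comm_y s t h.1 h.2) (by rw [map_mul, map_fy₀ hs, map_fy₀ ht])
    (by rw [map_mul, map_fy₀ hs, map_fy₀ ht])
  expand s hs := mk_R₀_eq (R.expand s) (map_fy₀ hs) (by
    rw [map_mul, map_mul, map_mul, map_inv, map_fx₀, map_fy₀ (isAdmissible_nonConst.append _ _ hs),
      map_fy₀ (isAdmissible_nonConst.append _ _ hs), map_fy₀ (isAdmissible_nonConst.append _ _ hs)])

/-! ### Finite generating sets -/

namespace PreModel

variable {M : Type*} [Group M]

theorem Evaluates.surjective {m : PreModel NonConst M} {π : FreeGroup (Fin 3) →* M}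
    (h : m.Evaluates π) (hM : Subgroup.closure (Set.range m.X ∪ m.Y '' {s | NonConst s}) = ⊤) :
    Function.Surjective π := by
  have hX (s) : m.X s ∈ π.range := m.X_mem (H := π.range) ⟨_, h.a⟩ ⟨_, h.b⟩ s
  rw [← MonoidHom.range_eq_top, eq_top_iff, ← hM, Subgroup.closure_le]
  rintro _ (⟨s, rfl⟩ | ⟨s, hs, rfl⟩)
  · exact hX s
  · exact m.Y_mem isAdmissible_nonConst hX (fun h => absurd h (by simp [NonConst]))
      (fun h => absurd h (by simp [NonConst])) (fun h => absurd h (by simp [NonConst]))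
      (fun _ => ⟨_, h.c⟩) s hs

theorem EvaluatesAll.surjective {m : PreModel (fun _ => True) M} {π : FreeGroup (Fin 6) →* M}
    (h : m.EvaluatesAll π) (hM : Subgroup.closure (Set.range m.X ∪ Set.range m.Y) = ⊤) :
    Function.Surjective π := by
  have hX (s) : m.X s ∈ π.range := m.X_mem (H := π.range) ⟨_, h.a⟩ ⟨_, h.b⟩ s
  rw [← MonoidHom.range_eq_top, eq_top_iff, ← hM, Subgroup.closure_le]
  rintro _ (⟨s, rfl⟩ | ⟨s, rfl⟩)
  · exact hX s
  · exact m.Y_mem isAdmissible_true hX (fun _ => ⟨_, h.ynil⟩) (fun _ => ⟨_, h.y0⟩)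
      (fun _ => ⟨_, h.y1⟩) (fun _ => ⟨_, h.c⟩) s trivial

end PreModel

theorem y_mem_G₀ {s : List Bool} (hs : NonConst s) (hX : ∀ s, x s ∈ G₀) : y s ∈ G₀ :=
  (permModel NonConst).Y_mem isAdmissible_nonConst hX (fun h => absurd h (by simp [NonConst]))
      (fun h => absurd h (by simp [NonConst])) (fun h => absurd h (by simp [NonConst]))
      (fun _ => Subgroup.subset_closure (by simp [permModel])) s hs

theorem x_mem_G₀ (s : List Bool) : x s ∈ G₀ :=
  (permModel NonConst).X_mem (Subgroup.subset_closure (by simp [permModel]))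
    (Subgroup.subset_closure (by simp [permModel])) s

theorem closure_range_eval : Subgroup.closure (Set.range Gen.eval) = G := by
  refine congrArg _ (Set.ext fun g => ⟨?_, ?_⟩)
  · rintro ⟨s | s, rfl⟩
    exacts [Or.inl ⟨s, rfl⟩, Or.inr ⟨s, rfl⟩]
  · rintro (⟨s, rfl⟩ | ⟨s, rfl⟩)
    exacts [⟨Gen.x s, rfl⟩, ⟨Gen.y s, rfl⟩]

theorem closure_range_eval₀ : Subgroup.closure (Set.range fun g : S₀ => Gen.eval g) = G₀ := by
  refine le_antisymm ((Subgroup.closure_le _).2 ?_) (Subgroup.closure_mono ?_)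
  · rintro _ ⟨⟨s | s, hs⟩, rfl⟩
    exacts [x_mem_G₀ s, y_mem_G₀ (hs s rfl) x_mem_G₀]
  · rintro _ (rfl | rfl | rfl)
    · exact ⟨⟨Gen.x [], fun _ h => nomatch h⟩, rfl⟩
    · exact ⟨⟨Gen.x [true], fun _ h => nomatch h⟩, rfl⟩
    · exact ⟨⟨Gen.y [true, false], fun _ h' => Gen.y.inj h' ▸ ⟨by simp, by simp⟩⟩, rfl⟩

/-- The generators of `G₀`. -/
def gens₀ : Fin 3 → RightPerm := ![x [], x [true], y [true, false]]

/-- Finitely many generators of `G`. -/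
def gens : Fin 6 → RightPerm :=
  ![x [], x [true], y [true, false], y [false], y [true], y []]

theorem evaluates_gens₀ : (permModel NonConst).Evaluates (FreeGroup.lift gens₀) :=
  ⟨FreeGroup.lift_apply_of, FreeGroup.lift_apply_of, FreeGroup.lift_apply_of⟩

theorem evaluatesAll_gens :
    (permModel fun _ => True).EvaluatesAll (FreeGroup.lift gens) :=
  ⟨⟨FreeGroup.lift_apply_of, FreeGroup.lift_apply_of, FreeGroup.lift_apply_of⟩,
    FreeGroup.lift_apply_of, FreeGroup.lift_apply_of, FreeGroup.lift_apply_of⟩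

theorem closure_range_gens₀ : Subgroup.closure (Set.range gens₀) = G₀ := by
  rw [gens₀, G₀, Matrix.range_cons, Matrix.range_cons, Matrix.range_cons, Matrix.range_empty,
    Set.union_empty]
  rfl

theorem closure_range_gens : Subgroup.closure (Set.range gens) = G := by
  refine le_antisymm (Subgroup.closure_mono ?_) ((Subgroup.closure_le _).2 ?_)
  · rintro _ ⟨i, rfl⟩
    fin_cases i
    exacts [Or.inl ⟨_, rfl⟩, Or.inl ⟨_, rfl⟩, Or.inr ⟨_, rfl⟩, Or.inr ⟨_, rfl⟩, Or.inr ⟨_, rfl⟩,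
      Or.inr ⟨_, rfl⟩]
  · have hg (i : Fin 6) : gens i ∈ Subgroup.closure (Set.range gens) :=
      Subgroup.subset_closure ⟨i, rfl⟩
    have hX (s) : x s ∈ Subgroup.closure (Set.range gens) :=
      (permModel fun _ => True).X_mem (hg 0) (hg 1) s
    rintro _ (⟨s, rfl⟩ | ⟨s, rfl⟩)
    · exact hX s
    · exact (permModel fun _ => True).Y_mem isAdmissible_true hX (fun _ => hg 5) (fun _ => hg 3)
        (fun _ => hg 4) (fun _ => hg 2) s trivial

/-- Here K is the group presented by the nine relations, mapped to permutations. -/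
theorem isPresentation_nine : IsPresentation gens₀ (Set.range Word.nine) G₀ := by
  refine isPresentation_of_injective closure_range_gens₀ ?_
    (injective_of_nine (π := PresentedGroup.mk _)
      (fun i => PresentedGroup.one_of_mem (Set.mem_range_self i)) (PresentedGroup.mk_surjective _) ?_ ?_ ?_)
  · rintro _ ⟨i, rfl⟩
    exact (permModel NonConst).map_nine (fun _ h₁ h₂ => ⟨h₁, h₂⟩) evaluates_gens₀ i
  all_goals exact PresentedGroup.toGroup.of _

theorem isPresentation_finiteRels : IsPresentation gens (Set.range Word.finiteRels) G := by
  refine isPresentation_of_injective closure_range_gens ?_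
    (injective_of_finiteRels (π := PresentedGroup.mk _)
      (fun i => PresentedGroup.one_of_mem (Set.mem_range_self i)) (PresentedGroup.mk_surjective _) ?_ ?_ ?_
      ?_ ?_ ?_)
  · rintro _ ⟨i, rfl⟩
    exact (permModel fun _ => True).map_finiteRels evaluatesAll_gens i
  all_goals exact PresentedGroup.toGroup.of _

/-- The group presented by R satisfies the finitely many relations and is generated by six of its
symbols, so `injective_of_finiteRels` applies to it. The same argument with `injective_of_nine`
handles R₀. -/
theorem isPresentation_R : IsPresentation Gen.eval R G := by
  let m := presentedModel
  let π : FreeGroup (Fin 6) →* PresentedGroup R := FreeGroup.lift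
    ![m.X [], m.X [true], m.Y [true, false], m.Y [false], m.Y [true], m.Y []]
  have e : m.EvaluatesAll π :=
    ⟨⟨FreeGroup.lift_apply_of, FreeGroup.lift_apply_of, FreeGroup.lift_apply_of⟩,
      FreeGroup.lift_apply_of, FreeGroup.lift_apply_of, FreeGroup.lift_apply_of⟩
  refine isPresentation_of_injective closure_range_eval (fun _ h => lift_eval_of_mem_R h)
    (injective_of_finiteRels (π := π) (m.map_finiteRels e) (e.surjective ?_) ?_ ?_ ?_ ?_ ?_ ?_)
  · rw [eq_top_iff, ← PresentedGroup.closure_range_of]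
    refine Subgroup.closure_mono ?_
    rintro _ ⟨s | s, rfl⟩
    exacts [Or.inl ⟨s, rfl⟩, Or.inr ⟨s, rfl⟩]
  · rw [e.a]; exact PresentedGroup.toGroup.of _
  · rw [e.b]; exact PresentedGroup.toGroup.of _
  · rw [e.c]; exact PresentedGroup.toGroup.of _
  · rw [e.y0]; exact PresentedGroup.toGroup.of _
  · rw [e.y1]; exact PresentedGroup.toGroup.of _
  · rw [e.ynil]; exact PresentedGroup.toGroup.of _

theorem isPresentation_R₀ : IsPresentation (fun g : S₀ => Gen.eval g) R₀ G₀ := by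
  let m := presentedModel₀
  let π : FreeGroup (Fin 3) →* PresentedGroup R₀ := FreeGroup.lift
    ![m.X [], m.X [true], m.Y [true, false]]
  have e : m.Evaluates π :=
    ⟨FreeGroup.lift_apply_of, FreeGroup.lift_apply_of, FreeGroup.lift_apply_of⟩
  have hY {s : List Bool} (h : NonConst s) : m.Y s =
      PresentedGroup.of (⟨Gen.y s, fun _ h' => Gen.y.inj h' ▸ h⟩ : S₀) :=
    congrArg (PresentedGroup.mk R₀) (dif_pos h)
  refine isPresentation_of_injective closure_range_eval₀ (fun w h => ?_)
    (injective_of_nine (π := π) (m.map_nine (fun _ h₁ h₂ => ⟨h₁, h₂⟩) e) (e.surjective ?_) ?_ ?_ ?_)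
  · have : FreeGroup.lift (fun g : S₀ => Gen.eval g) =
        (FreeGroup.lift Gen.eval).comp (FreeGroup.map Subtype.val) :=
      FreeGroup.ext_hom _ _ fun _ => rfl
    rw [this]
    exact lift_eval_of_mem_R h
  · rw [eq_top_iff, ← PresentedGroup.closure_range_of]
    refine Subgroup.closure_mono ?_
    rintro _ ⟨⟨s | s, hs⟩, rfl⟩
    exacts [Or.inl ⟨s, rfl⟩, Or.inr ⟨s, hs s rfl, hY (hs s rfl)⟩]
  · rw [e.a]; exact PresentedGroup.toGroup.of _
  · rw [e.b]; exact PresentedGroup.toGroup.of _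
  · rw [e.c, hY ⟨by simp, by simp⟩]; exact PresentedGroup.toGroup.of _

end Cantor

theorem mainTheorem2 :
    Cantor.IsPresentation Cantor.Gen.eval Cantor.R Cantor.G ∧
    Cantor.IsPresentation (fun g : Cantor.S₀ => Cantor.Gen.eval g) Cantor.R₀ Cantor.G₀ ∧
    Group.IsFinitelyPresented Cantor.G ∧
    Group.IsFinitelyPresented Cantor.G₀ ∧
    Cantor.IsPresentation ![Cantor.x [], Cantor.x [true], Cantor.y [true, false]]
      (Set.range Cantor.Word.nine) Cantor.G₀ :=
  ⟨Cantor.isPresentation_R, Cantor.isPresentation_R₀,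
    Cantor.isPresentation_finiteRels.isFinitelyPresented (Set.finite_range _),
    Cantor.isPresentation_nine.isFinitelyPresented (Set.finite_range _),
    Cantor.isPresentation_nine⟩
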